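/- **Setting.** Let $1\le K$ and let $A\in\mathbb R^{p\times K}$, $\beta\in\mathbb R^K$. Let $Z\in\mathbb R^K$, $E\in\mathbb R^p$ and $\varepsilon\in\mathbb R$ be mutually independent, centred and square integrable, and put $$X=AZ+E,\qquad y=Z^\top\beta+\varepsilon,$$ with $\Sigma_Z=\mathrm{Cov}(Z)$, $\Sigma_E=\mathrm{Cov}(E)$, $\sigma_\varepsilon^2=\mathrm{Var}(\varepsilon)$. Let $(Z_i,E_i,\varepsilon_i)$, $i=1,\dots,n$, be i.i.d. copies of $(Z,E,\varepsilon)$, put $X_i=AZ_i+E_i$, $y_i=Z_i^\top\beta+\varepsilon_i$, let $\mathbf X\in\mathbb R^{n\times p}$ be the matrix with rows $X_i$, and $\mathbf y=(y_1,\dots,y_n)^\top$. Let $\widehat\alpha=\mathbf X^+\mathbf y$, where $\mathbf X^+$ is the Moore–Penrose pseudo-inverse, let $R(\alpha)=\mathbb E_{X,y}[(X^\top\alpha-y)^2]$ for $\alpha\in\mathbb R^p$ (expectation over a new data point independent of the sample), and let $\alpha^*\in\arg\min_{\alpha\in\mathbb R^p}R(\alpha)$. For a random variable $U$ let $\|U\|_{\psi_2}=\inf\{t>0:\mathbb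 E\exp(U^2/t^2)\le 2\}$, and for a random vector $V$ let $\|V\|_{\psi_2}=\sup_{\|u\|=1}\|V^\top u\|_{\psi_2}$. For a positive semi-definite $Q$ let $\lambda_k(Q)$ be its $k$-th largest eigenvalue, $\|Q\|$ its operator norm, $\mathrm{r_e}(Q)=\mathrm{tr}(Q)/\|Q\|$ (and $\mathrm{r_e}(0)=1$), and $\|v\|_Q^2=v^\top Qv$. Let $\xi=\lambda_K(A\Sigma_ZA^\top)/\|\Sigma_E\|$. **Theorem.** For every $L\ge 0$ there are constants $C,c,C'>0$ depending only on $L$ such that the following holds for all $n$, $K\ge1$, $p$ and all models as above. Suppose that 1. $A$ and $\Sigma_Z$ both have rank $K$; 2. $E=\Sigma_E^{1/2}\tilde E$ a.s., where $\tilde E\in\mathbb R^p$ has independent entries with zero mean, unit variance and $\|\cdot\|_{\psi_2}$-norm at most $L$; $Z=\Sigma_Z^{1/2}\tilde Z$ a.s., where the random vector $\tilde Z\in\mathbb R^K$ has zero mean and $\|\tilde Z\|_{\psi_2}\le L$; $\varepsilon=\sigma_\varepsilon\tilde\varepsilon$ a.s., where $\tilde\varepsilon$ has zero mean and $\|\tilde\varepsilon\|_{\psi_2}\le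 L$; 3. $n>C\cdot K$ and $\mathrm{r_e}(\Sigma_E)>C\cdot n$. Then a minimizer $\alpha^*$ of $R$ exists, and for every such $\alpha^*$, with probability (over the sample) exceeding $1-c/n$, $$R(\widehat\alpha)-R(\alpha^*)\le R(\widehat\alpha)-\sigma_\varepsilon^2\le C'\left(\frac{\|\beta\|_{\Sigma_Z}^2}{\xi}\cdot\frac{\mathrm{r_e}(\Sigma_E)}{n}+\sigma_\varepsilon^2\,\frac{n\log n}{\mathrm{r_e}(\Sigma_E)}+\sigma_\varepsilon^2\,\frac{K\log n}{n}\right).$$ -/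

import Mathlib

open MeasureTheory ProbabilityTheory
open scoped NNReal ENNReal Matrix

namespace FactorRegression

/-! ### Matrices -/

section Matrices

/-- The four Penrose conditions: `N` is a Moore–Penrose pseudo-inverse of `M`. -/
structure IsMoorePenrose {m n : ℕ} (M : Matrix (Fin m) (Fin n) ℝ)
    (N : Matrix (Fin n) (Fin m) ℝ) : Prop where
  mul_inv_mul : M * N * M = M
  inv_mul_inv : N * M * N = N
  symm_mul_inv : (M * N)ᵀ = M * N
  symm_inv_mul : (N * M)ᵀ = N * M

theorem IsMoorePenrose.unique {m n : ℕ} {M : Matrix (Fin m) (Fin n) ℝ}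
    {N N' : Matrix (Fin n) (Fin m) ℝ} (h : IsMoorePenrose M N) (h' : IsMoorePenrose M N') :
    N = N' := by
  have e1 : M * N = M * N' := by
    have a : M * N' * (M * N) = M * N := by rw [← Matrix.mul_assoc, h'.mul_inv_mul]
    have b : M * N * (M * N') = M * N' := by rw [← Matrix.mul_assoc, h.mul_inv_mul]
    have c := congrArg Matrix.transpose a
    rw [Matrix.transpose_mul, h.symm_mul_inv, h'.symm_mul_inv, b] at c
    exact c.symm
  have e2 : N * M = N' * M := by
    have a : N * M * (N' * M) = N * M := by
      rw [Matrix.mul_assoc, ← Matrix.mul_assoc M, h'.mul_inv_mul]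
    have b : N' * M * (N * M) = N' * M := by
      rw [Matrix.mul_assoc, ← Matrix.mul_assoc M, h.mul_inv_mul]
    have c := congrArg Matrix.transpose a
    rw [Matrix.transpose_mul, h.symm_inv_mul, h'.symm_inv_mul, b] at c
    exact c.symm
  rw [← h.inv_mul_inv, e2, Matrix.mul_assoc, e1, ← Matrix.mul_assoc, h'.inv_mul_inv]

theorem exists_isMoorePenrose {m n : ℕ} (M : Matrix (Fin m) (Fin n) ℝ) :
    ∃ N, IsMoorePenrose M N := by
  set G : Matrix (Fin n) (Fin n) ℝ := Mᵀ * M with hG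
  have hGs : IsSelfAdjoint G := by
    rw [isSelfAdjoint_iff, Matrix.star_eq_conjTranspose, Matrix.conjTranspose_eq_transpose_of_trivial,
      hG, Matrix.transpose_mul, Matrix.transpose_transpose]
  set H : Matrix (Fin n) (Fin n) ℝ := cfc (fun x : ℝ => x⁻¹) G with hH
  have hfin : (spectrum ℝ G).Finite := Matrix.finite_real_spectrum
  have hc : ∀ f : ℝ → ℝ, ContinuousOn f (spectrum ℝ G) := fun f => hfin.continuousOn f
  have hHs : Hᵀ = H := by
    have : IsSelfAdjoint H := cfc_predicate _ _
    rwa [isSelfAdjoint_iff, Matrix.star_eq_conjTranspose,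
      Matrix.conjTranspose_eq_transpose_of_trivial] at this
  have hGt : Gᵀ = G := by
    rwa [isSelfAdjoint_iff, Matrix.star_eq_conjTranspose,
      Matrix.conjTranspose_eq_transpose_of_trivial] at hGs
  have hcomm : G * H = H * G := by
    have h := (cfc_commute_cfc (fun x : ℝ => x) (fun x : ℝ => x⁻¹) G).eq
    rwa [cfc_id' ℝ G] at h
  have hGH : G * H = cfc (fun x : ℝ => x * x⁻¹) G := by
    rw [cfc_mul _ _ G (hc _) (hc _), cfc_id' ℝ G]
  have hGHG : G * H * G = G := by
    conv_lhs => rw [hGH, ← cfc_id' ℝ G]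
    rw [cfc_id' ℝ G]
    nth_rewrite 2 [← cfc_id' ℝ G]
    rw [← cfc_mul _ _ G (hc _) (hc _)]
    conv_rhs => rw [← cfc_id' ℝ G]
    congr 1; funext x
    exact mul_inv_mul_cancel x
  have hHGH : H * G * H = H := by
    rw [Matrix.mul_assoc, hGH, hH, ← cfc_mul _ _ G (hc _) (hc _)]
    congr 1; funext x
    by_cases hx : x = 0 <;> simp [hx]
  have hM : M * (H * G) = M := by
    have h0 : Mᴴ * M * (H * G - 1) = 0 := by
      rw [Matrix.conjTranspose_eq_transpose_of_trivial, ← hG, Matrix.mul_sub, ← Matrix.mul_assoc,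
        hGHG, Matrix.mul_one, sub_self]
    rw [Matrix.conjTranspose_mul_self_mul_eq_zero, Matrix.mul_sub, Matrix.mul_one, sub_eq_zero] at h0
    exact h0
  refine ⟨H * Mᵀ, ?_, ?_, ?_, ?_⟩
  · rw [Matrix.mul_assoc, Matrix.mul_assoc H, ← hG, hM]
  · rw [Matrix.mul_assoc H, ← hG, ← Matrix.mul_assoc, hHGH]
  · rw [Matrix.transpose_mul, Matrix.transpose_mul, Matrix.transpose_transpose, hHs,
      Matrix.mul_assoc]
  · rw [Matrix.mul_assoc, ← hG, Matrix.transpose_mul, hHs, hGt, hcomm]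
/-- The Moore–Penrose pseudo-inverse `M⁺`. -/
noncomputable def pinv {m n : ℕ} (M : Matrix (Fin m) (Fin n) ℝ) : Matrix (Fin n) (Fin m) ℝ :=
  Classical.choose (exists_isMoorePenrose M)

theorem pinv_isMoorePenrose {m n : ℕ} (M : Matrix (Fin m) (Fin n) ℝ) :
    IsMoorePenrose M (pinv M) :=
  Classical.choose_spec (exists_isMoorePenrose M)

section OpNorm

open scoped Matrix.Norms.L2Operator

/-- The operator norm of a matrix with respect to the Euclidean norms. -/
noncomputable def opNorm {m n : ℕ} (M : Matrix (Fin m) (Fin n) ℝ) : ℝ := ‖M‖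

end OpNorm

section Sqrt

open scoped MatrixOrder

/-- The positive semi-definite square root `Q^{1/2}` of a positive semi-definite matrix. -/
noncomputable def psdSqrt {p : ℕ} (Q : Matrix (Fin p) (Fin p) ℝ) : Matrix (Fin p) (Fin p) ℝ :=
  CFC.sqrt Q

end Sqrt

open Classical in
/-- `λ_k(Q)`: the `k`-th largest eigenvalue (`1 ≤ k ≤ p`, with multiplicity) of a symmetric
`p × p` matrix; the value is `0` outside this range. -/
noncomputable def eigenvalueDesc {p : ℕ} (Q : Matrix (Fin p) (Fin p) ℝ) (k : ℕ) : ℝ :=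
  if h : Q.IsHermitian ∧ 1 ≤ k ∧ k - 1 < Fintype.card (Fin p) then
    h.1.eigenvalues₀ ⟨k - 1, h.2.2⟩
  else 0

open Classical in
/-- The effective rank `r_e(Q) = tr(Q) / ‖Q‖`, with the convention `r_e(0) = 1`. -/
noncomputable def effRank {p : ℕ} (Q : Matrix (Fin p) (Fin p) ℝ) : ℝ :=
  if Q = 0 then 1 else Q.trace / opNorm Q

end Matrices

/-! ### Probability -/

section Probability

variable {Ω : Type*} [MeasurableSpace Ω]

/-- The sub-Gaussian norm `‖U‖_{ψ₂} = inf {t > 0 : E exp(U² / t²) ≤ 2}`, equal to `∞` when no such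
`t` exists. -/
noncomputable def psi2Norm (U : Ω → ℝ) (P : Measure Ω) : ℝ≥0∞ :=
  ⨅ (t : ℝ≥0) (_ : 0 < t)
    (_ : ∫⁻ ω, ENNReal.ofReal (Real.exp (U ω ^ 2 / (t : ℝ) ^ 2)) ∂P ≤ 2), (t : ℝ≥0∞)

/-- The sub-Gaussian norm of a random vector: the supremum of the sub-Gaussian norms of its
one-dimensional marginals `⟨V, u⟩` over all Euclidean unit vectors `u`. -/
noncomputable def vecPsi2Norm {d : ℕ} (V : Ω → Fin d → ℝ) (P : Measure Ω) : ℝ≥0∞ :=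
  ⨆ (u : Fin d → ℝ) (_ : u ⬝ᵥ u = 1), psi2Norm (fun ω => V ω ⬝ᵥ u) P

/-- The covariance matrix of a random vector. -/
noncomputable def covMat {d : ℕ} (V : Ω → Fin d → ℝ) (P : Measure Ω) :
    Matrix (Fin d) (Fin d) ℝ :=
  Matrix.of fun i j => cov[fun ω => V ω i, fun ω => V ω j; P]

end Probability

/-! ### The factor regression model -/

section Model

variable {Ω₀ Ω : Type*} [MeasurableSpace Ω₀] [MeasurableSpace Ω] {n K p : ℕ}

/-- The features `X = A Z + E`. -/
def feature (A : Matrix (Fin p) (Fin K) ℝ) (z : Fin K → ℝ) (e : Fin p → ℝ) : Fin p → ℝ :=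
  A *ᵥ z + e

/-- The response `y = Zᵀ β + ε`. -/
def response (β : Fin K → ℝ) (z : Fin K → ℝ) (e : ℝ) : ℝ := z ⬝ᵥ β + e

/-- The latent variables of the factor regression model: square integrable, centred and mutually
independent `Z`, `E` and `ε`. -/
structure IsLatentModel (P₀ : Measure Ω₀) (Z : Ω₀ → Fin K → ℝ) (E : Ω₀ → Fin p → ℝ)
    (ε : Ω₀ → ℝ) : Prop where
  measurable_Z : Measurable Z
  measurable_E : Measurable E
  measurable_ε : Measurable ε
  memLp_Z : ∀ k, MemLp (fun ω => Z ω k) 2 P₀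
  memLp_E : ∀ j, MemLp (fun ω => E ω j) 2 P₀
  memLp_ε : MemLp ε 2 P₀
  mean_Z : ∀ k, ∫ ω, Z ω k ∂P₀ = 0
  mean_E : ∀ j, ∫ ω, E ω j ∂P₀ = 0
  mean_ε : ∫ ω, ε ω ∂P₀ = 0
  indep_Z : IndepFun Z (fun ω => (E ω, ε ω)) P₀
  indep_E_ε : IndepFun E ε P₀

/-- `E = Σ_E^{1/2} Ẽ`, where `Ẽ` has independent entries with zero mean, unit variance and
sub-Gaussian norms at most `L`. -/
def IsSubGaussianNoise (L : ℝ≥0) (P₀ : Measure Ω₀) (E : Ω₀ → Fin p → ℝ) : Prop :=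
  ∃ E' : Ω₀ → Fin p → ℝ, Measurable E' ∧
    (∀ᵐ ω ∂P₀, E ω = psdSqrt (covMat E P₀) *ᵥ E' ω) ∧
    iIndepFun (fun j ω => E' ω j) P₀ ∧
    (∀ j, ∫ ω, E' ω j ∂P₀ = 0) ∧
    (∀ j, Var[fun ω => E' ω j; P₀] = 1) ∧
    ∀ j, psi2Norm (fun ω => E' ω j) P₀ ≤ L

/-- `Z = Σ_Z^{1/2} Z̃`, where the random vector `Z̃` has zero mean and sub-Gaussian norm at
most `L`. -/
def IsSubGaussianFactor (L : ℝ≥0) (P₀ : Measure Ω₀) (Z : Ω₀ → Fin K → ℝ) : Prop :=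
  ∃ Z' : Ω₀ → Fin K → ℝ, Measurable Z' ∧
    (∀ᵐ ω ∂P₀, Z ω = psdSqrt (covMat Z P₀) *ᵥ Z' ω) ∧
    (∀ k, ∫ ω, Z' ω k ∂P₀ = 0) ∧
    vecPsi2Norm Z' P₀ ≤ L

/-- `ε = σ_ε ε̃`, where `σ_ε² = Var(ε)` and `ε̃` has zero mean and sub-Gaussian norm at most `L`. -/
def IsSubGaussianResponseNoise (L : ℝ≥0) (P₀ : Measure Ω₀) (ε : Ω₀ → ℝ) : Prop :=
  ∃ ε' : Ω₀ → ℝ, Measurable ε' ∧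
    (∀ᵐ ω ∂P₀, ε ω = Real.sqrt (Var[ε; P₀]) * ε' ω) ∧
    ∫ ω, ε' ω ∂P₀ = 0 ∧
    psi2Norm ε' P₀ ≤ L

/-- The triples `(Z_i, E_i, ε_i)`, `i = 1, …, n`, are i.i.d. copies of `(Z, E, ε)`. -/
structure IsSample (P : Measure Ω) (Zs : Fin n → Ω → Fin K → ℝ) (Es : Fin n → Ω → Fin p → ℝ)
    (εs : Fin n → Ω → ℝ) (P₀ : Measure Ω₀) (Z : Ω₀ → Fin K → ℝ) (E : Ω₀ → Fin p → ℝ)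
    (ε : Ω₀ → ℝ) : Prop where
  measurable_Z : ∀ i, Measurable (Zs i)
  measurable_E : ∀ i, Measurable (Es i)
  measurable_ε : ∀ i, Measurable (εs i)
  indep : iIndepFun (fun i ω => (Zs i ω, Es i ω, εs i ω)) P
  ident : ∀ i, IdentDistrib (fun ω => (Zs i ω, Es i ω, εs i ω)) (fun ω => (Z ω, E ω, ε ω)) P P₀

/-- The prediction risk `R(α) = E[(Xᵀ α - y)²]`, the expectation being over a new data point. -/
noncomputable def risk (P₀ : Measure Ω₀) (A : Matrix (Fin p) (Fin K) ℝ) (β : Fin K → ℝ)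
    (Z : Ω₀ → Fin K → ℝ) (E : Ω₀ → Fin p → ℝ) (ε : Ω₀ → ℝ) (α : Fin p → ℝ) : ℝ :=
  ∫ ω, (feature A (Z ω) (E ω) ⬝ᵥ α - response β (Z ω) (ε ω)) ^ 2 ∂P₀

/-- The minimum-norm estimator `α̂ = 𝐗⁺ 𝐲`, where `𝐗` has rows `X_i` and `𝐲` has entries `y_i`. -/
noncomputable def minNormEstimator (A : Matrix (Fin p) (Fin K) ℝ) (β : Fin K → ℝ)
    (Zs : Fin n → Ω → Fin K → ℝ) (Es : Fin n → Ω → Fin p → ℝ) (εs : Fin n → Ω → ℝ) (ω : Ω) :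
    Fin p → ℝ :=
  pinv (Matrix.of fun i => feature A (Zs i ω) (Es i ω)) *ᵥ fun i => response β (Zs i ω) (εs i ω)

/-- The signal-to-noise ratio `ξ = λ_K(A Σ_Z Aᵀ) / ‖Σ_E‖`, as a function of `A`, `Σ_Z`
and `Σ_E`. -/
noncomputable def snr (A : Matrix (Fin p) (Fin K) ℝ) (SZ : Matrix (Fin K) (Fin K) ℝ)
    (SE : Matrix (Fin p) (Fin p) ℝ) : ℝ :=
  eigenvalueDesc (A * SZ * Aᵀ) K / opNorm SE

end Model

end FactorRegression

open FactorRegression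

/-!
Write the design as `𝐗 = F Aᵀ + N`, with `F` the matrix of the factors `Z_i` and `N` that of the
noise vectors `E_i`. When `𝐗 𝐗ᵀ` is invertible, `𝐗⁺ = 𝐗ᵀ (𝐗 𝐗ᵀ)⁻¹`, and `R(α̂) - σ_ε²` is at most
twice the sum of a bias, which comes from the signal `Fβ`, and a variance, which is the sum of two
quadratic forms in the response noise. Both are controlled by three facts about the design:

* `N Nᵀ ≲ tr(Σ_E)`;
* `𝐗 𝐗ᵀ ≳ tr(Σ_E)`, because projecting the rows of `𝐗` onto the orthogonal complement of the range
  of `A` removes the signal, while it costs at most `K ‖Σ_E‖` of the trace of `Σ_E`;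
* `Fᵀ F ≳ n Σ_Z`.

For the bias, `β = Aᵀ x` with `|x|² ≤ ‖β‖²_{Σ_Z} / λ_K(A Σ_Z Aᵀ)`, so `Fβ = 𝐗 x - N x`. For the
variance, given the design, the quadratic forms in the response noise exceed their means by at most
a factor of order `log n` outside an event of probability `O(1 / n)`.

The three facts follow from two tail bounds for `ξᵀ M ξ`, with `M` positive semi-definite, through a
net of the unit sphere. For the upper one, which holds for any sub-Gaussian `ξ`, the exponential
moment of the form is a Gaussian average of exponential moments of linear forms in `ξ`. For the
lower one, with independent entries, the diagonal part is a sum of independent terms with bounded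
fourth moments, and the off-diagonal part is decoupled by averaging over the subsets of the indices.
-/

namespace FactorRegression

section ExpMoment

variable {Ω : Type*} [MeasurableSpace Ω] {P : Measure Ω}

/-- The exponential moment `E exp(f)`, taken in `[0, ∞]` so that no integrability is presupposed. -/
noncomputable def expMoment (f : Ω → ℝ) (P : Measure Ω) : ℝ≥0∞ :=
  ∫⁻ ω, ENNReal.ofReal (Real.exp (f ω)) ∂P

theorem expMoment_mono {f g : Ω → ℝ} (h : ∀ ω, f ω ≤ g ω) : expMoment f P ≤ expMoment g P :=
  lintegral_mono fun ω => ENNReal.ofReal_le_ofReal (Real.exp_le_exp.2 (h ω))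

theorem expMoment_map {Ω' : Type*} [MeasurableSpace Ω'] {X : Ω → Ω'} (hX : Measurable X)
    {f : Ω' → ℝ} (hf : Measurable f) :
    expMoment f (P.map X) = expMoment (fun ω => f (X ω)) P :=
  lintegral_map (by fun_prop) hX

theorem expMoment_eq_ofReal_integral {f : Ω → ℝ} (hf : Integrable (fun ω => Real.exp (f ω)) P) :
    expMoment f P = ENNReal.ofReal (∫ ω, Real.exp (f ω) ∂P) :=
  (ofReal_integral_eq_lintegral_ofReal hf (ae_of_all _ fun _ => (Real.exp_pos _).le)).symm

theorem integrable_exp_of_expMoment_ne_top {f : Ω → ℝ} (hf : Measurable f)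
    (h : expMoment f P ≠ ∞) : Integrable (fun ω => Real.exp (f ω)) P := by
  refine ⟨by fun_prop, ?_⟩
  rw [hasFiniteIntegral_iff_ofReal (ae_of_all _ fun _ => (Real.exp_pos _).le)]
  exact h.lt_top

theorem expMoment_lintegral_swap {Ω' : Type*} [MeasurableSpace Ω'] {Q : Measure Ω'} [SFinite P]
    [SFinite Q] {f : Ω → Ω' → ℝ} (hf : Measurable (Function.uncurry f)) :
    ∫⁻ ω, expMoment (f ω) Q ∂P = ∫⁻ ω', expMoment (fun ω => f ω ω') P ∂Q :=
  lintegral_lintegral_swap (f := fun ω ω' => ENNReal.ofReal (Real.exp (f ω ω')))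
    (by fun_prop)

theorem expMoment_sum_of_iIndepFun {ι : Type*} [Fintype ι] {f : ι → Ω → ℝ}
    (hind : iIndepFun f P) (hf : ∀ i, Measurable (f i)) :
    expMoment (fun ω => ∑ i, f i ω) P = ∏ i, expMoment (f i) P := by
  have hexp : Measurable fun x : ℝ => ENNReal.ofReal (Real.exp x) := by fun_prop
  simp_rw [expMoment, Real.exp_sum, ENNReal.ofReal_prod_of_nonneg fun _ _ => (Real.exp_pos _).le]
  exact lintegral_prod_eq_prod_lintegral_of_indepFun Finset.univ
    (fun i ω => ENNReal.ofReal (Real.exp (f i ω))) (hind.comp (fun _ => _) fun _ => hexp)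
    fun i => hexp.comp (hf i)

theorem expMoment_sum_le_of_iIndepFun {ι : Type*} [Fintype ι] {f : ι → Ω → ℝ} {a : ι → ℝ}
    (hind : iIndepFun f P) (hf : ∀ i, Measurable (f i))
    (h : ∀ i, expMoment (f i) P ≤ ENNReal.ofReal (Real.exp (a i))) :
    expMoment (fun ω => ∑ i, f i ω) P ≤ ENNReal.ofReal (Real.exp (∑ i, a i)) := by
  rw [expMoment_sum_of_iIndepFun hind hf, Real.exp_sum,
    ENNReal.ofReal_prod_of_nonneg fun _ _ => (Real.exp_pos _).le]
  exact Finset.prod_le_prod' fun i _ => h i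

theorem expMoment_pi_sum {ι : Type*} [Fintype ι] {X : ι → Type*} [∀ i, MeasurableSpace (X i)]
    (μ : ∀ i, Measure (X i)) [∀ i, IsProbabilityMeasure (μ i)] {f : ∀ i, X i → ℝ}
    (hf : ∀ i, Measurable (f i)) :
    expMoment (fun x => ∑ i, f i (x i)) (Measure.pi μ) = ∏ i, expMoment (f i) (μ i) := by
  rw [expMoment_sum_of_iIndepFun (iIndepFun_pi fun i => (hf i).aemeasurable)
    fun i => (hf i).comp (measurable_pi_apply i)]
  refine Finset.prod_congr rfl fun i _ => ?_
  rw [← expMoment_map (measurable_pi_apply i) (hf i), (measurePreserving_eval μ i).map_eq]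

theorem expMoment_sum_mul_le_of_forall_le {ι : Type*} [Fintype ι] {w : ι → ℝ} (hw : ∀ i, 0 ≤ w i)
    (hw_sum : ∑ i, w i = 1) {f : ι → Ω → ℝ} (hf : ∀ i, Measurable (f i)) {b : ℝ≥0∞}
    (h : ∀ i, expMoment (f i) P ≤ b) : expMoment (fun ω => ∑ i, w i * f i ω) P ≤ b := by
  calc expMoment (fun ω => ∑ i, w i * f i ω) P
      ≤ ∫⁻ ω, ∑ i, ENNReal.ofReal (w i) * ENNReal.ofReal (Real.exp (f i ω)) ∂P := by
        refine lintegral_mono fun ω => ?_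
        simp_rw [← fun i => ENNReal.ofReal_mul (q := Real.exp (f i ω)) (hw i)]
        rw [← ENNReal.ofReal_sum_of_nonneg fun i _ => mul_nonneg (hw i) (Real.exp_pos _).le]
        exact ENNReal.ofReal_le_ofReal (convexOn_exp.map_sum_le (fun i _ => hw i) hw_sum
          fun _ _ => Set.mem_univ _)
    _ = ∑ i, ENNReal.ofReal (w i) * expMoment (f i) P := by
        rw [lintegral_finsetSum _ fun i _ => by fun_prop]
        exact Finset.sum_congr rfl fun i _ => lintegral_const_mul' _ _ ENNReal.ofReal_ne_top
    _ ≤ ∑ i, ENNReal.ofReal (w i) * b := Finset.sum_le_sum fun i _ => by gcongr; exact h i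
    _ = b := by
        rw [← Finset.sum_mul, ← ENNReal.ofReal_sum_of_nonneg fun i _ => hw i, hw_sum,
          ENNReal.ofReal_one, one_mul]

theorem expMoment_add_le {f g : Ω → ℝ} (hf : Measurable f) (hg : Measurable g) {a b : ℝ}
    (hfa : expMoment (fun ω => 2 * f ω) P ≤ ENNReal.ofReal (Real.exp (2 * a)))
    (hgb : expMoment (fun ω => 2 * g ω) P ≤ ENNReal.ofReal (Real.exp (2 * b))) :
    expMoment (fun ω => f ω + g ω) P ≤ ENNReal.ofReal (Real.exp (a + b)) := by
  have hsq : ∀ x : ℝ, ENNReal.ofReal (Real.exp x) ^ (2 : ℝ) =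
      ENNReal.ofReal (Real.exp (2 * x)) := fun x => by
    rw [ENNReal.ofReal_rpow_of_pos (Real.exp_pos _), ← Real.exp_mul, mul_comm]
  have hroot : ∀ {y : ℝ≥0∞} {x : ℝ}, y ≤ ENNReal.ofReal (Real.exp (2 * x)) →
      y ^ (1 / 2 : ℝ) ≤ ENNReal.ofReal (Real.exp x) := fun {y x} h => by
    rw [← ENNReal.rpow_le_rpow_iff (z := 2) (by norm_num), ← ENNReal.rpow_mul, hsq]
    simpa using h
  calc expMoment (fun ω => f ω + g ω) P
      = ∫⁻ ω, ENNReal.ofReal (Real.exp (f ω)) * ENNReal.ofReal (Real.exp (g ω)) ∂P := by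
        simp_rw [expMoment, Real.exp_add, ENNReal.ofReal_mul (Real.exp_pos _).le]
    _ ≤ (expMoment (fun ω => 2 * f ω) P) ^ (1 / 2 : ℝ) *
          (expMoment (fun ω => 2 * g ω) P) ^ (1 / 2 : ℝ) := by
        simp_rw [expMoment, ← hsq]
        exact ENNReal.lintegral_mul_le_Lp_mul_Lq P Real.HolderConjugate.two_two
          (by fun_prop) (by fun_prop)
    _ ≤ ENNReal.ofReal (Real.exp (a + b)) := by
        rw [Real.exp_add, ENNReal.ofReal_mul (Real.exp_pos _).le]
        exact mul_le_mul' (hroot hfa) (hroot hgb)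

theorem measure_le_of_expMoment_le {f : Ω → ℝ} (hf : Measurable f) {a : ℝ}
    (h : expMoment f P ≤ ENNReal.ofReal (Real.exp a)) (b : ℝ) :
    P {ω | b ≤ f ω} ≤ ENNReal.ofReal (Real.exp (a - b)) := by
  have hset : {ω | b ≤ f ω} =
      {ω | ENNReal.ofReal (Real.exp b) ≤ ENNReal.ofReal (Real.exp (f ω))} := by
    ext ω
    simp [ENNReal.ofReal_le_ofReal_iff (Real.exp_pos _).le]
  rw [hset, Real.exp_sub, ENNReal.ofReal_div_of_pos (Real.exp_pos _)]
  exact (meas_ge_le_lintegral_div (by fun_prop) (by simp [Real.exp_pos])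
    ENNReal.ofReal_ne_top).trans (by gcongr; exact h)

end ExpMoment

section ScalarSubgaussian

theorem exp_le_add_exp_sq (x : ℝ) : Real.exp x ≤ x + Real.exp (x ^ 2) := by
  have hsq := Real.add_one_le_exp (x ^ 2)
  rcases le_or_gt 1 x with h | h
  · have : Real.exp x ≤ Real.exp (x ^ 2) := Real.exp_le_exp.2 (by nlinarith)
    linarith
  rcases le_or_gt (-1) x with h' | h'
  · linarith [(abs_le.1 (Real.abs_exp_sub_one_sub_id_le (abs_le.2 ⟨h', h.le⟩))).2]
  · have : Real.exp x ≤ 1 := Real.exp_le_one_iff.2 (by linarith)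
    nlinarith

theorem exp_mul_le_one_sub_add {θ : ℝ} (h0 : 0 ≤ θ) (h1 : θ ≤ 1) (a : ℝ) :
    Real.exp (θ * a) ≤ 1 - θ + θ * Real.exp a := by
  simpa using convexOn_exp.2 (Set.mem_univ 0) (Set.mem_univ a) (sub_nonneg.2 h1) h0 (by ring)

theorem exp_neg_le_one_sub_add_sq {x : ℝ} (hx : 0 ≤ x) :
    Real.exp (-x) ≤ 1 - x + x ^ 2 / 2 := by
  have hexp := Real.quadratic_le_exp_of_nonneg hx
  rw [Real.exp_neg, inv_le_comm₀ (Real.exp_pos x) (by nlinarith [sq_nonneg (x - 1)])]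
  refine le_trans ?_ hexp
  rw [inv_le_iff_one_le_mul₀ (by nlinarith [sq_nonneg (x - 1)])]
  nlinarith [pow_nonneg hx 4]

theorem pow_four_le_exp_add_exp_neg (x : ℝ) :
    x ^ 4 ≤ 24 * (Real.exp x + Real.exp (-x)) := by
  have habs := Real.pow_div_factorial_le_exp |x| (abs_nonneg x) 4
  have hmax := Real.exp_abs_le x
  rw [Even.pow_abs ⟨2, rfl⟩] at habs
  norm_num [Nat.factorial] at habs
  linarith

variable {Ω : Type*} [MeasurableSpace Ω] {P : Measure Ω} {U : Ω → ℝ}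

theorem expMoment_mul_le_of_hasSubgaussianMGF {c : ℝ≥0} (h : HasSubgaussianMGF U c P) (t : ℝ) :
    expMoment (fun ω => t * U ω) P ≤ ENNReal.ofReal (Real.exp (c * t ^ 2 / 2)) := by
  rw [expMoment_eq_ofReal_integral (h.integrable_exp_mul t)]
  exact ENNReal.ofReal_le_ofReal (h.mgf_le t)

theorem hasSubgaussianMGF_mono {c c' : ℝ≥0} (h : HasSubgaussianMGF U c P) (hcc' : c ≤ c') :
    HasSubgaussianMGF U c' P :=
  ⟨h.integrable_exp_mul, fun t => (h.mgf_le t).trans (by gcongr)⟩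

theorem expMoment_sq_div_le_two_of_psi2Norm_lt {T : ℝ≥0} (h : psi2Norm U P < T) :
    expMoment (fun ω => U ω ^ 2 / (T : ℝ) ^ 2) P ≤ 2 := by
  simp only [psi2Norm, iInf_lt_iff] at h
  obtain ⟨t, ht_pos, ht, htT⟩ := h
  have : (0 : ℝ) < t := by exact_mod_cast ht_pos
  have : (t : ℝ) ≤ T := by exact_mod_cast htT.le
  refine (expMoment_mono fun ω => ?_).trans ht
  gcongr

theorem exp_mul_le_exp_mul_one_add_exp {T : ℝ} (hT : 0 < T) (s u : ℝ) :
    Real.exp (s * u) ≤ Real.exp (T ^ 2 * s ^ 2 / 2) * ((1 + Real.exp (u ^ 2 / T ^ 2)) / 2) := by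
  have hyoung : s * u ≤ T ^ 2 * s ^ 2 / 2 + 1 / 2 * (u ^ 2 / T ^ 2) := by
    have : s * u = (T * s) * (u / T) := by field_simp
    rw [← div_pow, this]
    nlinarith [sq_nonneg (T * s - u / T)]
  calc Real.exp (s * u)
      ≤ Real.exp (T ^ 2 * s ^ 2 / 2) * Real.exp (1 / 2 * (u ^ 2 / T ^ 2)) := by
        rw [← Real.exp_add]
        exact Real.exp_le_exp.2 hyoung
    _ ≤ _ := by
        gcongr
        linarith [exp_mul_le_one_sub_add (θ := 1 / 2) (by norm_num) (by norm_num) (u ^ 2 / T ^ 2)]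

theorem integrable_exp_mul_of_integrable_exp_sq_div [IsFiniteMeasure P] (hU : Measurable U)
    {T : ℝ} (hT : 0 < T) (h : Integrable (fun ω => Real.exp (U ω ^ 2 / T ^ 2)) P) (s : ℝ) :
    Integrable (fun ω => Real.exp (s * U ω)) P := by
  have hdom : Integrable (fun ω =>
      Real.exp (T ^ 2 * s ^ 2 / 2) * ((1 + Real.exp (U ω ^ 2 / T ^ 2)) / 2)) P := by fun_prop
  refine hdom.mono' (by fun_prop) (ae_of_all _ fun ω => ?_)
  simpa using exp_mul_le_exp_mul_one_add_exp hT s (U ω)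

theorem mgf_le_of_integral_exp_sq_div_le_two [IsProbabilityMeasure P] (hU : Measurable U)
    (hmean : ∫ ω, U ω ∂P = 0) {T : ℝ} (hT : 0 < T)
    (hint : Integrable (fun ω => Real.exp (U ω ^ 2 / T ^ 2)) P)
    (h : ∫ ω, Real.exp (U ω ^ 2 / T ^ 2) ∂P ≤ 2) (s : ℝ) :
    mgf U P s ≤ Real.exp (T ^ 2 * s ^ 2) := by
  have hint_exp := integrable_exp_mul_of_integrable_exp_sq_div hU hT hint
  have hU_int : Integrable U P := by
    simpa using integrable_pow_of_integrable_exp_mul one_ne_zero (hint_exp 1) (hint_exp (-1)) 1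
  have hθ : 0 ≤ T ^ 2 * s ^ 2 := by positivity
  rcases le_or_gt (T ^ 2 * s ^ 2) 1 with hs | hs
  · calc mgf U P s
        ≤ ∫ ω, (s * U ω + (1 - T ^ 2 * s ^ 2 + T ^ 2 * s ^ 2 * Real.exp (U ω ^ 2 / T ^ 2))) ∂P := by
          refine integral_mono (hint_exp s) (by fun_prop) fun ω => (exp_le_add_exp_sq _).trans ?_
          have := exp_mul_le_one_sub_add hθ hs (U ω ^ 2 / T ^ 2)
          rwa [show T ^ 2 * s ^ 2 * (U ω ^ 2 / T ^ 2) = (s * U ω) ^ 2 by field_simp,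
            ← add_le_add_iff_left (s * U ω)] at this
      _ = 1 - T ^ 2 * s ^ 2 + T ^ 2 * s ^ 2 * ∫ ω, Real.exp (U ω ^ 2 / T ^ 2) ∂P := by
          rw [integral_add (by fun_prop) (by fun_prop), integral_add (by fun_prop) (by fun_prop),
            integral_const_mul, integral_const_mul, hmean]
          simp
      _ ≤ Real.exp (T ^ 2 * s ^ 2) := by
          nlinarith [Real.add_one_le_exp (T ^ 2 * s ^ 2), mul_le_mul_of_nonneg_left h hθ]
  · calc mgf U P s
        ≤ ∫ ω, Real.exp (T ^ 2 * s ^ 2 / 2) * ((1 + Real.exp (U ω ^ 2 / T ^ 2)) / 2) ∂P :=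
          integral_mono (hint_exp s) (by fun_prop) fun ω =>
            exp_mul_le_exp_mul_one_add_exp hT s (U ω)
      _ = Real.exp (T ^ 2 * s ^ 2 / 2) * ((1 + ∫ ω, Real.exp (U ω ^ 2 / T ^ 2) ∂P) / 2) := by
          rw [integral_const_mul, integral_div, integral_add (by fun_prop) hint]
          simp
      _ ≤ Real.exp (T ^ 2 * s ^ 2 / 2) * Real.exp (T ^ 2 * s ^ 2 / 2) := by
          gcongr
          linarith [Real.add_one_le_exp (T ^ 2 * s ^ 2 / 2)]
      _ = Real.exp (T ^ 2 * s ^ 2) := by rw [← Real.exp_add, add_halves]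

theorem hasSubgaussianMGF_of_psi2Norm_lt [IsProbabilityMeasure P] (hU : Measurable U)
    (hmean : ∫ ω, U ω ∂P = 0) {T : ℝ≥0} (h : psi2Norm U P < T) :
    HasSubgaussianMGF U (2 * T ^ 2) P := by
  have hT : (0 : ℝ) < T := by simpa using bot_le.trans_lt h
  have hsq := expMoment_sq_div_le_two_of_psi2Norm_lt h
  have hint : Integrable (fun ω => Real.exp (U ω ^ 2 / (T : ℝ) ^ 2)) P :=
    integrable_exp_of_expMoment_ne_top (by fun_prop) (hsq.trans_lt (by simp)).ne
  rw [expMoment_eq_ofReal_integral hint] at hsq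
  refine ⟨integrable_exp_mul_of_integrable_exp_sq_div hU hT hint, fun s => ?_⟩
  refine (mgf_le_of_integral_exp_sq_div_le_two hU hmean hT hint
    ((ENNReal.ofReal_le_ofReal_iff (by norm_num)).1 (by simpa using hsq)) s).trans_eq ?_
  push_cast
  ring_nf

theorem integral_pow_four_le_of_hasSubgaussianMGF {c : ℝ≥0} (h : HasSubgaussianMGF U c P) :
    ∫ ω, U ω ^ 4 ∂P ≤ 48 * Real.exp (c / 2) := by
  have hpos : Integrable (fun ω => Real.exp (U ω)) P := by simpa using h.integrable_exp_mul 1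
  have hneg : Integrable (fun ω => Real.exp (-U ω)) P := by simpa using h.integrable_exp_mul (-1)
  have hpos_le : ∫ ω, Real.exp (U ω) ∂P ≤ Real.exp (c / 2) := by simpa [mgf] using h.mgf_le 1
  have hneg_le : ∫ ω, Real.exp (-U ω) ∂P ≤ Real.exp (c / 2) := by
    simpa [mgf] using h.mgf_le (-1)
  calc ∫ ω, U ω ^ 4 ∂P
      ≤ ∫ ω, 24 * (Real.exp (U ω) + Real.exp (-U ω)) ∂P :=
        integral_mono_of_nonneg (ae_of_all _ fun _ => by positivity) (by fun_prop)
          (ae_of_all _ fun ω => pow_four_le_exp_add_exp_neg (U ω))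
    _ ≤ 48 * Real.exp (c / 2) := by
        rw [integral_const_mul, integral_add hpos hneg]
        linarith

theorem expMoment_neg_sq_le [IsProbabilityMeasure P] (hU : MemLp U 4 P) {a : ℝ} (ha : 0 ≤ a) :
    expMoment (fun ω => -(a * U ω ^ 2)) P ≤
      ENNReal.ofReal (Real.exp (-(a * ∫ ω, U ω ^ 2 ∂P) + a ^ 2 / 2 * ∫ ω, U ω ^ 4 ∂P)) := by
  have h2 : Integrable (fun ω => U ω ^ 2) P := (hU.mono_exponent (by norm_num)).integrable_sq
  have h4 : Integrable (fun ω => U ω ^ 4) P := by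
    simpa only [Real.norm_eq_abs, Even.pow_abs (⟨2, rfl⟩ : Even 4)] using
      hU.integrable_norm_pow (p := 4) (by norm_num)
  have hbound : ∀ ω, Real.exp (-(a * U ω ^ 2)) ≤ 1 - a * U ω ^ 2 + a ^ 2 / 2 * U ω ^ 4 :=
    fun ω => (exp_neg_le_one_sub_add_sq (by positivity)).trans_eq (by ring)
  have hint : Integrable (fun ω => Real.exp (-(a * U ω ^ 2))) P := by
    have hmeas := hU.aestronglyMeasurable.aemeasurable
    refine (integrable_const (1 : ℝ)).mono' (by fun_prop) (ae_of_all _ fun ω => ?_)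
    rw [Real.norm_of_nonneg (Real.exp_pos _).le, Real.exp_le_one_iff]
    nlinarith [sq_nonneg (U ω)]
  rw [expMoment_eq_ofReal_integral hint]
  refine ENNReal.ofReal_le_ofReal ?_
  calc ∫ ω, Real.exp (-(a * U ω ^ 2)) ∂P
      ≤ ∫ ω, (1 - a * U ω ^ 2 + a ^ 2 / 2 * U ω ^ 4) ∂P :=
        integral_mono hint (by fun_prop) hbound
    _ = -(a * ∫ ω, U ω ^ 2 ∂P) + a ^ 2 / 2 * ∫ ω, U ω ^ 4 ∂P + 1 := by
        rw [integral_add (by fun_prop) (by fun_prop), integral_sub (by fun_prop) (by fun_prop),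
          integral_const_mul, integral_const_mul]
        simp only [integral_const, probReal_univ, smul_eq_mul, one_mul]
        ring
    _ ≤ _ := Real.add_one_le_exp _

end ScalarSubgaussian

section GaussianMoments

theorem expMoment_mul_gaussianReal (a : ℝ) :
    expMoment (fun g => a * g) (gaussianReal 0 1) = ENNReal.ofReal (Real.exp (a ^ 2 / 2)) := by
  rw [expMoment_eq_ofReal_integral (integrable_exp_mul_gaussianReal a)]
  congr 1
  simpa [mgf] using mgf_gaussianReal (p := gaussianReal 0 1) (X := id) (μ := 0) (v := 1) (by simp) a

theorem inv_one_sub_le_exp {x : ℝ} (h0 : 0 ≤ x) (h1 : x ≤ 1 / 2) :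
    (1 - x)⁻¹ ≤ Real.exp (2 * x) := by
  rw [inv_le_iff_one_le_mul₀ (by linarith)]
  nlinarith [Real.add_one_le_exp (2 * x)]

theorem expMoment_mul_sq_gaussianReal_le {b : ℝ} (h0 : 0 ≤ b) (h1 : b ≤ 1 / 4) :
    expMoment (fun g => b * g ^ 2) (gaussianReal 0 1) ≤ ENNReal.ofReal (Real.exp (2 * b)) := by
  have hpos : 0 < 1 / 2 - b := by linarith
  have hdens : ∀ x : ℝ, (gaussianPDF 0 1 * fun g => ENNReal.ofReal (Real.exp (b * g ^ 2))) x =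
      ENNReal.ofReal ((√(2 * Real.pi))⁻¹ * Real.exp (-(1 / 2 - b) * x ^ 2)) := fun x => by
    rw [Pi.mul_apply, gaussianPDF, gaussianPDFReal, ← ENNReal.ofReal_mul (by positivity), mul_assoc,
      ← Real.exp_add]
    congr 3
    · simp
    · simp only [sub_zero, NNReal.coe_one]
      ring
  rw [expMoment, gaussianReal_of_var_ne_zero _ one_ne_zero,
    lintegral_withDensity_eq_lintegral_mul _ (measurable_gaussianPDF _ _) (by fun_prop)]
  simp_rw [hdens]
  rw [← ofReal_integral_eq_lintegral_ofReal ((integrable_exp_neg_mul_sq hpos).const_mul _)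
    (ae_of_all _ fun _ => by positivity), integral_const_mul, integral_gaussian]
  refine ENNReal.ofReal_le_ofReal ?_
  rw [← Real.sqrt_inv, ← Real.sqrt_mul (by positivity), Real.sqrt_le_iff, ← Real.exp_nat_mul]
  have hratio : (2 * Real.pi)⁻¹ * (Real.pi / (1 / 2 - b)) = (1 - 2 * b)⁻¹ := by
    have := Real.pi_pos
    have : 1 - 2 * b ≠ 0 := by linarith
    field_simp
  rw [hratio]
  exact ⟨(Real.exp_pos _).le, inv_one_sub_le_exp (by linarith) (by linarith)⟩

variable {ι : Type*} [Fintype ι]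

theorem expMoment_dotProduct_pi_gaussianReal (u : ι → ℝ) :
    expMoment (fun g => u ⬝ᵥ g) (Measure.pi fun _ => gaussianReal 0 1) =
      ENNReal.ofReal (Real.exp (u ⬝ᵥ u / 2)) := by
  simp_rw [dotProduct]
  rw [expMoment_pi_sum _ fun i => measurable_const_mul (u i)]
  simp_rw [expMoment_mul_gaussianReal]
  rw [← ENNReal.ofReal_prod_of_nonneg fun _ _ => (Real.exp_pos _).le, ← Real.exp_sum,
    Finset.sum_div]
  simp_rw [sq]

theorem ofReal_exp_mul_dotProduct_self {l : ℝ} (hl : 0 ≤ l) (y : ι → ℝ) :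
    ENNReal.ofReal (Real.exp (l * (y ⬝ᵥ y))) =
      expMoment (fun g => (√(2 * l) • y) ⬝ᵥ g) (Measure.pi fun _ => gaussianReal 0 1) := by
  rw [expMoment_dotProduct_pi_gaussianReal]
  simp only [smul_dotProduct, dotProduct_smul, smul_eq_mul, ← mul_assoc,
    Real.mul_self_sqrt (show 0 ≤ 2 * l by positivity)]
  congr 2
  ring

theorem expMoment_sum_mul_sq_pi_gaussianReal_le {d : ι → ℝ} (h0 : ∀ i, 0 ≤ d i)
    (h1 : ∀ i, d i ≤ 1 / 4) :
    expMoment (fun g => ∑ i, d i * g i ^ 2) (Measure.pi fun _ => gaussianReal 0 1) ≤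
      ENNReal.ofReal (Real.exp (2 * ∑ i, d i)) := by
  rw [expMoment_pi_sum (f := fun i x => d i * x ^ 2) _ fun i => by fun_prop, Finset.mul_sum,
    Real.exp_sum, ENNReal.ofReal_prod_of_nonneg fun _ _ => (Real.exp_pos _).le]
  exact Finset.prod_le_prod' fun i _ => expMoment_mul_sq_gaussianReal_le (h0 i) (h1 i)

end GaussianMoments

section PosSemidefForms

variable {ι : Type*} [Fintype ι]

theorem dotProduct_self_nonneg (x : ι → ℝ) : 0 ≤ x ⬝ᵥ x :=
  Finset.sum_nonneg fun _ _ => mul_self_nonneg _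

theorem dotProduct_transpose_mul_self_mulVec {ι' : Type*} [Fintype ι'] (B : Matrix ι' ι ℝ)
    (x : ι → ℝ) : x ⬝ᵥ (Bᵀ * B) *ᵥ x = B *ᵥ x ⬝ᵥ B *ᵥ x := by
  rw [← Matrix.mulVec_mulVec, Matrix.dotProduct_transpose_mulVec]

theorem dotProduct_diagonal_mulVec [DecidableEq ι] (d x : ι → ℝ) :
    x ⬝ᵥ Matrix.diagonal d *ᵥ x = ∑ i, d i * x i ^ 2 := by
  simp only [dotProduct, Matrix.mulVec_diagonal]
  exact Finset.sum_congr rfl fun i _ => by ring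

variable {M : Matrix ι ι ℝ}

theorem exists_transpose_mul_self_eq [DecidableEq ι] (hM : M.PosSemidef) :
    ∃ B : Matrix ι ι ℝ, Bᵀ * B = M ∧ B * Bᵀ = Matrix.diagonal hM.1.eigenvalues := by
  set U : Matrix ι ι ℝ := ↑hM.1.eigenvectorUnitary
  have hU : Uᵀ * U = 1 := by
    simpa [Matrix.star_eq_conjTranspose, Matrix.conjTranspose_eq_transpose_of_trivial] using
      Unitary.coe_star_mul_self hM.1.eigenvectorUnitary
  set S : Matrix ι ι ℝ := Matrix.diagonal fun i => √(hM.1.eigenvalues i)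
  have hS : S * S = Matrix.diagonal hM.1.eigenvalues := by
    simp [S, Matrix.diagonal_mul_diagonal, Real.mul_self_sqrt (hM.eigenvalues_nonneg _)]
  have hspec : M = U * Matrix.diagonal hM.1.eigenvalues * Uᵀ := by
    simpa [Unitary.conjStarAlgAut_apply, Matrix.star_eq_conjTranspose,
      Matrix.conjTranspose_eq_transpose_of_trivial, Function.comp_def] using hM.1.spectral_theorem
  refine ⟨S * Uᵀ, ?_, ?_⟩
  · rw [Matrix.transpose_mul, Matrix.transpose_transpose, Matrix.diagonal_transpose,
      Matrix.mul_assoc U, ← Matrix.mul_assoc S, hS, ← Matrix.mul_assoc]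
    exact hspec.symm
  · rw [Matrix.transpose_mul, Matrix.transpose_transpose, Matrix.diagonal_transpose,
      Matrix.mul_assoc S, ← Matrix.mul_assoc Uᵀ, hU, Matrix.one_mul, hS]

theorem eigenvalues_le_of_quadForm_le [DecidableEq ι] (hM : M.IsHermitian) {m : ℝ}
    (hm : ∀ x, x ⬝ᵥ M *ᵥ x ≤ m * (x ⬝ᵥ x)) (i : ι) : hM.eigenvalues i ≤ m := by
  have hunit : (hM.eigenvectorBasis i).ofLp ⬝ᵥ (hM.eigenvectorBasis i).ofLp = 1 := by
    have := orthonormal_iff_ite.1 hM.eigenvectorBasis.orthonormal i i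
    rwa [EuclideanSpace.inner_eq_star_dotProduct, star_trivial, if_pos rfl] at this
  simpa [hM.eigenvalues_eq, hunit] using hm (hM.eigenvectorBasis i).ofLp

theorem mulVec_dotProduct_mulVec_le (hM : M.PosSemidef) {m : ℝ}
    (hm : ∀ x, x ⬝ᵥ M *ᵥ x ≤ m * (x ⬝ᵥ x)) (x : ι → ℝ) :
    M *ᵥ x ⬝ᵥ M *ᵥ x ≤ m * (x ⬝ᵥ M *ᵥ x) := by
  classical
  obtain ⟨B, hBM, hBd⟩ := exists_transpose_mul_self_eq hM
  calc M *ᵥ x ⬝ᵥ M *ᵥ x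
      = ∑ i, hM.1.eigenvalues i * (B *ᵥ x) i ^ 2 := by
        rw [← dotProduct_diagonal_mulVec, ← hBd]
        nth_rw 2 [← Matrix.transpose_transpose B]
        rw [dotProduct_transpose_mul_self_mulVec, Matrix.mulVec_mulVec, hBM]
    _ ≤ ∑ i, m * (B *ᵥ x) i ^ 2 := Finset.sum_le_sum fun i _ =>
        mul_le_mul_of_nonneg_right (eigenvalues_le_of_quadForm_le hM.1 hm i) (sq_nonneg _)
    _ = m * (x ⬝ᵥ M *ᵥ x) := by
        rw [← Finset.mul_sum, ← hBM, dotProduct_transpose_mul_self_mulVec]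
        simp_rw [dotProduct, sq]

theorem diag_le_of_quadForm_le {m : ℝ} (hm : ∀ x, x ⬝ᵥ M *ᵥ x ≤ m * (x ⬝ᵥ x)) (i : ι) :
    M i i ≤ m := by
  classical
  simpa using hm (Pi.single i 1)

end PosSemidefForms

section SubgaussianVec

variable {Ω : Type*} [MeasurableSpace Ω] {P : Measure Ω} {ι : Type*} [Fintype ι]

/-- A sub-Gaussian random vector with variance proxy `c`: the linear form `⟨u, ξ⟩` is sub-Gaussian
with proxy `c |u|²` for every direction `u`. -/
def IsSubgaussianVec (ξ : Ω → ι → ℝ) (c : ℝ≥0) (P : Measure Ω) : Prop :=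
  ∀ u : ι → ℝ, HasSubgaussianMGF (fun ω => u ⬝ᵥ ξ ω) (c * (u ⬝ᵥ u).toNNReal) P

variable {ξ : Ω → ι → ℝ} {c : ℝ≥0}

theorem IsSubgaussianVec.expMoment_dotProduct_le (h : IsSubgaussianVec ξ c P) (u : ι → ℝ) :
    expMoment (fun ω => u ⬝ᵥ ξ ω) P ≤ ENNReal.ofReal (Real.exp (c * (u ⬝ᵥ u) / 2)) := by
  simpa [Real.coe_toNNReal _ (dotProduct_self_nonneg u)] using
    expMoment_mul_le_of_hasSubgaussianMGF (h u) 1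

theorem isSubgaussianVec_of_iIndepFun (hind : iIndepFun (fun j ω => ξ ω j) P)
    (h : ∀ j, HasSubgaussianMGF (fun ω => ξ ω j) c P) : IsSubgaussianVec ξ c P := fun u => by
  have hsum := HasSubgaussianMGF.sum_of_iIndepFun
    (hind.comp (fun j x => u j * x) fun j => measurable_const_mul (u j)) (s := Finset.univ)
    fun j _ => (h j).const_mul (u j)
  refine hasSubgaussianMGF_mono hsum (NNReal.coe_le_coe.1 (le_of_eq ?_))
  rw [NNReal.coe_mul, Real.coe_toNNReal _ (dotProduct_self_nonneg u), NNReal.coe_sum, dotProduct,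
    Finset.mul_sum]
  exact Finset.sum_congr rfl fun j _ => (by ring : u j ^ 2 * (c : ℝ) = c * (u j * u j))

end SubgaussianVec

section QuadFormUpperTail

variable {Ω : Type*} [MeasurableSpace Ω] {P : Measure Ω} {ι : Type*} [Fintype ι]
  {M : Matrix ι ι ℝ} {m : ℝ} {ξ : Ω → ι → ℝ} {c : ℝ≥0}

/- `exp(l ξᵀMξ)` is the Gaussian average of `exp(√(2l) ⟨Bᵀg, ξ⟩)` when `M = BᵀB`; after swapping the
two averages only the Gaussian chaos `∑ μᵢ gᵢ²` remains. -/
theorem expMoment_quadForm_le [SFinite P] (hM : M.PosSemidef)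
    (hm : ∀ x, x ⬝ᵥ M *ᵥ x ≤ m * (x ⬝ᵥ x)) (hξ : Measurable ξ) (h : IsSubgaussianVec ξ c P)
    {l : ℝ} (hl : 0 ≤ l) (hlm : l * c * m ≤ 1 / 4) :
    expMoment (fun ω => l * (ξ ω ⬝ᵥ M *ᵥ ξ ω)) P ≤
      ENNReal.ofReal (Real.exp (2 * l * c * M.trace)) := by
  classical
  obtain ⟨B, hBM, hBd⟩ := exists_transpose_mul_self_eq hM
  set μ := hM.1.eigenvalues
  set γ : Measure (ι → ℝ) := Measure.pi fun _ => gaussianReal 0 1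
  have hμ : ∀ i, 0 ≤ μ i := hM.eigenvalues_nonneg
  have hlinear : ∀ x, ENNReal.ofReal (Real.exp (l * (x ⬝ᵥ M *ᵥ x))) =
      expMoment (fun g => (√(2 * l) • Bᵀ *ᵥ g) ⬝ᵥ x) γ := fun x => by
    rw [← hBM, dotProduct_transpose_mul_self_mulVec, ofReal_exp_mul_dotProduct_self hl]
    congr 1
    funext g
    rw [smul_dotProduct, smul_dotProduct, dotProduct_comm _ x, Matrix.dotProduct_transpose_mulVec,
      dotProduct_comm g]
  have hnorm : ∀ g, (√(2 * l) • Bᵀ *ᵥ g) ⬝ᵥ (√(2 * l) • Bᵀ *ᵥ g) =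
      2 * l * ∑ i, μ i * g i ^ 2 := fun g => by
    rw [← dotProduct_diagonal_mulVec, ← hBd]
    nth_rw 3 [← Matrix.transpose_transpose B]
    rw [dotProduct_transpose_mul_self_mulVec]
    simp only [smul_dotProduct, dotProduct_smul, smul_eq_mul, ← mul_assoc,
      Real.mul_self_sqrt (show 0 ≤ 2 * l by positivity)]
  calc expMoment (fun ω => l * (ξ ω ⬝ᵥ M *ᵥ ξ ω)) P
      = ∫⁻ ω, expMoment (fun g => (√(2 * l) • Bᵀ *ᵥ g) ⬝ᵥ ξ ω) γ ∂P := by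
        simp_rw [← hlinear]
        rfl
    _ = ∫⁻ g, expMoment (fun ω => (√(2 * l) • Bᵀ *ᵥ g) ⬝ᵥ ξ ω) P ∂γ :=
        expMoment_lintegral_swap (by
          simp only [Function.uncurry_def, dotProduct, Matrix.mulVec, Pi.smul_apply]
          fun_prop)
    _ ≤ expMoment (fun g => ∑ i, (l * c * μ i) * g i ^ 2) γ := by
        refine lintegral_mono fun g => (h.expMoment_dotProduct_le _).trans_eq ?_
        simp_rw [hnorm, mul_assoc (l * (c : ℝ)), ← Finset.mul_sum]
        congr 2
        ring
    _ ≤ ENNReal.ofReal (Real.exp (2 * ∑ i, l * c * μ i)) :=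
        expMoment_sum_mul_sq_pi_gaussianReal_le (fun i => by have := hμ i; positivity) fun i =>
          (mul_le_mul_of_nonneg_left (eigenvalues_le_of_quadForm_le hM.1 hm i)
            (by positivity)).trans hlm
    _ = ENNReal.ofReal (Real.exp (2 * l * c * M.trace)) := by
        rw [← Finset.mul_sum, hM.1.trace_eq_sum_eigenvalues]
        simp only [RCLike.ofReal_real_eq_id, id, μ, mul_assoc]

theorem measure_le_quadForm_le [SFinite P] (hM : M.PosSemidef)
    (hm : ∀ x, x ⬝ᵥ M *ᵥ x ≤ m * (x ⬝ᵥ x)) (hm_pos : 0 < m) (hξ : Measurable ξ)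
    (h : IsSubgaussianVec ξ c P) (hc : 0 < c) :
    P {ω | 4 * c * M.trace ≤ ξ ω ⬝ᵥ M *ᵥ ξ ω} ≤
      ENNReal.ofReal (Real.exp (-(M.trace / (2 * m)))) := by
  have : (0 : ℝ) < c := hc
  have hl : 0 < 1 / (4 * c * m) := by positivity
  have hmeas : Measurable fun ω => 1 / (4 * c * m) * (ξ ω ⬝ᵥ M *ᵥ ξ ω) := by
    simp only [dotProduct, Matrix.mulVec]
    fun_prop
  have hmarkov := measure_le_of_expMoment_le hmeas
    (expMoment_quadForm_le hM hm hξ h hl.le (by field_simp; norm_num))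
    (1 / (4 * c * m) * (4 * c * M.trace))
  simp only [mul_le_mul_iff_right₀ hl] at hmarkov
  refine hmarkov.trans_eq ?_
  congr 2
  field_simp
  ring

end QuadFormUpperTail

section Decoupling

variable {ι : Type*}

theorem measurable_indicator (s : Set ι) : Measurable fun x : ι → ℝ => s.indicator x := by
  classical
  refine measurable_pi_lambda _ fun i => ?_
  by_cases hi : i ∈ s
  · simpa [hi] using measurable_pi_apply i
  · simp [hi]

theorem indepFun_indicator_compl {Ω : Type*} [MeasurableSpace Ω] {P : Measure Ω} [Finite ι]
    {ξ : Ω → ι → ℝ} (hξ : Measurable ξ) (hind : iIndepFun (fun j ω => ξ ω j) P) (I : Finset ι) :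
    IndepFun (fun ω => (I : Set ι).indicator (ξ ω))
      (fun ω => (I : Set ι)ᶜ.indicator (ξ ω)) P := by
  classical
  cases nonempty_fintype ι
  let extend (J : Finset ι) (y : J → ℝ) (i : ι) : ℝ := if hi : i ∈ J then y ⟨i, hi⟩ else 0
  have hextend : ∀ J, Measurable (extend J) := fun J => by
    refine measurable_pi_lambda _ fun i => ?_
    by_cases hi : i ∈ J
    · simpa only [extend, hi, dite_true] using measurable_pi_apply _
    · simp only [extend, hi, dite_false, measurable_const]
  have hcomp := (hind.indepFun_finset I Iᶜ disjoint_compl_right fun j => by fun_prop).comp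
    (hextend I) (hextend Iᶜ)
  convert hcomp using 1 <;> ext ω i <;> simp [extend, Set.indicator_apply]

variable [Fintype ι]

theorem dotProduct_indicator (s : Set ι) (x y : ι → ℝ) :
    x ⬝ᵥ s.indicator y = s.indicator x ⬝ᵥ y := by
  classical
  simp only [dotProduct, Set.indicator_apply, mul_ite, ite_mul, mul_zero, zero_mul]

theorem dotProduct_self_indicator_le (s : Set ι) (x : ι → ℝ) :
    s.indicator x ⬝ᵥ s.indicator x ≤ x ⬝ᵥ x := by
  classical
  refine Finset.sum_le_sum fun i _ => ?_
  by_cases hi : i ∈ s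
  · simp [hi]
  · simpa [hi] using mul_self_nonneg (x i)

theorem sum_mem_notMem_eq {i j : ι} (hij : i ≠ j) (a : ℝ) :
    ∑ I : Finset ι, (I : Set ι).indicator 1 i * (I : Set ι)ᶜ.indicator 1 j * a =
      2 ^ Fintype.card ι / 4 * a := by
  classical
  have hfilter : ({I : Finset ι | i ∈ I ∧ j ∉ I} : Finset (Finset ι)) =
      Finset.Icc {i} (Finset.univ.erase j) := by
    ext I
    simp [Finset.subset_erase]
  have hcard : Finset.card {I : Finset ι | i ∈ I ∧ j ∉ I} * 4 = 2 ^ Fintype.card ι := by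
    have : 2 ≤ Fintype.card ι := Fintype.one_lt_card_iff.2 ⟨i, j, hij⟩
    rw [hfilter, Finset.card_Icc_finset (by simp [hij]), Finset.card_erase_of_mem
      (Finset.mem_univ _), Finset.card_univ, Finset.card_singleton,
      show 4 = 2 ^ 2 from rfl, ← pow_add]
    congr 1
    omega
  have hterm : ∀ I : Finset ι, (I : Set ι).indicator 1 i * (I : Set ι)ᶜ.indicator 1 j * a =
      if i ∈ I ∧ j ∉ I then a else 0 := fun I => by
    by_cases hi : i ∈ I <;> by_cases hj : j ∈ I <;> simp [hi, hj]
  have hcard' : (Finset.card {I : Finset ι | i ∈ I ∧ j ∉ I} : ℝ) = 2 ^ Fintype.card ι / 4 :=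
    eq_div_of_mul_eq (by norm_num) (by exact_mod_cast hcard)
  rw [Finset.sum_congr rfl fun I _ => hterm I, ← Finset.sum_filter, Finset.sum_const, nsmul_eq_mul,
    hcard']

/- A quarter of all subsets `I` split a pair `i ≠ j`, in the sense that `i ∈ I` and `j ∉ I`. -/
theorem offDiag_eq_average_decoupled (M : Matrix ι ι ℝ) (x : ι → ℝ) :
    x ⬝ᵥ M *ᵥ x - ∑ i, M i i * x i ^ 2 = ∑ I : Finset ι, (1 / 2 ^ Fintype.card ι : ℝ) *
      (4 * ((I : Set ι).indicator x ⬝ᵥ M *ᵥ (I : Set ι)ᶜ.indicator x)) := by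
  classical
  have hform : ∀ I : Finset ι, (I : Set ι).indicator x ⬝ᵥ M *ᵥ (I : Set ι)ᶜ.indicator x =
      ∑ i, ∑ j, (I : Set ι).indicator 1 i * (I : Set ι)ᶜ.indicator 1 j *
        (M i j * x i * x j) := fun I => by
    simp only [dotProduct, Matrix.mulVec, Finset.mul_sum]
    refine Finset.sum_congr rfl fun i _ => Finset.sum_congr rfl fun j _ => ?_
    by_cases hi : i ∈ I <;> by_cases hj : j ∈ I <;> simp [hi, hj]
    ring
  have hpair : ∀ i j, ∑ I : Finset ι, (I : Set ι).indicator 1 i * (I : Set ι)ᶜ.indicator 1 j *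
      (M i j * x i * x j) =
      2 ^ Fintype.card ι / 4 * (M i j * x i * x j - if i = j then M i i * x i ^ 2 else 0) :=
    fun i j => by
    split_ifs with hij
    · subst hij
      rw [Finset.sum_eq_zero fun I _ => ?_]
      · ring
      · by_cases hi : i ∈ I <;> simp [hi]
    · rw [sum_mem_notMem_eq hij, sub_zero]
  simp_rw [← Finset.mul_sum, hform]
  rw [Finset.sum_comm]
  simp_rw [Finset.sum_comm (s := (Finset.univ : Finset (Finset ι))), hpair, ← Finset.mul_sum,
    Finset.sum_sub_distrib, Finset.sum_ite_eq, if_pos (Finset.mem_univ _), dotProduct,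
    Matrix.mulVec, dotProduct, Finset.mul_sum]
  rw [← mul_assoc, ← mul_assoc, show (1 / 2 ^ Fintype.card ι * 4 * (2 ^ Fintype.card ι / 4) : ℝ) = 1
    by field_simp, one_mul]
  refine congrArg (· - _) (Finset.sum_congr rfl fun i _ => Finset.sum_congr rfl fun j _ => ?_)
  ring

end Decoupling

section QuadFormLowerTail

variable {Ω : Type*} [MeasurableSpace Ω] {P : Measure Ω} {ι : Type*} [Fintype ι]
  {M : Matrix ι ι ℝ} {m : ℝ} {ξ : Ω → ι → ℝ} {c : ℝ≥0}

theorem IsSubgaussianVec.indicator (h : IsSubgaussianVec ξ c P) (s : Set ι) :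
    IsSubgaussianVec (fun ω => s.indicator (ξ ω)) c P := fun u => by
  simp_rw [dotProduct_indicator]
  refine hasSubgaussianMGF_mono (h _) ?_
  gcongr
  exact dotProduct_self_indicator_le s u

theorem measurable_bilinForm (M : Matrix ι ι ℝ) :
    Measurable fun z : (ι → ℝ) × (ι → ℝ) => z.1 ⬝ᵥ M *ᵥ z.2 := by
  simp only [dotProduct, Matrix.mulVec]
  fun_prop

theorem expMoment_bilinForm_le_of_indepFun [IsFiniteMeasure P] (hM : M.PosSemidef)
    (hm : ∀ x, x ⬝ᵥ M *ᵥ x ≤ m * (x ⬝ᵥ x)) {η : Ω → ι → ℝ} (hξ : Measurable ξ)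
    (hη : Measurable η) (hind : IndepFun ξ η P) (hsubξ : IsSubgaussianVec ξ c P)
    (hsubη : IsSubgaussianVec η c P) (hm_nonneg : 0 ≤ m) {t : ℝ} (ht : (t * c * m) ^ 2 ≤ 1 / 2) :
    expMoment (fun ω => t * (ξ ω ⬝ᵥ M *ᵥ η ω)) P ≤
      ENNReal.ofReal (Real.exp ((t * c) ^ 2 * m * M.trace)) := by
  have hlaw := (indepFun_iff_map_prod_eq_prod_map_map hξ.aemeasurable hη.aemeasurable).1 hind
  have hbilin := (measurable_bilinForm M).const_mul t
  have hform : Measurable fun v => t ^ 2 * c * m / 2 * (v ⬝ᵥ M *ᵥ v) :=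
    ((measurable_bilinForm M).comp (measurable_id.prodMk measurable_id)).const_mul _
  have hinner : ∀ v, expMoment (fun u => t * (u ⬝ᵥ M *ᵥ v)) (P.map ξ) ≤
      ENNReal.ofReal (Real.exp (t ^ 2 * c * m / 2 * (v ⬝ᵥ M *ᵥ v))) := fun v => by
    have hslice : Measurable fun u => t * (u ⬝ᵥ M *ᵥ v) :=
      hbilin.comp (measurable_id.prodMk measurable_const)
    rw [expMoment_map hξ hslice]
    have hlin := hsubξ.expMoment_dotProduct_le (t • M *ᵥ v)
    simp_rw [smul_dotProduct, dotProduct_smul, smul_eq_mul, dotProduct_comm (M *ᵥ v) (ξ _)] at hlin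
    refine hlin.trans (ENNReal.ofReal_le_ofReal (Real.exp_le_exp.2 ?_))
    calc c * (t * (t * (M *ᵥ v ⬝ᵥ M *ᵥ v))) / 2 = c * t ^ 2 / 2 * (M *ᵥ v ⬝ᵥ M *ᵥ v) := by ring
      _ ≤ c * t ^ 2 / 2 * (m * (v ⬝ᵥ M *ᵥ v)) := by
        gcongr
        exact mulVec_dotProduct_mulVec_le hM hm v
      _ = t ^ 2 * c * m / 2 * (v ⬝ᵥ M *ᵥ v) := by ring
  calc expMoment (fun ω => t * (ξ ω ⬝ᵥ M *ᵥ η ω)) P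
      = expMoment (fun z => t * (z.1 ⬝ᵥ M *ᵥ z.2)) ((P.map ξ).prod (P.map η)) := by
        rw [← hlaw, expMoment_map (hξ.prodMk hη) hbilin]
    _ = ∫⁻ v, expMoment (fun u => t * (u ⬝ᵥ M *ᵥ v)) (P.map ξ) ∂(P.map η) :=
        lintegral_prod_symm' _ (by fun_prop)
    _ ≤ expMoment (fun v => t ^ 2 * c * m / 2 * (v ⬝ᵥ M *ᵥ v)) (P.map η) := lintegral_mono hinner
    _ = expMoment (fun ω => t ^ 2 * c * m / 2 * (η ω ⬝ᵥ M *ᵥ η ω)) P := expMoment_map hη hform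
    _ ≤ ENNReal.ofReal (Real.exp (2 * (t ^ 2 * c * m / 2) * c * M.trace)) :=
        expMoment_quadForm_le hM hm hη hsubη (by positivity) (by linarith)
    _ = ENNReal.ofReal (Real.exp ((t * c) ^ 2 * m * M.trace)) := by ring_nf

theorem expMoment_offDiag_le (hM : M.PosSemidef)
    (hm : ∀ x, x ⬝ᵥ M *ᵥ x ≤ m * (x ⬝ᵥ x)) (hm_nonneg : 0 ≤ m) (hξ : Measurable ξ)
    (hind : iIndepFun (fun j ω => ξ ω j) P) (h : ∀ j, HasSubgaussianMGF (fun ω => ξ ω j) c P)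
    {t : ℝ} (ht : (4 * t * c * m) ^ 2 ≤ 1 / 2) :
    expMoment (fun ω => t * (ξ ω ⬝ᵥ M *ᵥ ξ ω - ∑ i, M i i * ξ ω i ^ 2)) P ≤
      ENNReal.ofReal (Real.exp (16 * (t * c) ^ 2 * m * M.trace)) := by
  have := hind.isProbabilityMeasure
  have hsub := isSubgaussianVec_of_iIndepFun hind h
  have hmeas := fun I : Finset ι => (measurable_indicator (I : Set ι)).comp hξ
  have hmeas' := fun I : Finset ι => (measurable_indicator (I : Set ι)ᶜ).comp hξ
  have haverage : ∀ ω, t * (ξ ω ⬝ᵥ M *ᵥ ξ ω - ∑ i, M i i * ξ ω i ^ 2) =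
      ∑ I : Finset ι, (1 / 2 ^ Fintype.card ι : ℝ) *
        (4 * t * ((I : Set ι).indicator (ξ ω) ⬝ᵥ M *ᵥ (I : Set ι)ᶜ.indicator (ξ ω))) := fun ω => by
    rw [offDiag_eq_average_decoupled, Finset.mul_sum]
    exact Finset.sum_congr rfl fun I _ => by ring
  simp_rw [haverage]
  refine expMoment_sum_mul_le_of_forall_le (fun _ => by positivity) (by simp) (fun I => ?_)
    fun I => ?_
  · exact ((measurable_bilinForm M).comp ((hmeas I).prodMk (hmeas' I))).const_mul _
  · refine (expMoment_bilinForm_le_of_indepFun hM hm (hmeas I) (hmeas' I)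
      (indepFun_indicator_compl hξ hind I) (hsub.indicator _) (hsub.indicator _) hm_nonneg
      ht).trans_eq ?_
    ring_nf

theorem expMoment_neg_diag_le (hM : M.PosSemidef)
    (hm : ∀ x, x ⬝ᵥ M *ᵥ x ≤ m * (x ⬝ᵥ x)) (hξ : Measurable ξ)
    (hind : iIndepFun (fun j ω => ξ ω j) P) (h4 : ∀ j, MemLp (fun ω => ξ ω j) 4 P)
    (hvar : ∀ j, ∫ ω, ξ ω j ^ 2 ∂P = 1) {κ : ℝ} (hκ : ∀ j, ∫ ω, ξ ω j ^ 4 ∂P ≤ κ)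
    {l : ℝ} (hl : 0 ≤ l) :
    expMoment (fun ω => -(l * ∑ i, M i i * ξ ω i ^ 2)) P ≤
      ENNReal.ofReal (Real.exp (-(l * M.trace * (1 - l * m * κ / 2)))) := by
  have := hind.isProbabilityMeasure
  have hcoord : ∀ i, expMoment (fun ω => -(l * M i i * ξ ω i ^ 2)) P ≤
      ENNReal.ofReal (Real.exp (-(l * M i i * (1 - l * m * κ / 2)))) := fun i => by
    have hMii : 0 ≤ M i i := hM.diag_nonneg
    refine (expMoment_neg_sq_le (h4 i) (by positivity)).trans
      (ENNReal.ofReal_le_ofReal (Real.exp_le_exp.2 ?_))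
    have : 0 ≤ ∫ ω, ξ ω i ^ 4 ∂P := integral_nonneg fun _ => by positivity
    have hsecond : M i i * ∫ ω, ξ ω i ^ 4 ∂P ≤ m * κ :=
      mul_le_mul (diag_le_of_quadForm_le hm i) (hκ i) this
        (hMii.trans (diag_le_of_quadForm_le hm i))
    rw [hvar]
    have : 0 ≤ l ^ 2 * M i i / 2 := by positivity
    nlinarith [mul_le_mul_of_nonneg_left hsecond this]
  have hsum : ∀ ω, -(l * ∑ i, M i i * ξ ω i ^ 2) = ∑ i, -(l * M i i * ξ ω i ^ 2) := fun ω => by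
    simp_rw [Finset.sum_neg_distrib, mul_assoc, ← Finset.mul_sum]
  simp_rw [hsum]
  refine (expMoment_sum_le_of_iIndepFun (hind.comp (fun i x => -(l * M i i * x ^ 2)) fun i => by
    fun_prop) (fun i => by fun_prop) hcoord).trans_eq ?_
  rw [Finset.sum_neg_distrib, ← Finset.sum_mul, ← Finset.mul_sum, Matrix.trace]
  rfl

theorem expMoment_neg_quadForm_le (hM : M.PosSemidef)
    (hm : ∀ x, x ⬝ᵥ M *ᵥ x ≤ m * (x ⬝ᵥ x)) (hm_nonneg : 0 ≤ m) (hξ : Measurable ξ)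
    (hind : iIndepFun (fun j ω => ξ ω j) P) (h : ∀ j, HasSubgaussianMGF (fun ω => ξ ω j) c P)
    (hvar : ∀ j, ∫ ω, ξ ω j ^ 2 ∂P = 1) {κ : ℝ} (hκ : ∀ j, ∫ ω, ξ ω j ^ 4 ∂P ≤ κ)
    {l : ℝ} (hl : 0 ≤ l) (hlm : l * m * c ≤ 1 / 12) :
    expMoment (fun ω => -(l * (ξ ω ⬝ᵥ M *ᵥ ξ ω))) P ≤
      ENNReal.ofReal (Real.exp (-(l * M.trace * (1 - l * m * (κ + 32 * c ^ 2))))) := by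
  have hdiag := expMoment_neg_diag_le hM hm hξ hind (fun j => (h j).memLp 4) hvar hκ
    (show 0 ≤ 2 * l by positivity)
  have hoff := expMoment_offDiag_le hM hm hm_nonneg hξ hind h (t := -(2 * l)) (by
    have : 0 ≤ l * m * c := by positivity
    nlinarith)
  have hquad : Measurable fun ω => ξ ω ⬝ᵥ M *ᵥ ξ ω :=
    (measurable_bilinForm M).comp (hξ.prodMk hξ)
  have hadd := expMoment_add_le (f := fun ω => -(l * ∑ i, M i i * ξ ω i ^ 2))
    (g := fun ω => -(l * (ξ ω ⬝ᵥ M *ᵥ ξ ω - ∑ i, M i i * ξ ω i ^ 2)))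
    (a := -(l * M.trace * (1 - l * m * κ))) (b := 32 * (l * c) ^ 2 * m * M.trace)
    (by fun_prop) (by fun_prop) (by convert hdiag using 3 <;> ring_nf)
    (by convert hoff using 3 <;> ring_nf)
  convert hadd using 3 <;> ring_nf

/-- The constant in the exponent of the lower tail of a quadratic form whose argument has
independent entries with variance proxy `c`: a bound on their fourth moment, which controls the
diagonal part of the form, plus the contribution of the off-diagonal part. -/
noncomputable def lowerTailConst (c : ℝ) : ℝ := 48 * Real.exp (c / 2) + 32 * c ^ 2

theorem lowerTailConst_pos (c : ℝ) : 0 < lowerTailConst c := by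
  unfold lowerTailConst
  positivity

theorem measure_quadForm_le_half_trace_le (hM : M.PosSemidef)
    (hm : ∀ x, x ⬝ᵥ M *ᵥ x ≤ m * (x ⬝ᵥ x)) (hm_pos : 0 < m) (hξ : Measurable ξ)
    (hind : iIndepFun (fun j ω => ξ ω j) P) (h : ∀ j, HasSubgaussianMGF (fun ω => ξ ω j) c P)
    (hvar : ∀ j, ∫ ω, ξ ω j ^ 2 ∂P = 1) :
    P {ω | ξ ω ⬝ᵥ M *ᵥ ξ ω ≤ M.trace / 2} ≤
      ENNReal.ofReal (Real.exp (-(M.trace / (16 * lowerTailConst c * m)))) := by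
  have := hind.isProbabilityMeasure
  have := lowerTailConst_pos c
  set θ := lowerTailConst c with hθ
  have hκ : ∀ j, ∫ ω, ξ ω j ^ 4 ∂P ≤ 48 * Real.exp (c / 2) := fun j =>
    integral_pow_four_le_of_hasSubgaussianMGF (h j)
  have hl : 0 < 1 / (4 * θ * m) := by positivity
  have hexp := expMoment_neg_quadForm_le hM hm hm_pos.le hξ hind h hvar hκ hl.le (by
    rw [show 1 / (4 * θ * m) * m * c = c / (4 * θ) by field_simp, div_le_iff₀ (by positivity), hθ,
      lowerTailConst]
    nlinarith [Real.add_one_le_exp (c / 2 : ℝ), sq_nonneg (c : ℝ)])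
  have hquad : Measurable fun ω => ξ ω ⬝ᵥ M *ᵥ ξ ω :=
    (measurable_bilinForm M).comp (hξ.prodMk hξ)
  have hmarkov := measure_le_of_expMoment_le (by fun_prop) hexp
    (-(1 / (4 * θ * m) * (M.trace / 2)))
  simp only [neg_le_neg_iff, mul_le_mul_iff_right₀ hl] at hmarkov
  refine hmarkov.trans_eq ?_
  congr 2
  rw [show 48 * Real.exp (c / 2) + 32 * (c : ℝ) ^ 2 = θ from rfl]
  field_simp
  ring

end QuadFormLowerTail

section IndependentColumns

variable {Ω : Type*} [MeasurableSpace Ω] {P : Measure Ω} {ι κ E : Type*} [MeasurableSpace E]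

theorem iIndepFun_columns {X : ι → κ → Ω → E} (hX : ∀ i j, Measurable (X i j))
    (hrows : iIndepFun (fun i ω => (X i · ω)) P) (hentries : ∀ i, iIndepFun (X i) P) :
    iIndepFun (fun j ω i => X i j ω) P := by
  have := hrows.isProbabilityMeasure
  have hlaw : ∀ j i, IsProbabilityMeasure (P.map (X i j)) :=
    fun j i => Measure.isProbabilityMeasure_map (hX i j).aemeasurable
  have hjoint := iIndepFun_uncurry' hX hrows hentries
  have hcolumn : ∀ j, iIndepFun (fun i => X i j) P := fun j =>
    hjoint.precomp (g := fun i => (i, j)) fun a b h => (Prod.mk.inj h).1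
  have hswap := hjoint.precomp (g := fun q : (_ : κ) × ι => (q.2, q.1)) (by
    rintro ⟨a, b⟩ ⟨c, d⟩ h
    simp_all)
  rw [iIndepFun_iff_map_fun_eq_infinitePi_map (by fun_prop)] at hswap ⊢
  have hcurry : (fun ω (j : κ) (i : ι) => X i j ω) =
      MeasurableEquiv.piCurry (fun (_ : κ) (_ : ι) => E) ∘
        fun ω (q : (_ : κ) × ι) => X q.2 q.1 ω := by
    ext
    simp [Sigma.curry]
  rw [hcurry, ← Measure.map_map (by fun_prop) (by fun_prop), hswap,
    Measure.infinitePi_map_piCurry (fun j i => P.map (X i j))]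
  refine congrArg Measure.infinitePi (funext fun j => ?_)
  exact ((iIndepFun_iff_map_fun_eq_infinitePi_map (by fun_prop)).1 (hcolumn j)).symm

end IndependentColumns

section SphereNet

open Metric Module

variable {E F : Type*} [NormedAddCommGroup E] [NormedSpace ℝ E] [NormedAddCommGroup F]
  [NormedSpace ℝ F] {N : Set E} {ε : ℝ≥0}

theorem card_le_of_isSeparated_of_norm_le_one [FiniteDimensional ℝ E] (hε : 0 < ε) {s : Finset E}
    (hs : ∀ x ∈ s, ‖x‖ ≤ 1) (hsep : IsSeparated ε (s : Set E)) :
    (s.card : ℝ) ≤ (1 + 2 / ε) ^ finrank ℝ E := by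
  borelize E
  let μ : Measure E := Measure.addHaar
  have hdisj : (s : Set E).PairwiseDisjoint fun x => ball x (ε / 2) := fun x hx y hy hxy => by
    refine ball_disjoint_ball ?_
    have hlt : (ε : ℝ≥0∞) < edist x y := hsep hx hy hxy
    rw [edist_nndist, ENNReal.coe_lt_coe] at hlt
    rw [add_halves]
    exact_mod_cast hlt.le
  have hsub : ⋃ x ∈ s, ball x (ε / 2) ⊆ ball 0 (1 + ε / 2) :=
    Set.iUnion₂_subset fun x hx => ball_subset_ball' (by
      rw [dist_zero_right, add_comm]
      gcongr
      exact hs x hx)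
  have hvolume := calc
    (s.card : ℝ≥0∞) * ENNReal.ofReal ((ε / 2 : ℝ) ^ finrank ℝ E) * μ (ball 0 1)
    _ = μ (⋃ x ∈ s, ball x (ε / 2)) := by
        rw [measure_biUnion_finset hdisj fun _ _ => measurableSet_ball]
        simp only [μ.addHaar_ball_of_pos _ (show (0 : ℝ) < ε / 2 by positivity), Finset.sum_const,
          nsmul_eq_mul, mul_assoc]
    _ ≤ μ (ball 0 (1 + ε / 2)) := measure_mono hsub
    _ = ENNReal.ofReal ((1 + ε / 2 : ℝ) ^ finrank ℝ E) * μ (ball 0 1) :=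
        μ.addHaar_ball_of_pos _ (by positivity)
  have hcard := ENNReal.toReal_le_of_le_ofReal (by positivity)
    ((ENNReal.mul_le_mul_iff_left (measure_ball_pos _ _ zero_lt_one).ne'
      measure_ball_lt_top.ne).1 hvolume)
  rw [ENNReal.toReal_mul, ENNReal.toReal_ofReal (by positivity), ENNReal.toReal_natCast,
    ← le_div_iff₀ (by positivity), ← div_pow] at hcard
  have : (ε : ℝ) ≠ 0 := by positivity
  rwa [show (1 + ε / 2) / (ε / 2) = 1 + 2 / (ε : ℝ) by field_simp; ring] at hcard

theorem exists_isCover_sphere (E : Type*) [NormedAddCommGroup E] [NormedSpace ℝ E]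
    [FiniteDimensional ℝ E] (hε : 0 < ε) :
    ∃ N : Finset E, (∀ u ∈ N, ‖u‖ = 1) ∧ IsCover ε (sphere (0 : E) 1) (N : Set E) ∧
      (N.card : ℝ) ≤ (1 + 2 / ε) ^ finrank ℝ E := by
  obtain ⟨C, -, hC, hcover⟩ := exists_finite_isCover_of_isCompact (ε := ε / 2) (by positivity)
    (isCompact_sphere (0 : E) 1)
  have hpacking : packingNumber ε (sphere (0 : E) 1) ≠ ⊤ := by
    have := (packingNumber_two_mul_le_externalCoveringNumber (ε / 2) _).trans
      hcover.externalCoveringNumber_le_encard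
    rw [mul_div_cancel₀ _ two_ne_zero] at this
    exact (this.trans_lt hC.encard_lt_top).ne
  have hfinite : (maximalSeparatedSet ε (sphere (0 : E) 1)).Finite := by
    rw [← Set.encard_ne_top_iff, encard_maximalSeparatedSet hpacking]
    exact hpacking
  have hunit : ∀ u ∈ hfinite.toFinset, ‖u‖ = 1 := fun u hu => by
    simpa using maximalSeparatedSet_subset (hfinite.mem_toFinset.1 hu)
  refine ⟨hfinite.toFinset, hunit, ?_, ?_⟩
  · simpa using isCover_maximalSeparatedSet hpacking
  · exact card_le_of_isSeparated_of_norm_le_one hε (fun u hu => (hunit u hu).le)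
      (by simpa using isSeparated_maximalSeparatedSet)

theorem exists_norm_sub_apply_le_of_isCover (T : E →L[ℝ] F) (hN : IsCover ε (sphere (0 : E) 1) N)
    {v : E} (hv : ‖v‖ = 1) : ∃ u ∈ N, ‖T v - T u‖ ≤ ε * ‖T‖ := by
  obtain ⟨u, hu, hvu⟩ := hN (mem_sphere_zero_iff_norm.2 hv)
  have hvu : ‖v - u‖ ≤ ε := by
    rw [← dist_eq_norm]
    exact_mod_cast edist_le_coe.1 hvu
  refine ⟨u, hu, ?_⟩
  rw [← map_sub, mul_comm]
  exact T.le_opNorm_of_le hvu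

theorem opNorm_le_of_isCover_sphere (T : E →L[ℝ] F) (hε : ε ≤ 1 / 2)
    (hN : IsCover ε (sphere (0 : E) 1) N) {a : ℝ} (ha : 0 ≤ a) (hT : ∀ u ∈ N, ‖T u‖ ≤ a) :
    ‖T‖ ≤ 2 * a := by
  have hε : (ε : ℝ) ≤ 1 / 2 := by exact_mod_cast hε
  have hsphere : ∀ v : E, ‖v‖ = 1 → ‖T v‖ ≤ a + ‖T‖ / 2 := fun v hv => by
    obtain ⟨u, hu, hvu⟩ := exists_norm_sub_apply_le_of_isCover T hN hv
    linarith [norm_le_norm_add_norm_sub' (T v) (T u), hT u hu,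
      mul_le_mul_of_nonneg_right hε (norm_nonneg T)]
  linarith [T.opNorm_le_of_unit_norm (by positivity) hsphere]

theorem mul_norm_le_norm_apply_of_isCover_sphere (T : E →L[ℝ] F)
    (hN : IsCover ε (sphere (0 : E) 1) N) {b : ℝ} (hb : 2 * ε * ‖T‖ ≤ b)
    (hT : ∀ u ∈ N, b ≤ ‖T u‖) (v : E) : b / 2 * ‖v‖ ≤ ‖T v‖ := by
  rcases eq_or_ne v 0 with rfl | hv
  · simp
  have hsphere : b / 2 ≤ ‖T (‖v‖⁻¹ • v)‖ := by
    obtain ⟨u, hu, hvu⟩ := exists_norm_sub_apply_le_of_isCover T hN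
      (norm_smul_inv_norm (𝕜 := ℝ) hv)
    simp only [RCLike.ofReal_real_eq_id, id_eq] at hvu
    linarith [norm_le_norm_add_norm_sub (T (‖v‖⁻¹ • v)) (T u), hT u hu]
  rwa [map_smul, norm_smul, norm_inv, norm_norm, inv_mul_eq_div,
    le_div_iff₀ (norm_pos_iff.2 hv)] at hsphere

end SphereNet

section UniformBounds

open Metric Module

variable {ι κ : Type*} [Fintype ι] [Fintype κ]

theorem norm_toLp_sq (v : ι → ℝ) : ‖WithLp.toLp 2 v‖ ^ 2 = v ⬝ᵥ v := by
  simp [EuclideanSpace.real_norm_sq_eq, dotProduct, ← sq]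

theorem dotProduct_mulVec_self_bounds_of_isCover {ε : ℝ≥0} (hε : ε ≤ 1 / 2)
    {N : Finset (EuclideanSpace ℝ κ)} (hN : IsCover ε (sphere 0 1) (N : Set (EuclideanSpace ℝ κ)))
    {W : Matrix ι κ ℝ} {a b : ℝ} (ha : 0 ≤ a) (hb : 0 ≤ b) (hab : 16 * ε ^ 2 * a ≤ b)
    (hW : ∀ u ∈ N, b ≤ W *ᵥ u.ofLp ⬝ᵥ W *ᵥ u.ofLp ∧ W *ᵥ u.ofLp ⬝ᵥ W *ᵥ u.ofLp ≤ a) (v : κ → ℝ) :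
    b / 4 * (v ⬝ᵥ v) ≤ W *ᵥ v ⬝ᵥ W *ᵥ v ∧ W *ᵥ v ⬝ᵥ W *ᵥ v ≤ 4 * a * (v ⬝ᵥ v) := by
  classical
  let T : EuclideanSpace ℝ κ →L[ℝ] EuclideanSpace ℝ ι :=
    LinearMap.toContinuousLinearMap (Matrix.toLpLin 2 2 W)
  have hT : ∀ v : EuclideanSpace ℝ κ, ‖T v‖ ^ 2 = W *ᵥ v.ofLp ⬝ᵥ W *ᵥ v.ofLp := fun v =>
    norm_toLp_sq (W *ᵥ v.ofLp)
  have hnorm : ‖T‖ ≤ 2 * √a :=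
    opNorm_le_of_isCover_sphere T hε hN (Real.sqrt_nonneg a) fun u hu =>
      Real.le_sqrt_of_sq_le (hT u ▸ (hW u hu).2)
  have hlower := mul_norm_le_norm_apply_of_isCover_sphere T hN (b := √b)
    (calc 2 * ε * ‖T‖ ≤ 2 * ε * (2 * √a) := by gcongr
      _ = √(16 * ε ^ 2 * a) := by
        rw [Real.sqrt_mul (by positivity), show 16 * (ε : ℝ) ^ 2 = (4 * ε) ^ 2 by ring,
          Real.sqrt_sq (by positivity)]
        ring
      _ ≤ √b := Real.sqrt_le_sqrt hab)
    (fun u hu => (Real.sqrt_le_iff.2 ⟨norm_nonneg _, hT u ▸ (hW u hu).1⟩)) (WithLp.toLp 2 v)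
  have hv := hT (WithLp.toLp 2 v)
  rw [← hv, ← norm_toLp_sq]
  constructor
  · calc b / 4 * ‖WithLp.toLp 2 v‖ ^ 2 = (√b / 2 * ‖WithLp.toLp 2 v‖) ^ 2 := by
          rw [mul_pow, div_pow, Real.sq_sqrt hb]
          norm_num
      _ ≤ ‖T (WithLp.toLp 2 v)‖ ^ 2 := by gcongr
  · calc ‖T (WithLp.toLp 2 v)‖ ^ 2 ≤ (2 * √a * ‖WithLp.toLp 2 v‖) ^ 2 := by
          gcongr
          exact T.le_of_opNorm_le hnorm _
      _ = 4 * a * ‖WithLp.toLp 2 v‖ ^ 2 := by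
          rw [mul_pow, mul_pow, Real.sq_sqrt ha]
          norm_num

theorem measure_not_forall_dotProduct_mulVec_self_bounds_le {Ω : Type*} [MeasurableSpace Ω]
    {P : Measure Ω} (W : Ω → Matrix ι κ ℝ) {ε a b : ℝ} (hε_pos : 0 < ε) (hε : ε ≤ 1 / 2)
    (ha : 0 ≤ a) (hb : 0 ≤ b) (hab : 16 * ε ^ 2 * a ≤ b) {q : ℝ≥0∞}
    (hq : ∀ u : κ → ℝ, u ⬝ᵥ u = 1 →
      P {ω | ¬ (b ≤ W ω *ᵥ u ⬝ᵥ W ω *ᵥ u ∧ W ω *ᵥ u ⬝ᵥ W ω *ᵥ u ≤ a)} ≤ q) :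
    P {ω | ¬ ∀ v : κ → ℝ, b / 4 * (v ⬝ᵥ v) ≤ W ω *ᵥ v ⬝ᵥ W ω *ᵥ v ∧
      W ω *ᵥ v ⬝ᵥ W ω *ᵥ v ≤ 4 * a * (v ⬝ᵥ v)} ≤
      ENNReal.ofReal ((3 / ε) ^ Fintype.card κ) * q := by
  lift ε to ℝ≥0 using hε_pos.le
  obtain ⟨N, hunit, hcover, hcard⟩ :=
    exists_isCover_sphere (EuclideanSpace ℝ κ) (ε := ε) (by exact_mod_cast hε_pos)
  let bad (u : κ → ℝ) : Set Ω := {ω | ¬ (b ≤ W ω *ᵥ u ⬝ᵥ W ω *ᵥ u ∧ W ω *ᵥ u ⬝ᵥ W ω *ᵥ u ≤ a)}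
  have hcard' : (N.card : ℝ) ≤ (3 / ε) ^ Fintype.card κ := by
    rw [finrank_euclideanSpace] at hcard
    refine hcard.trans (pow_le_pow_left₀ (by positivity) ?_ _)
    rw [← sub_nonneg]
    have : 1 ≤ 1 / (ε : ℝ) := by rw [le_div_iff₀ hε_pos]; linarith
    have : 3 / (ε : ℝ) - (1 + 2 / ε) = 1 / ε - 1 := by ring
    linarith
  calc P {ω | ¬ ∀ v : κ → ℝ, b / 4 * (v ⬝ᵥ v) ≤ W ω *ᵥ v ⬝ᵥ W ω *ᵥ v ∧
        W ω *ᵥ v ⬝ᵥ W ω *ᵥ v ≤ 4 * a * (v ⬝ᵥ v)}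
      ≤ P (⋃ u ∈ N, bad u.ofLp) := measure_mono fun ω hω => by
        by_contra hgood
        simp only [bad, Set.mem_iUnion, Set.mem_ofPred_eq, not_exists, not_not] at hgood
        exact hω (dotProduct_mulVec_self_bounds_of_isCover (by exact_mod_cast hε) hcover ha hb hab
          hgood)
    _ ≤ ∑ u ∈ N, P (bad u.ofLp) := measure_biUnion_finset_le _ _
    _ ≤ ∑ _u ∈ N, q := Finset.sum_le_sum fun u hu => hq _ (by
        rw [← norm_toLp_sq]
        simp [hunit u hu])
    _ = N.card * q := by rw [Finset.sum_const, nsmul_eq_mul]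
    _ ≤ ENNReal.ofReal ((3 / ε) ^ Fintype.card κ) * q := by
        gcongr
        rw [← ENNReal.ofReal_natCast]
        exact ENNReal.ofReal_le_ofReal hcard'

end UniformBounds

section Psi2NormBounds

variable {Ω : Type*} [MeasurableSpace Ω] {P : Measure Ω} [IsProbabilityMeasure P] {L : ℝ≥0}

/-- The variance proxy of a centred random variable with sub-Gaussian norm at most `L`. It is
computed from `L + 1` instead of `L` because the infimum defining the norm need not be attained. -/
noncomputable def proxy (L : ℝ≥0) : ℝ≥0 := 2 * (L + 1) ^ 2

theorem one_le_proxy (L : ℝ≥0) : 1 ≤ proxy L :=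
  one_le_mul one_le_two (one_le_pow₀ le_add_self)

theorem hasSubgaussianMGF_of_psi2Norm_le {U : Ω → ℝ} (hU : Measurable U)
    (hmean : ∫ ω, U ω ∂P = 0) (h : psi2Norm U P ≤ L) : HasSubgaussianMGF U (proxy L) P :=
  hasSubgaussianMGF_of_psi2Norm_lt hU hmean
    (h.trans_lt (ENNReal.coe_lt_coe.2 (lt_add_one L)))

theorem isSubgaussianVec_of_forall_unit {ι : Type*} [Fintype ι] {ξ : Ω → ι → ℝ} {c : ℝ≥0}
    (h : ∀ u : ι → ℝ, u ⬝ᵥ u = 1 → HasSubgaussianMGF (fun ω => u ⬝ᵥ ξ ω) c P) :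
    IsSubgaussianVec ξ c P := by
  intro u
  rcases (dotProduct_self_nonneg u).eq_or_lt with hzero | hpos
  · rw [eq_comm, dotProduct_self_eq_zero] at hzero
    simp [hzero]
  have hsqrt : √(u ⬝ᵥ u) ≠ 0 := (Real.sqrt_pos.2 hpos).ne'
  have hsq := Real.sq_sqrt hpos.le
  have hunit : ((√(u ⬝ᵥ u))⁻¹ • u) ⬝ᵥ ((√(u ⬝ᵥ u))⁻¹ • u) = 1 := by
    rw [smul_dotProduct, dotProduct_smul, smul_eq_mul, smul_eq_mul]
    nth_rw 3 [← hsq]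
    field_simp
  have hscale := (h _ hunit).const_mul √(u ⬝ᵥ u)
  simp only [smul_dotProduct, smul_eq_mul, mul_inv_cancel_left₀ hsqrt] at hscale
  refine hasSubgaussianMGF_mono hscale (NNReal.coe_le_coe.1 (le_of_eq ?_))
  rw [NNReal.coe_mul c, Real.coe_toNNReal _ hpos.le, mul_comm (c : ℝ)]
  exact congrArg (· * (c : ℝ)) hsq

theorem isSubgaussianVec_of_vecPsi2Norm_le {d : ℕ} {V : Ω → Fin d → ℝ} (hV : Measurable V)
    (hmean : ∀ k, ∫ ω, V ω k ∂P = 0) (h : vecPsi2Norm V P ≤ L) :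
    IsSubgaussianVec V (proxy L) P := by
  have hdir : ∀ u : Fin d → ℝ, u ⬝ᵥ u = 1 → psi2Norm (fun ω => u ⬝ᵥ V ω) P ≤ L := fun u hu => by
    simp_rw [dotProduct_comm u]
    exact (le_iSup₂ (f := fun (u : Fin d → ℝ) (_ : u ⬝ᵥ u = 1) =>
      psi2Norm (fun ω => V ω ⬝ᵥ u) P) u hu).trans h
  have hint : ∀ k, Integrable (fun ω => V ω k) P := fun k =>
    (hasSubgaussianMGF_of_psi2Norm_le (by fun_prop) (hmean k)
      (by simpa using hdir (Pi.single k 1) (by simp))).integrable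
  refine isSubgaussianVec_of_forall_unit fun u hu =>
    hasSubgaussianMGF_of_psi2Norm_le (by simp only [dotProduct]; fun_prop) ?_ (hdir u hu)
  simp only [dotProduct]
  rw [integral_finsetSum _ fun k _ => (hint k).const_mul _]
  exact Finset.sum_eq_zero fun k _ => by rw [integral_const_mul, hmean, mul_zero]

end Psi2NormBounds

section IndependentCopies

theorem iIndepFun_comp_measurePreserving {Ω Ω' : Type*} [MeasurableSpace Ω] [MeasurableSpace Ω']
    {P : Measure Ω} {P' : Measure Ω'} {f : Ω' → Ω} (hf : MeasurePreserving f P' P) {ι : Type*}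
    {E : ι → Type*} [∀ j, MeasurableSpace (E j)] {X : ∀ j, Ω → E j} (hX : ∀ j, Measurable (X j))
    (hind : iIndepFun X P) : iIndepFun (fun j ω => X j (f ω)) P' := by
  rw [iIndepFun_iff_measure_inter_preimage_eq_mul] at hind ⊢
  intro S s hs
  have hmeas : ∀ j ∈ S, MeasurableSet (X j ⁻¹' s j) := fun j hj => hX j (hs j hj)
  have hprod : ∏ j ∈ S, P' (f ⁻¹' (X j ⁻¹' s j)) = ∏ j ∈ S, P (X j ⁻¹' s j) :=
    Finset.prod_congr rfl fun j hj => hf.measure_preimage (hmeas j hj).nullMeasurableSet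
  have hinter := hf.measure_preimage (Finset.measurableSet_biInter S hmeas).nullMeasurableSet
  rw [Set.preimage_iInter₂] at hinter
  exact (hinter.trans (hind S hs)).trans hprod.symm

variable {Ω : Type*} [MeasurableSpace Ω] {P : Measure Ω} [IsProbabilityMeasure P]
  {κ : Type*} [Fintype κ] {U : Ω → ℝ} {c : ℝ≥0}

theorem hasSubgaussianMGF_pi_eval (hU : HasSubgaussianMGF U c P) (i : κ) :
    HasSubgaussianMGF (fun ω : κ → Ω => U (ω i)) c (Measure.pi fun _ => P) := by
  rw [← (measurePreserving_eval (fun _ : κ => P) i).map_eq] at hU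
  exact hU.of_map (measurable_pi_apply i).aemeasurable

theorem isSubgaussianVec_pi (hU : HasSubgaussianMGF U c P) :
    IsSubgaussianVec (fun (ω : κ → Ω) i => U (ω i)) c (Measure.pi fun _ => P) :=
  isSubgaussianVec_of_iIndepFun (iIndepFun_pi fun _ => hU.aemeasurable)
    (hasSubgaussianMGF_pi_eval hU)

theorem integral_sq_dotProduct_pi (hU : MemLp U 2 P) (hmean : ∫ ω, U ω ∂P = 0) (u : κ → ℝ) :
    ∫ ω : κ → Ω, (u ⬝ᵥ fun i => U (ω i)) ^ 2 ∂(Measure.pi fun _ => P) =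
      (u ⬝ᵥ u) * ∫ ω, U ω ^ 2 ∂P := by
  have hmp (i : κ) := measurePreserving_eval (fun _ : κ => P) i
  have hL2 : ∀ i, MemLp (fun ω : κ → Ω => u i * U (ω i)) 2 (Measure.pi fun _ => P) := fun i =>
    (hU.comp_measurePreserving (hmp i)).const_mul _
  have hmean_sum : ∫ ω : κ → Ω, (u ⬝ᵥ fun i => U (ω i)) ∂(Measure.pi fun _ => P) = 0 := by
    simp only [dotProduct]
    rw [integral_finsetSum _ fun i _ => (hL2 i).integrable one_le_two]
    refine Finset.sum_eq_zero fun i _ => ?_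
    rw [integral_const_mul, integral_comp_eval (μ := fun _ : κ => P) hU.aestronglyMeasurable,
      hmean, mul_zero]
  have hsum := variance_sum_pi (μ := fun _ : κ => P) (X := fun i x => u i * U x)
    fun i => hU.const_mul _
  rw [Finset.sum_fn] at hsum
  change Var[fun ω : κ → Ω => u ⬝ᵥ fun i => U (ω i); _] = _ at hsum
  rw [variance_of_integral_eq_zero _ hmean_sum] at hsum
  · simp_rw [hsum, variance_const_mul,
      variance_of_integral_eq_zero hU.aestronglyMeasurable.aemeasurable hmean, ← Finset.sum_mul,
      dotProduct, sq]
  · exact Finset.aemeasurable_fun_sum _ fun i _ => (hL2 i).aestronglyMeasurable.aemeasurable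

variable {ι : Type*} {V : Ω → ι → ℝ}

theorem iIndepFun_transpose_mulVec_pi (hV : Measurable V)
    (hind : iIndepFun (fun j ω => V ω j) P) (v : κ → ℝ) :
    iIndepFun (fun j (ω : κ → Ω) => ((Matrix.of fun i => V (ω i))ᵀ *ᵥ v) j)
      (Measure.pi fun _ => P) := by
  have hcolumns := iIndepFun_columns (X := fun i j (ω : κ → Ω) => V (ω i) j)
    (fun i j => by fun_prop)
    (iIndepFun_pi (μ := fun _ : κ => P) (X := fun _ => V) fun _ => hV.aemeasurable)
    fun i => iIndepFun_comp_measurePreserving (measurePreserving_eval (fun _ : κ => P) i)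
      (fun j => by fun_prop) hind
  exact hcolumns.comp (fun _ y => y ⬝ᵥ v) fun _ => by simp only [dotProduct]; fun_prop

end IndependentCopies

section IndependentEntries

variable {Ω : Type*} [MeasurableSpace Ω] {P : Measure Ω}

/-- A random vector with independent sub-Gaussian entries of unit second moment and with variance
proxy `c`. -/
structure HasIndepSubgaussianEntries {ι : Type*} (ξ : Ω → ι → ℝ) (c : ℝ≥0) (P : Measure Ω) :
    Prop where
  measurable : Measurable ξ
  indep : iIndepFun (fun j ω => ξ ω j) P
  subgaussian : ∀ j, HasSubgaussianMGF (fun ω => ξ ω j) c P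
  second_moment : ∀ j, ∫ ω, ξ ω j ^ 2 ∂P = 1

variable {c : ℝ≥0} {κ : Type*} [Fintype κ]

theorem hasIndepSubgaussianEntries_pi [IsProbabilityMeasure P] {U : Ω → ℝ} (hU : Measurable U)
    (h : HasSubgaussianMGF U c P) (hsq : ∫ ω, U ω ^ 2 ∂P = 1) :
    HasIndepSubgaussianEntries (fun (ω : κ → Ω) i => U (ω i)) c (Measure.pi fun _ => P) where
  measurable := by fun_prop
  indep := iIndepFun_pi fun _ => hU.aemeasurable
  subgaussian := hasSubgaussianMGF_pi_eval h
  second_moment i := by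
    rw [← hsq]
    exact integral_comp_eval (μ := fun _ : κ => P) (f := fun ω => U ω ^ 2) (by fun_prop)

theorem hasIndepSubgaussianEntries_transpose_mulVec_pi [IsProbabilityMeasure P] {ι : Type*}
    {V : Ω → ι → ℝ} (hV : HasIndepSubgaussianEntries V c P) (hmean : ∀ j, ∫ ω, V ω j ∂P = 0)
    {u : κ → ℝ} (hu : u ⬝ᵥ u = 1) :
    HasIndepSubgaussianEntries (fun ω : κ → Ω => (Matrix.of fun i => V (ω i))ᵀ *ᵥ u) c
      (Measure.pi fun _ => P) := by
  have := hV.measurable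
  have hentry : ∀ (ω : κ → Ω) j,
      ((Matrix.of fun i => V (ω i))ᵀ *ᵥ u) j = u ⬝ᵥ fun i => V (ω i) j :=
    fun ω j => dotProduct_comm _ _
  refine ⟨?_, iIndepFun_transpose_mulVec_pi hV.measurable hV.indep u, fun j => ?_, fun j => ?_⟩
  · refine measurable_pi_lambda _ fun j => ?_
    simp only [hentry, dotProduct]
    fun_prop
  · simp only [hentry]
    simpa [hu] using isSubgaussianVec_pi (κ := κ) (hV.subgaussian j) u
  · simp only [hentry]
    rw [integral_sq_dotProduct_pi ((hV.subgaussian j).memLp 2) (hmean j), hu, hV.second_moment j,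
      one_mul]

end IndependentEntries

section RandomMatrixBounds

theorem posSemidef_transpose_mul_self {ρ ι : Type*} [Finite ι] [Fintype ρ] (B : Matrix ρ ι ℝ) :
    (Bᵀ * B).PosSemidef := by
  simpa using Matrix.posSemidef_conjTranspose_mul_self B

variable {Ω : Type*} [MeasurableSpace Ω] {P : Measure Ω} {ρ ι κ : Type*} [Fintype ρ] [Fintype ι]
  [Fintype κ] {c : ℝ≥0} {B : Matrix ρ ι ℝ} {m : ℝ}

theorem measure_not_mulVec_sq_bounds_le (hm : ∀ x, x ⬝ᵥ (Bᵀ * B) *ᵥ x ≤ m * (x ⬝ᵥ x))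
    (hm_pos : 0 < m) (hc : 0 < c) {ξ : Ω → ι → ℝ} (hξ : HasIndepSubgaussianEntries ξ c P) :
    P {ω | ¬ ((Bᵀ * B).trace / 2 ≤ B *ᵥ ξ ω ⬝ᵥ B *ᵥ ξ ω ∧
        B *ᵥ ξ ω ⬝ᵥ B *ᵥ ξ ω ≤ 4 * c * (Bᵀ * B).trace)} ≤
      ENNReal.ofReal (2 * Real.exp (-((Bᵀ * B).trace / (16 * lowerTailConst c * m)))) := by
  have := hξ.indep.isProbabilityMeasure
  set M := Bᵀ * B
  have hM : M.PosSemidef := posSemidef_transpose_mul_self B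
  have htr := hM.trace_nonneg
  have hθ : 1 ≤ lowerTailConst c := by
    have := Real.one_le_exp (show (0 : ℝ) ≤ c / 2 by positivity)
    unfold lowerTailConst
    nlinarith [sq_nonneg (c : ℝ)]
  have hlower := measure_quadForm_le_half_trace_le hM hm hm_pos hξ.measurable hξ.indep
    hξ.subgaussian hξ.second_moment
  have hupper := measure_le_quadForm_le hM hm hm_pos hξ.measurable
    (isSubgaussianVec_of_iIndepFun hξ.indep hξ.subgaussian) hc
  simp_rw [← dotProduct_transpose_mul_self_mulVec B]
  calc _ ≤ P ({ω | ξ ω ⬝ᵥ M *ᵥ ξ ω ≤ M.trace / 2} ∪ {ω | 4 * c * M.trace ≤ ξ ω ⬝ᵥ M *ᵥ ξ ω}) :=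
        measure_mono fun ω hω => (not_and_or.1 hω).imp (fun h => (not_le.1 h).le)
          fun h => (not_le.1 h).le
    _ ≤ _ := (measure_union_le _ _).trans (add_le_add hlower hupper)
    _ ≤ _ := by
        rw [← ENNReal.ofReal_add (Real.exp_pos _).le (Real.exp_pos _).le, two_mul (Real.exp _)]
        gcongr
        linarith

theorem measure_not_forall_mul_mulVec_sq_bounds_le
    (hm : ∀ x, x ⬝ᵥ (Bᵀ * B) *ᵥ x ≤ m * (x ⬝ᵥ x)) (hm_pos : 0 < m) (hc : 1 ≤ c)
    {Y : Ω → Matrix ι κ ℝ}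
    (hY : ∀ u, u ⬝ᵥ u = 1 → HasIndepSubgaussianEntries (fun ω => Y ω *ᵥ u) c P) :
    P {ω | ¬ ∀ v : κ → ℝ,
        (Bᵀ * B).trace / 8 * (v ⬝ᵥ v) ≤ (B * Y ω) *ᵥ v ⬝ᵥ (B * Y ω) *ᵥ v ∧
        (B * Y ω) *ᵥ v ⬝ᵥ (B * Y ω) *ᵥ v ≤ 16 * c * (Bᵀ * B).trace * (v ⬝ᵥ v)} ≤
      ENNReal.ofReal (2 * Real.exp (Fintype.card κ * Real.log (48 * c) -
        (Bᵀ * B).trace / (16 * lowerTailConst c * m))) := by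
  have : (1 : ℝ) ≤ c := hc
  have hM : (Bᵀ * B).PosSemidef := posSemidef_transpose_mul_self B
  have htr := hM.trace_nonneg
  have hnet := measure_not_forall_dotProduct_mulVec_self_bounds_le (fun ω => B * Y ω)
    (ε := 1 / (16 * c)) (a := 4 * c * (Bᵀ * B).trace) (b := (Bᵀ * B).trace / 2) (by positivity)
    (by rw [div_le_div_iff₀ (by positivity) (by norm_num)]; linarith) (by positivity)
    (by positivity)
    (by
      rw [show 16 * (1 / (16 * c)) ^ 2 * (4 * c * (Bᵀ * B).trace) =
        (Bᵀ * B).trace / (4 * c) by field_simp; ring]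
      gcongr
      linarith)
    (fun u hu => by
      simp only [← Matrix.mulVec_mulVec]
      exact measure_not_mulVec_sq_bounds_le hm hm_pos (zero_lt_one.trans_le hc) (hY u hu))
  rw [show (Bᵀ * B).trace / 2 / 4 = (Bᵀ * B).trace / 8 by ring,
    show 4 * (4 * c * (Bᵀ * B).trace) = 16 * c * (Bᵀ * B).trace by ring] at hnet
  refine hnet.trans_eq ?_
  rw [show 3 / (1 / (16 * (c : ℝ))) = 48 * c by field_simp; norm_num,
    ← ENNReal.ofReal_mul (by positivity), sub_eq_add_neg, Real.exp_add, Real.exp_nat_mul,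
    Real.exp_log (by positivity), mul_left_comm]

/-- The factor by which the effective rank of the noise has to exceed the sample size, and the
sample size the number of factors, as a function of the variance proxy `c`. -/
noncomputable def rankConst (c : ℝ) : ℝ := 16 * lowerTailConst c * (Real.log (48 * c) + 1)

theorem rankConst_pos {c : ℝ} (hc : 1 ≤ c) : 0 < rankConst c := by
  have := lowerTailConst_pos c
  have : 0 ≤ Real.log (48 * c) := Real.log_nonneg (by linarith)
  unfold rankConst
  positivity

theorem measure_not_noise_bounds_le [IsProbabilityMeasure P] {V : Ω → ι → ℝ}
    (hV : HasIndepSubgaussianEntries V c P) (hmean : ∀ j, ∫ ω, V ω j ∂P = 0) (hc : 1 ≤ c)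
    (hm : ∀ x, x ⬝ᵥ (Bᵀ * B) *ᵥ x ≤ m * (x ⬝ᵥ x)) (hm_pos : 0 < m)
    (hrank : rankConst c * Fintype.card κ * m ≤ (Bᵀ * B).trace) :
    (Measure.pi fun _ : κ => P) {ω | ¬ ∀ v : κ → ℝ,
        (Bᵀ * B).trace / 8 * (v ⬝ᵥ v) ≤ (B * (Matrix.of fun i => V (ω i))ᵀ) *ᵥ v ⬝ᵥ
          (B * (Matrix.of fun i => V (ω i))ᵀ) *ᵥ v ∧
        (B * (Matrix.of fun i => V (ω i))ᵀ) *ᵥ v ⬝ᵥ (B * (Matrix.of fun i => V (ω i))ᵀ) *ᵥ v ≤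
          16 * c * (Bᵀ * B).trace * (v ⬝ᵥ v)} ≤
      ENNReal.ofReal (2 * Real.exp (-Fintype.card κ)) := by
  refine (measure_not_forall_mul_mulVec_sq_bounds_le hm hm_pos hc fun u hu =>
    hasIndepSubgaussianEntries_transpose_mulVec_pi hV hmean hu).trans ?_
  have := lowerTailConst_pos c
  have : (Real.log (48 * c) + 1) * Fintype.card κ ≤
      (Bᵀ * B).trace / (16 * lowerTailConst c * m) := by
    rw [le_div_iff₀ (by positivity)]
    refine le_trans (le_of_eq ?_) hrank
    unfold rankConst
    ring
  gcongr
  linarith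

theorem measure_not_factor_bound_le [IsProbabilityMeasure P] {V : Ω → ι → ℝ} (hV : Measurable V)
    (h : IsSubgaussianVec V c P) (hc : 1 ≤ c)
    (hiso : ∀ u : ι → ℝ, u ⬝ᵥ u = 1 → ∫ ω, (u ⬝ᵥ V ω) ^ 2 ∂P = 1)
    (hcard : 2 * rankConst c * Fintype.card ι ≤ Fintype.card κ) :
    (Measure.pi fun _ : κ => P) {ω | ¬ ∀ v : ι → ℝ, Fintype.card κ / 8 * (v ⬝ᵥ v) ≤
        (Matrix.of fun i => V (ω i)) *ᵥ v ⬝ᵥ (Matrix.of fun i => V (ω i)) *ᵥ v} ≤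
      ENNReal.ofReal (2 * Real.exp (-(Fintype.card κ / (32 * lowerTailConst c)))) := by
  classical
  have hrows : ∀ u : ι → ℝ, u ⬝ᵥ u = 1 → HasIndepSubgaussianEntries
      (fun ω : κ → Ω => (Matrix.of fun i => V (ω i)) *ᵥ u) c (Measure.pi fun _ => P) := by
    intro u hu
    have hcopies := hasIndepSubgaussianEntries_pi (κ := κ) (U := fun ω => u ⬝ᵥ V ω)
      (by simp only [dotProduct]; fun_prop) (by simpa [hu] using h u) (hiso u hu)
    simp_rw [dotProduct_comm u] at hcopies
    exact hcopies
  have hbounds := measure_not_forall_mul_mulVec_sq_bounds_le (B := (1 : Matrix κ κ ℝ)) (m := 1)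
    (by simp) one_pos hc hrows
  simp only [Matrix.one_mul, Matrix.transpose_one, Matrix.trace_one, mul_one] at hbounds
  refine (measure_mono fun ω hω => mt (fun hcon v => (hcon v).1) hω).trans (hbounds.trans ?_)
  have hθ := lowerTailConst_pos c
  have : Fintype.card ι * Real.log (48 * c) ≤ Fintype.card κ / (32 * lowerTailConst c) := by
    rw [le_div_iff₀ (by positivity)]
    refine le_trans ?_ hcard
    unfold rankConst
    nlinarith [mul_nonneg hθ.le (Nat.cast_nonneg (α := ℝ) (Fintype.card ι))]
  have : Fintype.card κ / (16 * lowerTailConst c) =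
      2 * (Fintype.card κ / (32 * lowerTailConst c)) := by ring
  gcongr
  linarith

end RandomMatrixBounds

section QuadFormTraceTail

variable {Ω : Type*} [MeasurableSpace Ω] {P : Measure Ω} {ι : Type*} [Fintype ι]

theorem quadForm_le_trace_mul {M : Matrix ι ι ℝ} (hM : M.PosSemidef) (x : ι → ℝ) :
    x ⬝ᵥ M *ᵥ x ≤ M.trace * (x ⬝ᵥ x) := by
  classical
  obtain ⟨B, rfl, -⟩ := exists_transpose_mul_self_eq hM
  rw [dotProduct_transpose_mul_self_mulVec, Matrix.trace_mul_comm]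
  simp only [dotProduct, Matrix.trace, Matrix.diag, Matrix.mul_apply, Matrix.transpose_apply,
    Matrix.mulVec, ← sq, Finset.sum_mul]
  exact Finset.sum_le_sum fun i _ => by
    simpa only [Finset.sum_mul] using Finset.sum_mul_sq_le_sq_mul_sq Finset.univ (B i) x

theorem measure_trace_mul_lt_quadForm_le [IsProbabilityMeasure P] {c : ℝ≥0} (hc : 0 < c)
    {ξ : Ω → ι → ℝ} (hξ : Measurable ξ) (h : IsSubgaussianVec ξ c P) {M : Matrix ι ι ℝ}
    (hM : M.PosSemidef) (s : ℝ) :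
    P {ω | 4 * c * s * M.trace < ξ ω ⬝ᵥ M *ᵥ ξ ω} ≤ ENNReal.ofReal (Real.exp (1 / 2 - s)) := by
  have hle := quadForm_le_trace_mul hM
  rcases hM.trace_nonneg.eq_or_lt with htr | htr
  · rw [← htr] at hle ⊢
    rw [show {ω | 4 * c * s * 0 < ξ ω ⬝ᵥ M *ᵥ ξ ω} = ∅ from
      Set.eq_empty_of_forall_notMem fun ω hω => by
        have : 4 * c * s * 0 < ξ ω ⬝ᵥ M *ᵥ ξ ω := hω
        linarith [hle (ξ ω)], measure_empty]
    exact zero_le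
  · have hmeas : Measurable fun ω => 1 / (4 * c * M.trace) * (ξ ω ⬝ᵥ M *ᵥ ξ ω) :=
      ((measurable_bilinForm M).comp (hξ.prodMk hξ)).const_mul _
    have hmoment := expMoment_quadForm_le hM hle hξ h (l := 1 / (4 * c * M.trace))
      (by positivity) (by field_simp; norm_num)
    refine (measure_mono fun ω hω => ?_).trans
      ((measure_le_of_expMoment_le hmeas hmoment s).trans_eq ?_)
    · have : 4 * c * s * M.trace < ξ ω ⬝ᵥ M *ᵥ ξ ω := hω
      change s ≤ 1 / (4 * c * M.trace) * (ξ ω ⬝ᵥ M *ᵥ ξ ω)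
      rw [div_mul_eq_mul_div, le_div_iff₀ (by positivity)]
      linarith
    · congr 3
      field_simp
      norm_num

end QuadFormTraceTail

section TraceBounds

variable {ι κ : Type*} [Fintype ι] [Fintype κ]

theorem quadForm_nonneg {M : Matrix ι ι ℝ} (hM : M.PosSemidef) (x : ι → ℝ) : 0 ≤ x ⬝ᵥ M *ᵥ x :=
  hM.dotProduct_mulVec_nonneg x

theorem quadForm_add_le {M : Matrix ι ι ℝ} (hM : M.PosSemidef) (x y : ι → ℝ) :
    (x + y) ⬝ᵥ M *ᵥ (x + y) ≤ 2 * (x ⬝ᵥ M *ᵥ x) + 2 * (y ⬝ᵥ M *ᵥ y) := by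
  have h := quadForm_nonneg hM (x - y)
  simp only [sub_dotProduct, Matrix.mulVec_sub, dotProduct_sub, add_dotProduct, Matrix.mulVec_add,
    dotProduct_add] at h ⊢
  linarith

theorem sub_dotProduct_self_le (x y : ι → ℝ) :
    (x - y) ⬝ᵥ (x - y) ≤ 2 * (x ⬝ᵥ x) + 2 * (y ⬝ᵥ y) := by
  classical
  simpa [sub_eq_add_neg] using quadForm_add_le Matrix.PosSemidef.one x (-y)

theorem quadForm_transpose_mul_mul (M : Matrix ι ι ℝ) (R : Matrix ι κ ℝ) (w : κ → ℝ) :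
    w ⬝ᵥ (Rᵀ * M * R) *ᵥ w = R *ᵥ w ⬝ᵥ M *ᵥ (R *ᵥ w) := by
  rw [Matrix.mul_assoc, ← Matrix.mulVec_mulVec, ← Matrix.mulVec_mulVec,
    Matrix.dotProduct_transpose_mulVec, dotProduct_comm]

theorem dotProduct_self_le_of_eq_dotProduct {x z : ι → ℝ} {y : κ → ℝ} {a : ℝ} (ha : 0 ≤ a)
    (hy : y ⬝ᵥ y = x ⬝ᵥ z) (hz : z ⬝ᵥ z ≤ a * (y ⬝ᵥ y)) : y ⬝ᵥ y ≤ a * (x ⬝ᵥ x) := by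
  have hx := dotProduct_self_nonneg x
  rcases (dotProduct_self_nonneg y).eq_or_lt with h0 | h0
  · rw [← h0]
    positivity
  · have hcs : (x ⬝ᵥ z) ^ 2 ≤ (x ⬝ᵥ x) * (z ⬝ᵥ z) := by
      simpa only [dotProduct, ← sq] using Finset.sum_mul_sq_le_sq_mul_sq Finset.univ x z
    refine le_of_mul_le_mul_right ?_ h0
    calc (y ⬝ᵥ y) * (y ⬝ᵥ y) = (x ⬝ᵥ z) ^ 2 := by rw [← hy, sq]
      _ ≤ (x ⬝ᵥ x) * (a * (y ⬝ᵥ y)) := hcs.trans (mul_le_mul_of_nonneg_left hz hx)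
      _ = a * (x ⬝ᵥ x) * (y ⬝ᵥ y) := by ring

theorem mulVec_sq_le_of_transpose (M : Matrix κ ι ℝ) {a : ℝ} (ha : 0 ≤ a)
    (h : ∀ v, Mᵀ *ᵥ v ⬝ᵥ Mᵀ *ᵥ v ≤ a * (v ⬝ᵥ v)) (x : ι → ℝ) :
    M *ᵥ x ⬝ᵥ M *ᵥ x ≤ a * (x ⬝ᵥ x) :=
  dotProduct_self_le_of_eq_dotProduct ha (Matrix.dotProduct_transpose_mulVec _ _ _).symm (h _)

theorem trace_le_trace_of_quadForm_le {M N : Matrix ι ι ℝ}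
    (h : ∀ x, x ⬝ᵥ M *ᵥ x ≤ x ⬝ᵥ N *ᵥ x) : M.trace ≤ N.trace := by
  classical
  exact Finset.sum_le_sum fun i _ => by simpa using h (Pi.single i 1)

theorem trace_le_card_mul {M : Matrix ι ι ℝ} {a : ℝ} (h : ∀ x, x ⬝ᵥ M *ᵥ x ≤ a * (x ⬝ᵥ x)) :
    M.trace ≤ Fintype.card ι * a := by
  classical
  have := trace_le_trace_of_quadForm_le (N := a • (1 : Matrix ι ι ℝ)) fun x => by
    simpa [Matrix.smul_mulVec] using h x
  simpa [mul_comm] using this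

theorem trace_transpose_mul_mul_le_card_mul {M : Matrix ι ι ℝ} (hM : M.PosSemidef)
    (R : Matrix ι κ ℝ) {a : ℝ} (ha : 0 ≤ a)
    (h : ∀ w, R *ᵥ w ⬝ᵥ M *ᵥ (R *ᵥ w) ≤ a * (w ⬝ᵥ w)) :
    (Rᵀ * M * R).trace ≤ Fintype.card ι * a := by
  classical
  obtain ⟨B, rfl, -⟩ := exists_transpose_mul_self_eq hM
  have hle : ∀ x, (B * R)ᵀ *ᵥ x ⬝ᵥ (B * R)ᵀ *ᵥ x ≤ a * (x ⬝ᵥ x) :=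
    mulVec_sq_le_of_transpose _ ha fun w => by
      rw [Matrix.transpose_transpose, ← Matrix.mulVec_mulVec]
      simpa only [dotProduct_transpose_mul_self_mulVec] using h w
  have htrace : (Rᵀ * (Bᵀ * B) * R).trace = ((B * R)ᵀᵀ * (B * R)ᵀ).trace := by
    rw [Matrix.trace_mul_comm (B * R)ᵀᵀ, Matrix.transpose_transpose, Matrix.transpose_mul]
    simp only [Matrix.mul_assoc]
  rw [htrace]
  exact trace_le_card_mul fun x => (dotProduct_transpose_mul_self_mulVec _ x).trans_le (hle x)

theorem mulVec_sq_le_of_isSymm_of_isIdempotentElem {Q : Matrix ι ι ℝ} (hs : Q.IsSymm)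
    (hi : IsIdempotentElem Q) (x : ι → ℝ) : Q *ᵥ x ⬝ᵥ Q *ᵥ x ≤ x ⬝ᵥ x := by
  have hself : Q *ᵥ x ⬝ᵥ Q *ᵥ x = x ⬝ᵥ Q *ᵥ x := by
    rw [← dotProduct_transpose_mul_self_mulVec, hs, hi]
  have := dotProduct_self_nonneg (x - Q *ᵥ x)
  simp only [sub_dotProduct, dotProduct_sub, dotProduct_comm (Q *ᵥ x) x] at this
  linarith

end TraceBounds

section RightInverse

variable {ν π : Type*} [Fintype ν] [Fintype π] [DecidableEq ν]

/-- The right inverse `Xᵀ (X Xᵀ)⁻¹` of a matrix `X` of full row rank, which is then the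
pseudo-inverse of `X`. Unlike `pinv` it is an explicit, hence measurable, function of `X`. -/
noncomputable def rightInv (X : Matrix ν π ℝ) : Matrix π ν ℝ := Xᵀ * (X * Xᵀ)⁻¹

variable {X : Matrix ν π ℝ}

theorem isUnit_det_mul_transpose {g : ℝ} (hg : 0 < g)
    (h : ∀ v, g * (v ⬝ᵥ v) ≤ Xᵀ *ᵥ v ⬝ᵥ Xᵀ *ᵥ v) : IsUnit (X * Xᵀ).det := by
  rw [← Matrix.isUnit_iff_isUnit_det, ← Matrix.mulVec_injective_iff_isUnit]
  refine (injective_iff_map_eq_zero (Matrix.mulVecLin (X * Xᵀ))).2 fun v hv => ?_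
  have hker : (X * Xᵀ) *ᵥ v = 0 := hv
  have hle := h v
  rw [← dotProduct_transpose_mul_self_mulVec, Matrix.transpose_transpose, hker,
    dotProduct_zero] at hle
  exact dotProduct_self_eq_zero.1 (le_antisymm (by nlinarith) (dotProduct_self_nonneg v))

theorem mul_rightInv (hX : IsUnit (X * Xᵀ).det) : X * rightInv X = 1 := by
  rw [rightInv, ← Matrix.mul_assoc, Matrix.mul_nonsing_inv _ hX]

theorem isSymm_rightInv_mul : (rightInv X * X).IsSymm := by
  rw [Matrix.IsSymm, rightInv, Matrix.transpose_mul, Matrix.transpose_mul,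
    Matrix.transpose_nonsing_inv, Matrix.transpose_mul, Matrix.transpose_transpose,
    Matrix.mul_assoc]

theorem isIdempotentElem_rightInv_mul (hX : IsUnit (X * Xᵀ).det) :
    IsIdempotentElem (rightInv X * X) := by
  rw [IsIdempotentElem, Matrix.mul_assoc, ← Matrix.mul_assoc X, mul_rightInv hX, Matrix.one_mul]

theorem rightInv_mul_mulVec_sq_le (hX : IsUnit (X * Xᵀ).det) (x : π → ℝ) :
    (rightInv X * X) *ᵥ x ⬝ᵥ (rightInv X * X) *ᵥ x ≤ x ⬝ᵥ x :=
  mulVec_sq_le_of_isSymm_of_isIdempotentElem isSymm_rightInv_mul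
    (isIdempotentElem_rightInv_mul hX) x

theorem rightInv_mulVec_sq_le {g : ℝ} (hg : 0 < g)
    (h : ∀ v, g * (v ⬝ᵥ v) ≤ Xᵀ *ᵥ v ⬝ᵥ Xᵀ *ᵥ v) (w : ν → ℝ) :
    rightInv X *ᵥ w ⬝ᵥ rightInv X *ᵥ w ≤ g⁻¹ * (w ⬝ᵥ w) := by
  set v := (X * Xᵀ)⁻¹ *ᵥ w
  have hv : rightInv X *ᵥ w = Xᵀ *ᵥ v := (Matrix.mulVec_mulVec _ _ _).symm
  have hw : X *ᵥ (Xᵀ *ᵥ v) = w := by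
    rw [← hv, Matrix.mulVec_mulVec, mul_rightInv (isUnit_det_mul_transpose hg h),
      Matrix.one_mulVec]
  rw [hv]
  refine dotProduct_self_le_of_eq_dotProduct (z := v) (inv_nonneg.2 hg.le) ?_ ?_
  · rw [dotProduct_comm w, ← hw, Matrix.dotProduct_mulVec v, ← Matrix.mulVec_transpose]
  · rw [inv_mul_eq_div, le_div_iff₀ hg, mul_comm]
    exact h v

theorem pinv_eq_rightInv {n p : ℕ} {X : Matrix (Fin n) (Fin p) ℝ} (hX : IsUnit (X * Xᵀ).det) :
    pinv X = rightInv X := by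
  have hone := mul_rightInv hX
  refine (pinv_isMoorePenrose X).unique ⟨?_, ?_, ?_, isSymm_rightInv_mul⟩
  · rw [hone, Matrix.one_mul]
  · rw [Matrix.mul_assoc, hone, Matrix.mul_one]
  · rw [hone, Matrix.transpose_one]

end RightInverse

section GoodSample

variable {ν π κ : Type*} [Fintype π] [Fintype κ]

/-- The design matrix, with rows `X_i = A Z_i + E_i`, for factors `Z_i` and noise vectors `E_i` that
are the rows of `F` and `N`. -/
def design (A : Matrix π κ ℝ) (F : Matrix ν κ ℝ) (N : Matrix ν π ℝ) : Matrix ν π ℝ := F * Aᵀ + N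

variable {A : Matrix π κ ℝ} {F : Matrix ν κ ℝ} {N : Matrix ν π ℝ}

theorem mulVec_transpose_mulVec_eq_design_sub (x : π → ℝ) :
    F *ᵥ (Aᵀ *ᵥ x) = design A F N *ᵥ x - N *ᵥ x := by
  rw [design, Matrix.add_mulVec, ← Matrix.mulVec_mulVec, add_sub_cancel_right]

variable [Fintype ν] [DecidableEq ν]

/-- The deterministic conditions on a sample, with factors `F`, feature noise `N` and response noise
`e`, under which the excess risk of the minimum-norm estimator is controlled. With
`G = rightInv 𝐗`, the last two fields say that the variance terms `‖G e‖²` in the norms given by the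
covariance matrices `SE` and `A SZ Aᵀ` are at most `t` times their expectations for a white noise
`e`. -/
structure IsGoodSample (A : Matrix π κ ℝ) (SZ : Matrix κ κ ℝ) (SE : Matrix π π ℝ) (a g h t : ℝ)
    (F : Matrix ν κ ℝ) (N : Matrix ν π ℝ) (e : ν → ℝ) : Prop where
  noise_le : ∀ v, Nᵀ *ᵥ v ⬝ᵥ Nᵀ *ᵥ v ≤ a * (v ⬝ᵥ v)
  le_design : ∀ v, g * (v ⬝ᵥ v) ≤ (design A F N)ᵀ *ᵥ v ⬝ᵥ (design A F N)ᵀ *ᵥ v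
  le_factor : ∀ γ, h * (γ ⬝ᵥ SZ *ᵥ γ) ≤ F *ᵥ γ ⬝ᵥ F *ᵥ γ
  variance_noise_le : e ⬝ᵥ ((rightInv (design A F N))ᵀ * SE * rightInv (design A F N)) *ᵥ e ≤
    t * ((rightInv (design A F N))ᵀ * SE * rightInv (design A F N)).trace
  variance_factor_le :
    e ⬝ᵥ ((Aᵀ * rightInv (design A F N))ᵀ * SZ * (Aᵀ * rightInv (design A F N))) *ᵥ e ≤
      t * ((Aᵀ * rightInv (design A F N))ᵀ * SZ * (Aᵀ * rightInv (design A F N))).trace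

namespace IsGoodSample

variable {SZ : Matrix κ κ ℝ} {SE : Matrix π π ℝ} {a g h t : ℝ} {e : ν → ℝ}

theorem isUnit_det (hs : IsGoodSample A SZ SE a g h t F N e) (hg : 0 < g) :
    IsUnit (design A F N * (design A F N)ᵀ).det :=
  isUnit_det_mul_transpose hg hs.le_design

theorem noise_rightInv_le (hs : IsGoodSample A SZ SE a g h t F N e) (ha : 0 ≤ a) (hg : 0 < g)
    (w : ν → ℝ) :
    N *ᵥ (rightInv (design A F N) *ᵥ w) ⬝ᵥ N *ᵥ (rightInv (design A F N) *ᵥ w) ≤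
      a / g * (w ⬝ᵥ w) :=
  calc _ ≤ a * (rightInv (design A F N) *ᵥ w ⬝ᵥ rightInv (design A F N) *ᵥ w) :=
        mulVec_sq_le_of_transpose N ha hs.noise_le _
    _ ≤ a * (g⁻¹ * (w ⬝ᵥ w)) :=
        mul_le_mul_of_nonneg_left (rightInv_mulVec_sq_le hg hs.le_design w) ha
    _ = _ := by ring

theorem bias_sq_le (hs : IsGoodSample A SZ SE a g h t F N e) (ha : 0 ≤ a) (hg : 0 < g)
    (x : π → ℝ) :
    rightInv (design A F N) *ᵥ (F *ᵥ (Aᵀ *ᵥ x)) ⬝ᵥ rightInv (design A F N) *ᵥ (F *ᵥ (Aᵀ *ᵥ x)) ≤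
      2 * (1 + a / g) * (x ⬝ᵥ x) := by
  rw [mulVec_transpose_mulVec_eq_design_sub (N := N), Matrix.mulVec_sub, Matrix.mulVec_mulVec]
  refine (sub_dotProduct_self_le _ _).trans ?_
  have hproj := rightInv_mul_mulVec_sq_le (hs.isUnit_det hg) x
  have hnoise : rightInv (design A F N) *ᵥ (N *ᵥ x) ⬝ᵥ rightInv (design A F N) *ᵥ (N *ᵥ x) ≤
      a / g * (x ⬝ᵥ x) :=
    calc _ ≤ g⁻¹ * (N *ᵥ x ⬝ᵥ N *ᵥ x) := rightInv_mulVec_sq_le hg hs.le_design _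
      _ ≤ g⁻¹ * (a * (x ⬝ᵥ x)) :=
          mul_le_mul_of_nonneg_left (mulVec_sq_le_of_transpose N ha hs.noise_le x)
            (inv_nonneg.2 hg.le)
      _ = _ := by ring
  linarith

theorem bias_factor_le (hs : IsGoodSample A SZ SE a g h t F N e) (ha : 0 ≤ a) (hg : 0 < g)
    (hh : 0 < h) (β : κ → ℝ) :
    (Aᵀ *ᵥ (rightInv (design A F N) *ᵥ (F *ᵥ β)) - β) ⬝ᵥ
        SZ *ᵥ (Aᵀ *ᵥ (rightInv (design A F N) *ᵥ (F *ᵥ β)) - β) ≤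
      a / h * (rightInv (design A F N) *ᵥ (F *ᵥ β) ⬝ᵥ rightInv (design A F N) *ᵥ (F *ᵥ β)) := by
  set α := rightInv (design A F N) *ᵥ (F *ᵥ β) with hα
  have hinterp : design A F N *ᵥ α = F *ᵥ β := by
    rw [hα, Matrix.mulVec_mulVec, mul_rightInv (hs.isUnit_det hg), Matrix.one_mulVec]
  have hfit : F *ᵥ (Aᵀ *ᵥ α - β) = -(N *ᵥ α) := by
    rw [Matrix.mulVec_sub, mulVec_transpose_mulVec_eq_design_sub (N := N), hinterp]
    abel
  have hle := hs.le_factor (Aᵀ *ᵥ α - β)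
  rw [hfit, neg_dotProduct_neg] at hle
  rw [div_mul_eq_mul_div, le_div_iff₀ hh, mul_comm]
  exact hle.trans (mulVec_sq_le_of_transpose N ha hs.noise_le α)

theorem quadForm_factor_rightInv_le (hs : IsGoodSample A SZ SE a g h t F N e) (ha : 0 ≤ a)
    (hg : 0 < g) (hh : 0 < h) (w : ν → ℝ) :
    (Aᵀ * rightInv (design A F N)) *ᵥ w ⬝ᵥ SZ *ᵥ ((Aᵀ * rightInv (design A F N)) *ᵥ w) ≤
      2 * (1 + a / g) / h * (w ⬝ᵥ w) := by
  rw [← Matrix.mulVec_mulVec, div_mul_eq_mul_div, le_div_iff₀ hh, mul_comm]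
  have hinterp : design A F N *ᵥ (rightInv (design A F N) *ᵥ w) = w := by
    rw [Matrix.mulVec_mulVec, mul_rightInv (hs.isUnit_det hg), Matrix.one_mulVec]
  have hle := hs.le_factor (Aᵀ *ᵥ (rightInv (design A F N) *ᵥ w))
  rw [mulVec_transpose_mulVec_eq_design_sub (N := N), hinterp] at hle
  have hsub := sub_dotProduct_self_le w (N *ᵥ (rightInv (design A F N) *ᵥ w))
  have hnoise := hs.noise_rightInv_le ha hg w
  linarith

theorem variance_noise_le_card (hs : IsGoodSample A SZ SE a g h t F N e) (hg : 0 < g) {m : ℝ}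
    (hm : ∀ x, x ⬝ᵥ SE *ᵥ x ≤ m * (x ⬝ᵥ x)) (hm_nonneg : 0 ≤ m) (ht : 0 ≤ t) :
    rightInv (design A F N) *ᵥ e ⬝ᵥ SE *ᵥ (rightInv (design A F N) *ᵥ e) ≤
      t * (Fintype.card ν * (m / g)) := by
  rw [← quadForm_transpose_mul_mul]
  refine hs.variance_noise_le.trans (mul_le_mul_of_nonneg_left (trace_le_card_mul fun w => ?_) ht)
  rw [quadForm_transpose_mul_mul]
  calc _ ≤ m * (rightInv (design A F N) *ᵥ w ⬝ᵥ rightInv (design A F N) *ᵥ w) := hm _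
    _ ≤ m * (g⁻¹ * (w ⬝ᵥ w)) :=
        mul_le_mul_of_nonneg_left (rightInv_mulVec_sq_le hg hs.le_design w) hm_nonneg
    _ = _ := by ring

theorem variance_factor_le_card (hs : IsGoodSample A SZ SE a g h t F N e) (hSZ : SZ.PosSemidef)
    (ha : 0 ≤ a) (hg : 0 < g) (hh : 0 < h) (ht : 0 ≤ t) :
    Aᵀ *ᵥ (rightInv (design A F N) *ᵥ e) ⬝ᵥ SZ *ᵥ (Aᵀ *ᵥ (rightInv (design A F N) *ᵥ e)) ≤
      t * (Fintype.card κ * (2 * (1 + a / g) / h)) := by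
  rw [Matrix.mulVec_mulVec e, ← quadForm_transpose_mul_mul]
  exact hs.variance_factor_le.trans (mul_le_mul_of_nonneg_left
    (trace_transpose_mul_mul_le_card_mul hSZ _ (by positivity)
      (hs.quadForm_factor_rightInv_le ha hg hh)) ht)

theorem excess_risk_le (hs : IsGoodSample A SZ SE a g h t F N e) (hSZ : SZ.PosSemidef)
    (hSE : SE.PosSemidef) (ha : 0 ≤ a) (hg : 0 < g) (hh : 0 < h) (ht : 0 ≤ t) {m : ℝ}
    (hm : ∀ x, x ⬝ᵥ SE *ᵥ x ≤ m * (x ⬝ᵥ x)) (hm_nonneg : 0 ≤ m) {β : κ → ℝ} {x α : π → ℝ}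
    (hx : Aᵀ *ᵥ x = β) (hα : α = rightInv (design A F N) *ᵥ (F *ᵥ β + e)) :
    (Aᵀ *ᵥ α - β) ⬝ᵥ SZ *ᵥ (Aᵀ *ᵥ α - β) + α ⬝ᵥ SE *ᵥ α ≤
      4 * (1 + a / g) * (a / h + m) * (x ⬝ᵥ x) + 2 * t * (Fintype.card ν * (m / g)) +
        4 * t * (Fintype.card κ * ((1 + a / g) / h)) := by
  set bias := rightInv (design A F N) *ᵥ (F *ᵥ β)
  set var := rightInv (design A F N) *ᵥ e
  have hsplit : α = bias + var := by rw [hα, Matrix.mulVec_add]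
  have hbias : bias ⬝ᵥ bias ≤ 2 * (1 + a / g) * (x ⬝ᵥ x) := by
    simpa only [hx] using hs.bias_sq_le ha hg x
  have hbias_noise : bias ⬝ᵥ SE *ᵥ bias ≤ m * (2 * (1 + a / g) * (x ⬝ᵥ x)) :=
    (hm bias).trans (mul_le_mul_of_nonneg_left hbias hm_nonneg)
  have hbias_factor : (Aᵀ *ᵥ bias - β) ⬝ᵥ SZ *ᵥ (Aᵀ *ᵥ bias - β) ≤
      a / h * (2 * (1 + a / g) * (x ⬝ᵥ x)) :=
    (hs.bias_factor_le ha hg hh β).trans (mul_le_mul_of_nonneg_left hbias (by positivity))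
  have hvar_noise := hs.variance_noise_le_card hg hm hm_nonneg ht
  have hvar_factor := hs.variance_factor_le_card hSZ ha hg hh ht
  calc (Aᵀ *ᵥ α - β) ⬝ᵥ SZ *ᵥ (Aᵀ *ᵥ α - β) + α ⬝ᵥ SE *ᵥ α
      = (Aᵀ *ᵥ bias - β + Aᵀ *ᵥ var) ⬝ᵥ SZ *ᵥ (Aᵀ *ᵥ bias - β + Aᵀ *ᵥ var) +
          (bias + var) ⬝ᵥ SE *ᵥ (bias + var) := by
        rw [hsplit, Matrix.mulVec_add, sub_add_eq_add_sub]
    _ ≤ 2 * (a / h * (2 * (1 + a / g) * (x ⬝ᵥ x))) +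
          2 * (t * (Fintype.card κ * (2 * (1 + a / g) / h))) +
          (2 * (m * (2 * (1 + a / g) * (x ⬝ᵥ x))) + 2 * (t * (Fintype.card ν * (m / g)))) := by
        refine add_le_add ((quadForm_add_le hSZ _ _).trans ?_)
          ((quadForm_add_le hSE _ _).trans ?_) <;> gcongr
    _ = _ := by ring

end IsGoodSample

end GoodSample

section Spectral

variable {p K : ℕ}

theorem isUnit_det_of_rank_eq {κ : Type*} [Fintype κ] [DecidableEq κ] {M : Matrix κ κ ℝ}
    (h : M.rank = Fintype.card κ) : IsUnit M.det := by
  rw [← Matrix.isUnit_iff_isUnit_det, ← Matrix.mulVec_surjective_iff_isUnit]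
  have hrange : LinearMap.range M.mulVecLin = ⊤ :=
    Submodule.eq_top_of_finrank_eq (by rw [← Matrix.rank, h, Module.finrank_fintype_fun_eq_card])
  exact LinearMap.range_eq_top.1 hrange

theorem mem_iff_lt_card_of_isLowerSet {N : ℕ} {S : Finset (Fin N)}
    (hS : IsLowerSet (S : Set (Fin N))) (j : Fin N) : j ∈ S ↔ (j : ℕ) < S.card := by
  constructor
  · intro hj
    have hle := Finset.card_le_card (show Finset.Iic j ⊆ S from fun i hi =>
      hS (Finset.mem_Iic.1 hi) hj)
    rw [Fin.card_Iic] at hle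
    omega
  · intro hj
    by_contra hmem
    have hle := Finset.card_le_card (show S ⊆ Finset.Iio j from fun i hi =>
      Finset.mem_Iio.2 (not_le.1 fun hle => hmem (hS hle hi)))
    rw [Fin.card_Iio] at hle
    omega

variable {H : Matrix (Fin p) (Fin p) ℝ}

theorem eigenvalues₀_ne_zero_iff_lt_rank (hH : H.PosSemidef) (j : Fin (Fintype.card (Fin p))) :
    hH.1.eigenvalues₀ j ≠ 0 ↔ (j : ℕ) < H.rank := by
  classical
  let e : Fin (Fintype.card (Fin p)) ≃ Fin p := Fintype.equivOfCardEq (Fintype.card_fin _)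
  have heigen : ∀ j, hH.1.eigenvalues (e j) = hH.1.eigenvalues₀ j := fun j =>
    congrArg hH.1.eigenvalues₀ (e.symm_apply_apply j)
  have hnonneg : ∀ j, 0 ≤ hH.1.eigenvalues₀ j := fun j => heigen j ▸ hH.eigenvalues_nonneg (e j)
  set S := Finset.univ.filter fun j => hH.1.eigenvalues₀ j ≠ 0
  have hlower : IsLowerSet (S : Set (Fin (Fintype.card (Fin p)))) := by
    intro a b hba ha
    simp only [S, Finset.coe_filter, Finset.mem_univ, true_and, Set.mem_ofPred_eq] at ha ⊢
    exact (((hnonneg a).lt_of_ne' ha).trans_le (hH.1.eigenvalues₀_antitone hba)).ne'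
  have hcard : S.card = H.rank := by
    rw [hH.1.rank_eq_card_non_zero_eigs, ← Fintype.card_subtype]
    exact Fintype.card_congr (e.subtypeEquiv fun j => by rw [heigen])
  rw [← hcard, ← mem_iff_lt_card_of_isLowerSet hlower]
  simp [S]

theorem exists_eigenvalueDesc_eq (hH : H.PosSemidef) (hK : 1 ≤ K) (hrank : H.rank = K) :
    ∃ j : Fin (Fintype.card (Fin p)), (j : ℕ) = K - 1 ∧
      eigenvalueDesc H K = hH.1.eigenvalues₀ j := by
  have hle : H.rank ≤ Fintype.card (Fin p) := by simpa using H.rank_le_card_width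
  have hlt : K - 1 < Fintype.card (Fin p) := by omega
  exact ⟨⟨K - 1, hlt⟩, rfl, by rw [eigenvalueDesc, dif_pos ⟨hH.1, hK, hlt⟩]⟩

theorem eigenvalueDesc_pos (hH : H.PosSemidef) (hK : 1 ≤ K) (hrank : H.rank = K) :
    0 < eigenvalueDesc H K := by
  obtain ⟨j, hj, hdesc⟩ := exists_eigenvalueDesc_eq hH hK hrank
  have hne := (eigenvalues₀_ne_zero_iff_lt_rank hH j).2 (by omega)
  have hnonneg : 0 ≤ hH.1.eigenvalues₀ j := by
    simpa [Matrix.IsHermitian.eigenvalues] using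
      hH.eigenvalues_nonneg (Fintype.equivOfCardEq (Fintype.card_fin _) j)
  exact hdesc ▸ hnonneg.lt_of_ne' hne

theorem eigenvalueDesc_le_eigenvalues (hH : H.PosSemidef) (hK : 1 ≤ K) (hrank : H.rank = K)
    {i : Fin p} (hi : hH.1.eigenvalues i ≠ 0) : eigenvalueDesc H K ≤ hH.1.eigenvalues i := by
  obtain ⟨j, hj, hdesc⟩ := exists_eigenvalueDesc_eq hH hK hrank
  rw [hdesc]
  have hlt := (eigenvalues₀_ne_zero_iff_lt_rank hH _).1 hi
  exact hH.1.eigenvalues₀_antitone (Fin.le_def.2 (by omega))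

theorem eigenvalueDesc_mul_sq_le (hH : H.PosSemidef) (hK : 1 ≤ K) (hrank : H.rank = K)
    (x : Fin p → ℝ) : eigenvalueDesc H K * (H *ᵥ x ⬝ᵥ H *ᵥ x) ≤ H *ᵥ x ⬝ᵥ H *ᵥ (H *ᵥ x) := by
  obtain ⟨B, hB, hdiag⟩ := exists_transpose_mul_self_eq hH
  set μ := hH.1.eigenvalues
  have hHx : H *ᵥ x = Bᵀ *ᵥ (B *ᵥ x) := by rw [Matrix.mulVec_mulVec, hB]
  have hBHx : B *ᵥ (H *ᵥ x) = Matrix.diagonal μ *ᵥ (B *ᵥ x) := by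
    rw [hHx, Matrix.mulVec_mulVec, hdiag]
  have hquad : H *ᵥ x ⬝ᵥ H *ᵥ (H *ᵥ x) = B *ᵥ (H *ᵥ x) ⬝ᵥ B *ᵥ (H *ᵥ x) := by
    rw [← dotProduct_transpose_mul_self_mulVec, hB]
  have hsq : H *ᵥ x ⬝ᵥ H *ᵥ x = B *ᵥ x ⬝ᵥ B *ᵥ (H *ᵥ x) := by
    conv_lhs => rw [hHx, dotProduct_comm, Matrix.dotProduct_transpose_mulVec]
    rw [← hHx]
  rw [hquad, hsq, hBHx]
  simp only [dotProduct, Matrix.mulVec_diagonal, Finset.mul_sum]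
  refine Finset.sum_le_sum fun i _ => ?_
  by_cases hi : μ i = 0
  · simp [hi]
  · calc _ = eigenvalueDesc H K * (μ i * (B *ᵥ x) i ^ 2) := by ring
      _ ≤ μ i * (μ i * (B *ᵥ x) i ^ 2) :=
          mul_le_mul_of_nonneg_right (eigenvalueDesc_le_eigenvalues hH hK hrank hi)
            (mul_nonneg (hH.eigenvalues_nonneg i) (sq_nonneg _))
      _ = _ := by ring

theorem isUnit_det_transpose_mul_self_of_rank_eq {A : Matrix (Fin p) (Fin K) ℝ} (hA : A.rank = K) :
    IsUnit (Aᵀ * Aᵀᵀ).det :=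
  isUnit_det_of_rank_eq (by rw [Matrix.transpose_transpose, Matrix.rank_transpose_mul_self, hA,
    Fintype.card_fin])

theorem rank_mul_mul_transpose {A : Matrix (Fin p) (Fin K) ℝ} {S : Matrix (Fin K) (Fin K) ℝ}
    (hA : A.rank = K) (hS : S.rank = K) : (A * S * Aᵀ).rank = K := by
  have hone := mul_rightInv (isUnit_det_transpose_mul_self_of_rank_eq hA)
  have hcompress : Aᵀ * (A * S * Aᵀ) * rightInv Aᵀ = (Aᵀ * Aᵀᵀ) * S := by
    simp only [Matrix.mul_assoc, hone, Matrix.mul_one, Matrix.transpose_transpose]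
  have hrank : (Aᵀ * (A * S * Aᵀ) * rightInv Aᵀ).rank = K := by
    rw [hcompress, Matrix.rank_mul_eq_right_of_isUnit_det _ _
      (isUnit_det_transpose_mul_self_of_rank_eq hA), hS]
  refine le_antisymm ?_ ?_
  · rw [Matrix.mul_assoc]
    exact (Matrix.rank_mul_le_left _ _).trans_eq hA
  · exact hrank.symm.le.trans ((Matrix.rank_mul_le_left _ _).trans (Matrix.rank_mul_le_right _ _))

theorem posSemidef_mul_mul_transpose {A : Matrix (Fin p) (Fin K) ℝ} {S : Matrix (Fin K) (Fin K) ℝ}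
    (hS : S.PosSemidef) : (A * S * Aᵀ).PosSemidef := by
  simpa using hS.mul_mul_conjTranspose_same A

theorem exists_transpose_mulVec_eq {A : Matrix (Fin p) (Fin K) ℝ} {S : Matrix (Fin K) (Fin K) ℝ}
    (hS : S.PosSemidef) (hK : 1 ≤ K) (hA : A.rank = K) (hrank : S.rank = K) (β : Fin K → ℝ) :
    ∃ x, Aᵀ *ᵥ x = β ∧ x ⬝ᵥ x ≤ (β ⬝ᵥ S *ᵥ β) / eigenvalueDesc (A * S * Aᵀ) K := by
  have hone := mul_rightInv (isUnit_det_transpose_mul_self_of_rank_eq hA)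
  have hS_unit : IsUnit S.det := isUnit_det_of_rank_eq (by rw [hrank, Fintype.card_fin])
  set x := rightInv Aᵀ *ᵥ β
  have hx : Aᵀ *ᵥ x = β := by rw [Matrix.mulVec_mulVec, hone, Matrix.one_mulVec]
  have hrange : x = (A * S * Aᵀ) *ᵥ
      ((rightInv Aᵀ * S⁻¹ * (Aᵀ * Aᵀᵀ)⁻¹) *ᵥ β) := by
    have hcancel : A * S * Aᵀ * (rightInv Aᵀ * S⁻¹ * (Aᵀ * Aᵀᵀ)⁻¹) = rightInv Aᵀ :=
      calc _ = A * (S * (Aᵀ * rightInv Aᵀ * S⁻¹)) * (Aᵀ * Aᵀᵀ)⁻¹ := by simp only [Matrix.mul_assoc]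
        _ = _ := by
          rw [hone, Matrix.one_mul, Matrix.mul_nonsing_inv _ hS_unit, Matrix.mul_one, rightInv,
            Matrix.transpose_transpose]
    rw [Matrix.mulVec_mulVec, hcancel]
  have hH := posSemidef_mul_mul_transpose (A := A) hS
  have hH_rank := rank_mul_mul_transpose hA hrank
  refine ⟨x, hx, ?_⟩
  rw [le_div_iff₀ (eigenvalueDesc_pos hH hK hH_rank), mul_comm]
  calc eigenvalueDesc (A * S * Aᵀ) K * (x ⬝ᵥ x) ≤ x ⬝ᵥ (A * S * Aᵀ) *ᵥ x := by
        rw [hrange]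
        exact eigenvalueDesc_mul_sq_le hH hK hH_rank _
    _ = β ⬝ᵥ S *ᵥ β := by
        simpa only [Matrix.transpose_transpose, hx] using quadForm_transpose_mul_mul S Aᵀ x

end Spectral

section OperatorNorm

variable {p : ℕ}

theorem quadForm_le_opNorm (Q : Matrix (Fin p) (Fin p) ℝ) (x : Fin p → ℝ) :
    x ⬝ᵥ Q *ᵥ x ≤ opNorm Q * (x ⬝ᵥ x) := by
  open scoped Matrix.Norms.L2Operator in
  have hnorm : ‖WithLp.toLp 2 (Q *ᵥ x)‖ ≤ opNorm Q * ‖WithLp.toLp 2 x‖ :=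
    Matrix.l2_opNorm_mulVec Q (WithLp.toLp 2 x)
  have hinner : x ⬝ᵥ Q *ᵥ x ≤ ‖WithLp.toLp 2 x‖ * ‖WithLp.toLp 2 (Q *ᵥ x)‖ := by
    have := real_inner_le_norm (WithLp.toLp 2 x) (WithLp.toLp 2 (Q *ᵥ x))
    rwa [EuclideanSpace.inner_eq_star_dotProduct, star_trivial, dotProduct_comm] at this
  rw [← norm_toLp_sq]
  nlinarith [mul_le_mul_of_nonneg_left hnorm (norm_nonneg (WithLp.toLp 2 x))]

theorem opNorm_pos {Q : Matrix (Fin p) (Fin p) ℝ} (hQ : Q ≠ 0) : 0 < opNorm Q := by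
  open scoped Matrix.Norms.L2Operator in
  exact norm_pos_iff.2 hQ

theorem isSymm_psdSqrt (Q : Matrix (Fin p) (Fin p) ℝ) : (psdSqrt Q).IsSymm := by
  open scoped MatrixOrder in
  have hherm := (Matrix.nonneg_iff_posSemidef.1 (CFC.sqrt_nonneg Q)).isHermitian
  rwa [Matrix.IsHermitian, Matrix.conjTranspose_eq_transpose_of_trivial] at hherm

theorem psdSqrt_mul_self {Q : Matrix (Fin p) (Fin p) ℝ} (hQ : Q.PosSemidef) :
    psdSqrt Q * psdSqrt Q = Q := by
  open scoped MatrixOrder in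
  exact CFC.sqrt_mul_sqrt_self Q (Matrix.nonneg_iff_posSemidef.2 hQ)

end OperatorNorm

section ComplementaryProjection

variable {ι κ ρ : Type*} [Fintype ι] [Fintype κ] [Fintype ρ] [DecidableEq ι] [DecidableEq κ]

theorem trace_sub_le_trace_proj_mul {D : Matrix ι ι ℝ} (hs : D.IsSymm) (hi : IsIdempotentElem D)
    (B : Matrix ι ρ ℝ) {m : ℝ} (hm : ∀ x, x ⬝ᵥ (B * Bᵀ) *ᵥ x ≤ m * (x ⬝ᵥ x)) :
    (B * Bᵀ).trace - m * (1 - D).trace ≤ ((D * B)ᵀ * (D * B)).trace := by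
  have hcs : (1 - D)ᵀ = 1 - D := by rw [Matrix.transpose_sub, Matrix.transpose_one, hs]
  have hcompl : ((1 - D)ᵀ * (B * Bᵀ) * (1 - D)).trace = ((1 - D) * (B * Bᵀ)).trace := by
    rw [hcs, Matrix.trace_mul_comm, ← Matrix.mul_assoc, hi.one_sub]
  have hproj : ((D * B)ᵀ * (D * B)).trace = (D * (B * Bᵀ)).trace := by
    rw [Matrix.transpose_mul, hs, Matrix.mul_assoc, ← Matrix.mul_assoc D D, hi,
      Matrix.trace_mul_comm, Matrix.mul_assoc]
  have hle : ((1 - D)ᵀ * (B * Bᵀ) * (1 - D)).trace ≤ (m • ((1 - D)ᵀ * (1 - D))).trace :=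
    trace_le_trace_of_quadForm_le fun x => by
      rw [quadForm_transpose_mul_mul, Matrix.smul_mulVec, dotProduct_smul,
        dotProduct_transpose_mul_self_mulVec]
      exact hm _
  rw [hcompl, hcs, hi.one_sub, Matrix.trace_smul, smul_eq_mul, Matrix.sub_mul, Matrix.one_mul,
    Matrix.trace_sub] at hle
  rw [hproj]
  linarith

/-- The orthogonal projection onto the orthogonal complement of the range of a matrix `A` of full
column rank; it removes the factors from the design matrix. -/
noncomputable def complProj (A : Matrix ι κ ℝ) : Matrix ι ι ℝ := 1 - rightInv Aᵀ * Aᵀ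

theorem isSymm_complProj (A : Matrix ι κ ℝ) : (complProj A).IsSymm := by
  rw [Matrix.IsSymm, complProj, Matrix.transpose_sub, Matrix.transpose_one, isSymm_rightInv_mul]

variable {A : Matrix ι κ ℝ}

theorem isIdempotentElem_complProj (hA : IsUnit (Aᵀ * Aᵀᵀ).det) :
    IsIdempotentElem (complProj A) :=
  (isIdempotentElem_rightInv_mul hA).one_sub

theorem complProj_mul_self (hA : IsUnit (Aᵀ * Aᵀᵀ).det) : complProj A * A = 0 := by
  have htranspose : Aᵀ * complProj A = 0 := by
    rw [complProj, Matrix.mul_sub, ← Matrix.mul_assoc, mul_rightInv hA, Matrix.one_mul,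
      Matrix.mul_one, sub_self]
  rw [← Matrix.transpose_transpose (complProj A * A), Matrix.transpose_mul, isSymm_complProj,
    htranspose, Matrix.transpose_zero]

theorem trace_one_sub_complProj (hA : IsUnit (Aᵀ * Aᵀᵀ).det) :
    (1 - complProj A).trace = Fintype.card κ := by
  rw [complProj, sub_sub_cancel, Matrix.trace_mul_comm, mul_rightInv hA, Matrix.trace_one]

end ComplementaryProjection

section LeastSquares

variable {ι κ : Type*} [Fintype ι] [Fintype κ]

theorem exists_forall_sub_mulVec_sq_le (M : Matrix ι κ ℝ) (b : ι → ℝ) :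
    ∃ x, ∀ y, (b - M *ᵥ x) ⬝ᵥ (b - M *ᵥ x) ≤ (b - M *ᵥ y) ⬝ᵥ (b - M *ᵥ y) := by
  let T : (κ → ℝ) →ₗ[ℝ] EuclideanSpace ℝ ι :=
    (WithLp.linearEquiv 2 ℝ (ι → ℝ)).symm.toLinearMap ∘ₗ M.mulVecLin
  have hdist : ∀ x, (b - M *ᵥ x) ⬝ᵥ (b - M *ᵥ x) = dist (WithLp.toLp 2 b) (T x) ^ 2 := fun x => by
    rw [dist_eq_norm, ← norm_toLp_sq]
    rfl
  have hclosed : IsClosed (LinearMap.range T : Set (EuclideanSpace ℝ ι)) :=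
    Submodule.closed_of_finiteDimensional _
  obtain ⟨-, ⟨x, rfl⟩, hx⟩ :=
    hclosed.exists_infDist_eq_dist ⟨0, Submodule.zero_mem _⟩ (WithLp.toLp 2 b)
  refine ⟨x, fun y => ?_⟩
  rw [hdist, hdist, ← hx]
  exact pow_le_pow_left₀ Metric.infDist_nonneg (Metric.infDist_le_dist_of_mem
    (LinearMap.mem_range_self T y)) 2

end LeastSquares

section Covariance

variable {Ω₀ : Type*} [MeasurableSpace Ω₀] {P₀ : Measure Ω₀} {d : ℕ} {V : Ω₀ → Fin d → ℝ}

theorem memLp_dotProduct (hV : ∀ k, MemLp (fun ω => V ω k) 2 P₀) (γ : Fin d → ℝ) :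
    MemLp (fun ω => V ω ⬝ᵥ γ) 2 P₀ := by
  simp only [dotProduct]
  exact memLp_finsetSum _ fun k _ => (hV k).mul_const _

theorem integral_sub_sq_of_indepFun {X Y : Ω₀ → ℝ} (hX : MemLp X 2 P₀) (hY : MemLp Y 2 P₀)
    (hXY : IndepFun X Y P₀) (hmean : ∫ ω, X ω ∂P₀ = 0) :
    ∫ ω, (X ω - Y ω) ^ 2 ∂P₀ = ∫ ω, X ω ^ 2 ∂P₀ + ∫ ω, Y ω ^ 2 ∂P₀ := by
  have hcross : ∫ ω, 2 * (X ω * Y ω) ∂P₀ = 0 := by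
    rw [integral_const_mul, hXY.integral_fun_mul_eq_mul_integral hX.aestronglyMeasurable
      hY.aestronglyMeasurable, hmean, zero_mul, mul_zero]
  have hsum : Integrable (fun ω => X ω ^ 2 + Y ω ^ 2) P₀ := hX.integrable_sq.add hY.integrable_sq
  have hprod : Integrable (fun ω => 2 * (X ω * Y ω)) P₀ := (hX.integrable_mul hY).const_mul 2
  calc ∫ ω, (X ω - Y ω) ^ 2 ∂P₀ = ∫ ω, (X ω ^ 2 + Y ω ^ 2 - 2 * (X ω * Y ω)) ∂P₀ := by
        congr with ω
        ring
    _ = _ := by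
        rw [integral_sub hsum hprod, hcross, sub_zero,
          integral_add hX.integrable_sq hY.integrable_sq]

variable [IsFiniteMeasure P₀]

theorem dotProduct_covMat_mulVec (hV : ∀ k, MemLp (fun ω => V ω k) 2 P₀) (γ : Fin d → ℝ) :
    γ ⬝ᵥ covMat V P₀ *ᵥ γ = Var[fun ω => V ω ⬝ᵥ γ; P₀] := by
  simp only [dotProduct]
  rw [variance_fun_sum' (s := Finset.univ) fun k _ => (hV k).mul_const (γ k)]
  simp only [Matrix.mulVec, dotProduct, covMat, Matrix.of_apply, Finset.mul_sum,
    covariance_mul_const_left, covariance_mul_const_right]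
  exact Finset.sum_congr rfl fun i _ => Finset.sum_congr rfl fun j _ => by ring

theorem posSemidef_covMat (hV : ∀ k, MemLp (fun ω => V ω k) 2 P₀) : (covMat V P₀).PosSemidef := by
  rw [Matrix.posSemidef_iff_dotProduct_mulVec]
  refine ⟨?_, fun x => ?_⟩
  · ext i j
    simp [covMat, covariance_comm]
  · rw [star_trivial, dotProduct_covMat_mulVec hV]
    exact variance_nonneg _ _

theorem integral_dotProduct_eq_zero (hV : ∀ k, MemLp (fun ω => V ω k) 2 P₀)
    (hmean : ∀ k, ∫ ω, V ω k ∂P₀ = 0) (γ : Fin d → ℝ) : ∫ ω, V ω ⬝ᵥ γ ∂P₀ = 0 := by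
  simp only [dotProduct]
  rw [integral_finsetSum _ fun k _ => ((hV k).integrable one_le_two).mul_const _]
  exact Finset.sum_eq_zero fun k _ => by rw [integral_mul_const, hmean, zero_mul]

theorem integral_dotProduct_sq (hV : ∀ k, MemLp (fun ω => V ω k) 2 P₀)
    (hmean : ∀ k, ∫ ω, V ω k ∂P₀ = 0) (γ : Fin d → ℝ) :
    ∫ ω, (V ω ⬝ᵥ γ) ^ 2 ∂P₀ = γ ⬝ᵥ covMat V P₀ *ᵥ γ := by
  rw [dotProduct_covMat_mulVec hV, variance_of_integral_eq_zero
    (memLp_dotProduct hV γ).aestronglyMeasurable.aemeasurable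
    (integral_dotProduct_eq_zero hV hmean γ)]

end Covariance

section Risk

variable {Ω₀ : Type*} [MeasurableSpace Ω₀] {P₀ : Measure Ω₀} [IsFiniteMeasure P₀] {K p : ℕ}
  {A : Matrix (Fin p) (Fin K) ℝ} {β : Fin K → ℝ} {Z : Ω₀ → Fin K → ℝ} {E : Ω₀ → Fin p → ℝ}
  {ε : Ω₀ → ℝ}

theorem feature_dotProduct_sub_response (z : Fin K → ℝ) (e : Fin p → ℝ) (u : ℝ) (α : Fin p → ℝ) :
    feature A z e ⬝ᵥ α - response β z u = z ⬝ᵥ (Aᵀ *ᵥ α - β) - (u - e ⬝ᵥ α) := by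
  rw [feature, response, add_dotProduct, dotProduct_sub, Matrix.dotProduct_mulVec z,
    Matrix.vecMul_transpose]
  ring

theorem risk_eq (h : IsLatentModel P₀ Z E ε) (α : Fin p → ℝ) :
    risk P₀ A β Z E ε α =
      (Aᵀ *ᵥ α - β) ⬝ᵥ covMat Z P₀ *ᵥ (Aᵀ *ᵥ α - β) + α ⬝ᵥ covMat E P₀ *ᵥ α + Var[ε; P₀] := by
  have hZ := memLp_dotProduct h.memLp_Z (Aᵀ *ᵥ α - β)
  have hE := memLp_dotProduct h.memLp_E α
  have hindep_Z : IndepFun (fun ω => Z ω ⬝ᵥ (Aᵀ *ᵥ α - β)) (fun ω => ε ω - E ω ⬝ᵥ α) P₀ :=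
    h.indep_Z.comp (φ := fun z => z ⬝ᵥ (Aᵀ *ᵥ α - β))
      (ψ := fun q : (Fin p → ℝ) × ℝ => q.2 - q.1 ⬝ᵥ α)
      (by simp only [dotProduct]; fun_prop) (by simp only [dotProduct]; fun_prop)
  have hεE : MemLp (fun ω => ε ω - E ω ⬝ᵥ α) 2 P₀ := h.memLp_ε.sub hE
  have hindep_E : IndepFun ε (fun ω => E ω ⬝ᵥ α) P₀ :=
    h.indep_E_ε.symm.comp (φ := id) (ψ := fun e => e ⬝ᵥ α) measurable_id
      (by simp only [dotProduct]; fun_prop)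
  simp only [risk, feature_dotProduct_sub_response]
  rw [integral_sub_sq_of_indepFun hZ hεE hindep_Z
      (integral_dotProduct_eq_zero h.memLp_Z h.mean_Z _),
    integral_sub_sq_of_indepFun h.memLp_ε hE hindep_E h.mean_ε,
    integral_dotProduct_sq h.memLp_Z h.mean_Z, integral_dotProduct_sq h.memLp_E h.mean_E,
    variance_of_integral_eq_zero h.measurable_ε.aemeasurable h.mean_ε]
  ring

theorem variance_le_risk (h : IsLatentModel P₀ Z E ε) (α : Fin p → ℝ) :
    Var[ε; P₀] ≤ risk P₀ A β Z E ε α := by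
  rw [risk_eq h]
  have hZ := quadForm_nonneg (posSemidef_covMat h.memLp_Z) (Aᵀ *ᵥ α - β)
  have hE := quadForm_nonneg (posSemidef_covMat h.memLp_E) α
  linarith

theorem exists_isMinOn_risk (h : IsLatentModel P₀ Z E ε) :
    ∃ α : Fin p → ℝ, IsMinOn (risk P₀ A β Z E ε) Set.univ α := by
  obtain ⟨BZ, hBZ, -⟩ := exists_transpose_mul_self_eq (posSemidef_covMat h.memLp_Z)
  obtain ⟨BE, hBE, -⟩ := exists_transpose_mul_self_eq (posSemidef_covMat h.memLp_E)
  let M := Matrix.fromRows (BZ * Aᵀ) BE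
  let b : Fin K ⊕ Fin p → ℝ := Sum.elim (BZ *ᵥ β) 0
  have hrisk : ∀ α, risk P₀ A β Z E ε α = (b - M *ᵥ α) ⬝ᵥ (b - M *ᵥ α) + Var[ε; P₀] := fun α => by
    have hresidual : b - M *ᵥ α = -Sum.elim (BZ *ᵥ (Aᵀ *ᵥ α - β)) (BE *ᵥ α) := by
      ext (i | i) <;> simp [b, M, Matrix.fromRows_mulVec, Matrix.mulVec_sub]
    rw [risk_eq h, hresidual, neg_dotProduct_neg, sumElim_dotProduct_sumElim, ← hBZ, ← hBE,
      dotProduct_transpose_mul_self_mulVec, dotProduct_transpose_mul_self_mulVec]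
  obtain ⟨α, hα⟩ := exists_forall_sub_mulVec_sq_le M b
  refine ⟨α, fun α' _ => ?_⟩
  rw [Set.mem_ofPred_eq, hrisk, hrisk]
  exact add_le_add_left (hα α') _

end Risk

section Independence

variable {Ω α β γ ι : Type*} [MeasurableSpace Ω] [MeasurableSpace α] [MeasurableSpace β]
  [MeasurableSpace γ] {P : Measure Ω} [IsProbabilityMeasure P] {X : Ω → α} {Y : Ω → β} {W : Ω → γ}

theorem indepFun_prodMk_left (hX : Measurable X) (hY : Measurable Y) (hW : Measurable W)
    (h : IndepFun X (fun ω => (Y ω, W ω)) P) (h' : IndepFun Y W P) :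
    IndepFun (fun ω => (X ω, Y ω)) W P := by
  have : IsProbabilityMeasure (P.map X) := Measure.isProbabilityMeasure_map hX.aemeasurable
  have : IsProbabilityMeasure (P.map Y) := Measure.isProbabilityMeasure_map hY.aemeasurable
  have : IsProbabilityMeasure (P.map W) := Measure.isProbabilityMeasure_map hW.aemeasurable
  have hXY : IndepFun X Y P := h.comp measurable_id measurable_fst
  rw [indepFun_iff_map_prod_eq_prod_map_map hX.aemeasurable (hY.prodMk hW).aemeasurable,
    (indepFun_iff_map_prod_eq_prod_map_map hY.aemeasurable hW.aemeasurable).1 h'] at h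
  rw [indepFun_iff_map_prod_eq_prod_map_map (hX.prodMk hY).aemeasurable hW.aemeasurable,
    (indepFun_iff_map_prod_eq_prod_map_map hX.aemeasurable hY.aemeasurable).1 hXY]
  apply MeasurableEquiv.prodAssoc.map_measurableEquiv_injective
  rw [Measure.map_map (by fun_prop) (by fun_prop), Measure.prodAssoc_prod, ← h]
  rfl

theorem indepFun_pi [Fintype ι] (hX : Measurable X) (hY : Measurable Y) (h : IndepFun X Y P) :
    IndepFun (fun (ω : ι → Ω) i => X (ω i)) (fun ω i => Y (ω i)) (Measure.pi fun _ => P) := by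
  have : IsProbabilityMeasure (P.map X) := Measure.isProbabilityMeasure_map hX.aemeasurable
  have : IsProbabilityMeasure (P.map Y) := Measure.isProbabilityMeasure_map hY.aemeasurable
  have hXY : P.map (fun ω => (X ω, Y ω)) = (P.map X).prod (P.map Y) :=
    (indepFun_iff_map_prod_eq_prod_map_map hX.aemeasurable hY.aemeasurable).1 h
  have hpi := Measure.pi_map_pi (μ := fun _ : ι => P) (f := fun _ ω => (X ω, Y ω))
    fun _ => (hX.prodMk hY).aemeasurable
  have harrow := (measurePreserving_arrowProdEquivProdArrow α β ι
    (fun _ => P.map X) (fun _ => P.map Y)).map_eq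
  have : IsProbabilityMeasure (P.map fun ω => (X ω, Y ω)) :=
    Measure.isProbabilityMeasure_map (hX.prodMk hY).aemeasurable
  have hX_pi : Measurable fun (ω : ι → Ω) i => X (ω i) := by fun_prop
  have hY_pi : Measurable fun (ω : ι → Ω) i => Y (ω i) := by fun_prop
  rw [indepFun_iff_map_prod_eq_prod_map_map hX_pi.aemeasurable hY_pi.aemeasurable,
    Measure.pi_map_pi fun _ => hX.aemeasurable, Measure.pi_map_pi fun _ => hY.aemeasurable,
    ← harrow]
  simp only [← hXY]
  rw [← hpi, Measure.map_map (by fun_prop) (by fun_prop)]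
  rfl

variable {ν : Type*} [Fintype ν]

theorem measure_trace_mul_lt_quadForm_le_of_indepFun {ξ : Ω → ν → ℝ} {c : ℝ≥0} (hc : 0 < c)
    (hX : Measurable X) (hξ : Measurable ξ) (hindep : IndepFun X ξ P) (h : IsSubgaussianVec ξ c P)
    {M : α → Matrix ν ν ℝ} (hM : ∀ i j, Measurable fun u => M u i j) (hpsd : ∀ u, (M u).PosSemidef)
    (s : ℝ) :
    P {ω | 4 * c * s * (M (X ω)).trace < ξ ω ⬝ᵥ M (X ω) *ᵥ ξ ω} ≤
      ENNReal.ofReal (Real.exp (1 / 2 - s)) := by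
  have : IsProbabilityMeasure (P.map X) := Measure.isProbabilityMeasure_map hX.aemeasurable
  have : IsProbabilityMeasure (P.map ξ) := Measure.isProbabilityMeasure_map hξ.aemeasurable
  have : ∀ i j, Measurable fun q : α × (ν → ℝ) => M q.1 i j := fun i j =>
    (hM i j).comp measurable_fst
  have hmeas : MeasurableSet {q : α × (ν → ℝ) | 4 * c * s * (M q.1).trace < q.2 ⬝ᵥ M q.1 *ᵥ q.2} :=
    measurableSet_lt (by simp only [Matrix.trace, Matrix.diag_apply]; fun_prop)
      (by simp only [dotProduct, Matrix.mulVec]; fun_prop)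
  have hlaw : IdentDistrib ξ id P (P.map ξ) :=
    ⟨hξ.aemeasurable, aemeasurable_id, Measure.map_id.symm⟩
  have h' : IsSubgaussianVec id c (P.map ξ) := fun u =>
    (h u).congr_identDistrib
      (hlaw.comp (u := fun x => u ⬝ᵥ x) (by simp only [dotProduct]; fun_prop))
  calc _ = P.map (fun ω => (X ω, ξ ω)) {q | 4 * c * s * (M q.1).trace < q.2 ⬝ᵥ M q.1 *ᵥ q.2} :=
        (Measure.map_apply (hX.prodMk hξ) hmeas).symm
    _ = ∫⁻ u, P.map ξ {x | 4 * c * s * (M u).trace < x ⬝ᵥ M u *ᵥ x} ∂(P.map X) := by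
        rw [(indepFun_iff_map_prod_eq_prod_map_map hX.aemeasurable hξ.aemeasurable).1 hindep,
          Measure.prod_apply hmeas]
        rfl
    _ ≤ ∫⁻ _, ENNReal.ofReal (Real.exp (1 / 2 - s)) ∂(P.map X) :=
        lintegral_mono fun u => measure_trace_mul_lt_quadForm_le hc measurable_id h' (hpsd u) s
    _ = _ := by simp

end Independence

section Measurability

variable {ι κ ρ U : Type*} [MeasurableSpace U]

theorem measurable_mul_apply [Fintype κ] {M : U → Matrix ι κ ℝ} {N : U → Matrix κ ρ ℝ}
    (hM : ∀ i j, Measurable fun u => M u i j) (hN : ∀ i j, Measurable fun u => N u i j)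
    (i : ι) (j : ρ) : Measurable fun u => (M u * N u) i j := by
  simp only [Matrix.mul_apply]
  fun_prop

variable [Fintype ι] [DecidableEq ι]

theorem measurable_inv_apply {M : U → Matrix ι ι ℝ} (hM : ∀ i j, Measurable fun u => M u i j)
    (i j : ι) : Measurable fun u => (M u)⁻¹ i j := by
  have hmeas : Measurable fun u i j => M u i j :=
    measurable_pi_lambda _ fun i => measurable_pi_lambda _ (hM i)
  have hdet : Continuous fun N : ι → ι → ℝ => (Matrix.of N).det := continuous_id.matrix_det
  have hadj : Continuous fun N : ι → ι → ℝ => (Matrix.of N).adjugate i j :=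
    continuous_id.matrix_adjugate.matrix_elem i j
  simp only [Matrix.inv_def, Ring.inverse_eq_inv', Matrix.smul_apply, smul_eq_mul]
  exact (hdet.measurable.comp hmeas).inv.mul (hadj.measurable.comp hmeas)

theorem measurable_rightInv_apply [Fintype κ] {X : U → Matrix ι κ ℝ}
    (hX : ∀ i j, Measurable fun u => X u i j) (j : κ) (i : ι) :
    Measurable fun u => rightInv (X u) j i := by
  have hXt : ∀ j i, Measurable fun u => (X u)ᵀ j i := fun j i => hX i j
  exact measurable_mul_apply hXt (measurable_inv_apply (measurable_mul_apply hX hXt)) j i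

end Measurability

section SampleLaw

variable {Ω₀ Ω : Type*} [MeasurableSpace Ω₀] [MeasurableSpace Ω] {P₀ : Measure Ω₀}
  [IsProbabilityMeasure P₀] {P : Measure Ω} {n K p : ℕ}
  {Z : Ω₀ → Fin K → ℝ} {E : Ω₀ → Fin p → ℝ} {ε : Ω₀ → ℝ}
  {Zs : Fin n → Ω → Fin K → ℝ} {Es : Fin n → Ω → Fin p → ℝ} {εs : Fin n → Ω → ℝ}

theorem ae_pi_forall {ι : Type*} [Fintype ι] {Q : Ω₀ → Prop} (h : ∀ᵐ x ∂P₀, Q x) :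
    ∀ᵐ ω ∂(Measure.pi fun _ : ι => P₀), ∀ i, Q (ω i) :=
  ae_all_iff.2 fun i =>
    (measurePreserving_eval (fun _ : ι => P₀) i).quasiMeasurePreserving.ae h

theorem identDistrib_pi_eval {ι β : Type*} [Fintype ι] [MeasurableSpace β] {V : Ω₀ → β}
    (hV : AEMeasurable V P₀) (i : ι) :
    IdentDistrib V (fun ω : ι → Ω₀ => V (ω i)) P₀ (Measure.pi fun _ => P₀) :=
  have heval := measurePreserving_eval (fun _ : ι => P₀) i
  IdentDistrib.comp_of_aemeasurable (f := id) (g := fun ω : ι → Ω₀ => ω i)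
    ⟨aemeasurable_id, heval.aemeasurable, Measure.map_id.trans heval.map_eq.symm⟩
    (by rwa [Measure.map_id])

theorem IsSample.identDistrib_pi (hs : IsSample P Zs Es εs P₀ Z E ε) :
    IdentDistrib (fun ω i => (Zs i ω, Es i ω, εs i ω))
      (fun (ω : Fin n → Ω₀) i => (Z (ω i), E (ω i), ε (ω i))) P (Measure.pi fun _ => P₀) :=
  IdentDistrib.pi
    (fun i => (hs.ident i).trans (identDistrib_pi_eval (hs.ident i).aemeasurable_snd i)) hs.indep
    (iIndepFun_pi fun i => (hs.ident i).aemeasurable_snd)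

theorem measurableSet_forall_le {V U : Type*} [TopologicalSpace U] [MeasurableSpace U]
    [OpensMeasurableSpace U] {f g : V → U → ℝ} (hf : ∀ v, Continuous (f v))
    (hg : ∀ v, Continuous (g v)) : MeasurableSet {u | ∀ v, f v u ≤ g v u} := by
  rw [Set.ofPred_forall]
  exact (isClosed_iInter fun v => isClosed_le (hf v) (hg v)).measurableSet

theorem measurableSet_quadForm_le_mul_trace {U ν : Type*} [MeasurableSpace U] [Fintype ν]
    {e : U → ν → ℝ} (he : Measurable e) {M : U → Matrix ν ν ℝ}
    (hM : ∀ i j, Measurable fun u => M u i j) (t : ℝ) :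
    MeasurableSet {u | e u ⬝ᵥ M u *ᵥ e u ≤ t * (M u).trace} :=
  measurableSet_le (by simp only [dotProduct, Matrix.mulVec]; fun_prop)
    (by simp only [Matrix.trace, Matrix.diag_apply]; fun_prop)

theorem continuous_design (A : Matrix (Fin p) (Fin K) ℝ) :
    Continuous fun s : Fin n → (Fin K → ℝ) × (Fin p → ℝ) × ℝ =>
      design A (Matrix.of fun i => (s i).1) (Matrix.of fun i => (s i).2.1) := by
  refine continuous_matrix fun i j => ?_
  simp only [design, Matrix.add_apply, Matrix.mul_apply, Matrix.of_apply]
  fun_prop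

theorem measurable_transpose_mul_mul_apply {U ι κ : Type*} [MeasurableSpace U] [Fintype ι]
    {R : U → Matrix ι κ ℝ} (hR : ∀ i j, Measurable fun u => R u i j) (S : Matrix ι ι ℝ) (i j : κ) :
    Measurable fun u => ((R u)ᵀ * S * R u) i j := by
  have hRt : ∀ i j, Measurable fun u => (R u)ᵀ i j := fun i j => hR j i
  have hRS : ∀ i j, Measurable fun u => ((R u)ᵀ * S) i j :=
    measurable_mul_apply hRt fun _ _ => measurable_const
  exact measurable_mul_apply hRS hR i j

theorem measurableSet_isGoodSample {A : Matrix (Fin p) (Fin K) ℝ} {SZ : Matrix (Fin K) (Fin K) ℝ}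
    {SE : Matrix (Fin p) (Fin p) ℝ} {a g h t : ℝ} :
    MeasurableSet {s : Fin n → (Fin K → ℝ) × (Fin p → ℝ) × ℝ |
      IsGoodSample A SZ SE a g h t (Matrix.of fun i => (s i).1) (Matrix.of fun i => (s i).2.1)
        fun i => (s i).2.2} := by
  have hF : Continuous fun s : Fin n → (Fin K → ℝ) × (Fin p → ℝ) × ℝ =>
      Matrix.of fun i => (s i).1 := continuous_matrix fun i j => by
    simp only [Matrix.of_apply]; fun_prop
  have hN : Continuous fun s : Fin n → (Fin K → ℝ) × (Fin p → ℝ) × ℝ =>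
      (Matrix.of fun i => (s i).2.1)ᵀ := continuous_matrix fun i j => by
    simp only [Matrix.transpose_apply, Matrix.of_apply]; fun_prop
  have hX := continuous_design (n := n) A
  have he : Measurable fun (s : Fin n → (Fin K → ℝ) × (Fin p → ℝ) × ℝ) i => (s i).2.2 := by
    fun_prop
  have hR := measurable_rightInv_apply fun i j => (hX.matrix_elem i j).measurable
  have hAR := measurable_mul_apply (fun i j => measurable_const (a := Aᵀ i j)) hR
  have hNv := fun v => hN.matrix_mulVec (continuous_const (y := v))
  have hXv := fun v => hX.matrix_transpose.matrix_mulVec (continuous_const (y := v))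
  have hFv := fun v => hF.matrix_mulVec (continuous_const (y := v))
  refine ((measurableSet_forall_le (fun v => (hNv v).dotProduct (hNv v))
      fun v => continuous_const (y := a * (v ⬝ᵥ v))).inter <|
    (measurableSet_forall_le (fun v => continuous_const (y := g * (v ⬝ᵥ v)))
      fun v => (hXv v).dotProduct (hXv v)).inter <|
    (measurableSet_forall_le (fun γ => continuous_const (y := h * (γ ⬝ᵥ SZ *ᵥ γ)))
      fun γ => (hFv γ).dotProduct (hFv γ)).inter <|
    (measurableSet_quadForm_le_mul_trace he (measurable_transpose_mul_mul_apply hR SE) t).inter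
      (measurableSet_quadForm_le_mul_trace he (measurable_transpose_mul_mul_apply hAR SZ) t)).congr
    (Set.ext fun s => ⟨?_, ?_⟩)
  · rintro ⟨hnoise, hdesign, hfactor, hvar_noise, hvar_factor⟩
    exact ⟨hnoise, hdesign, hfactor, hvar_noise, hvar_factor⟩
  · rintro ⟨hnoise, hdesign, hfactor, hvar_noise, hvar_factor⟩
    exact ⟨hnoise, hdesign, hfactor, hvar_noise, hvar_factor⟩

end SampleLaw

section NoiseEvents

variable {Ω₀ : Type*} [MeasurableSpace Ω₀] {P₀ : Measure Ω₀} [IsProbabilityMeasure P₀]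
  {n K p : ℕ} {E : Ω₀ → Fin p → ℝ} {L : ℝ≥0}

theorem measure_not_mul_noise_bounds_le (hE : IsSubGaussianNoise L P₀ E) {ρ : Type*} [Fintype ρ]
    {D : Matrix ρ (Fin p) ℝ} {B : Matrix ρ (Fin p) ℝ} (hB : D * psdSqrt (covMat E P₀) = B) {m : ℝ}
    (hm_pos : 0 < m) (hm : ∀ x, x ⬝ᵥ (Bᵀ * B) *ᵥ x ≤ m * (x ⬝ᵥ x))
    (hrank : rankConst (proxy L) * n * m ≤ (Bᵀ * B).trace) :
    (Measure.pi fun _ : Fin n => P₀) {ω | ¬ ∀ v : Fin n → ℝ,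
        (Bᵀ * B).trace / 8 * (v ⬝ᵥ v) ≤ (D * (Matrix.of fun i => E (ω i))ᵀ) *ᵥ v ⬝ᵥ
          (D * (Matrix.of fun i => E (ω i))ᵀ) *ᵥ v ∧
        (D * (Matrix.of fun i => E (ω i))ᵀ) *ᵥ v ⬝ᵥ (D * (Matrix.of fun i => E (ω i))ᵀ) *ᵥ v ≤
          16 * proxy L * (Bᵀ * B).trace * (v ⬝ᵥ v)} ≤
      ENNReal.ofReal (2 * Real.exp (-n)) := by
  obtain ⟨E', hE'_meas, hE', hindep, hmean, hvar, hpsi⟩ := hE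
  have hentry : ∀ j, Measurable fun ω => E' ω j := fun j => (measurable_pi_apply j).comp hE'_meas
  have hentries : HasIndepSubgaussianEntries E' (proxy L) P₀ :=
    { measurable := hE'_meas
      indep := hindep
      subgaussian := fun j => hasSubgaussianMGF_of_psi2Norm_le (hentry j) (hmean j) (hpsi j)
      second_moment := fun j => by
        rw [← hvar j, variance_of_integral_eq_zero (hentry j).aemeasurable (hmean j)] }
  have hbounds := measure_not_noise_bounds_le (κ := Fin n) hentries hmean (one_le_proxy L) hm hm_pos
    (by rwa [Fintype.card_fin])
  rw [Fintype.card_fin] at hbounds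
  refine (measure_mono_ae ?_).trans hbounds
  filter_upwards [ae_pi_forall hE'] with ω hω
  have hfactor : D * (Matrix.of fun i => E (ω i))ᵀ = B * (Matrix.of fun i => E' (ω i))ᵀ := by
    rw [← hB, Matrix.mul_assoc]
    congr 1
    ext j i
    exact congrFun (hω i) j
  exact mt fun hgood => by rwa [hfactor]

theorem transpose_mul_self_psdSqrt {Q : Matrix (Fin p) (Fin p) ℝ} (hQ : Q.PosSemidef) :
    (psdSqrt Q)ᵀ * psdSqrt Q = Q := by
  rw [isSymm_psdSqrt, psdSqrt_mul_self hQ]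

theorem dotProduct_mulVec_eq_psdSqrt_mulVec {Q : Matrix (Fin p) (Fin p) ℝ} (hQ : Q.PosSemidef)
    (x : Fin p → ℝ) : x ⬝ᵥ Q *ᵥ x = psdSqrt Q *ᵥ x ⬝ᵥ psdSqrt Q *ᵥ x := by
  rw [← dotProduct_transpose_mul_self_mulVec, transpose_mul_self_psdSqrt hQ]

theorem measure_not_noise_le (hE : IsSubGaussianNoise L P₀ E)
    (hpsd : (covMat E P₀).PosSemidef) (hop : 0 < opNorm (covMat E P₀))
    (hrank : rankConst (proxy L) * n * opNorm (covMat E P₀) ≤ (covMat E P₀).trace) :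
    (Measure.pi fun _ : Fin n => P₀) {ω | ¬ ∀ v,
        (Matrix.of fun i => E (ω i))ᵀ *ᵥ v ⬝ᵥ (Matrix.of fun i => E (ω i))ᵀ *ᵥ v ≤
          16 * proxy L * (covMat E P₀).trace * (v ⬝ᵥ v)} ≤
      ENNReal.ofReal (2 * Real.exp (-n)) := by
  have hsq := transpose_mul_self_psdSqrt hpsd
  have hbounds := measure_not_mul_noise_bounds_le (n := n) hE (Matrix.one_mul _) hop
    (by rw [hsq]; exact quadForm_le_opNorm _) (by rwa [hsq])
  simp only [hsq, Matrix.one_mul] at hbounds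
  exact (measure_mono fun ω => mt fun hgood v => (hgood v).2).trans hbounds

theorem measure_not_le_design {A : Matrix (Fin p) (Fin K) ℝ} (hA : A.rank = K)
    (F : (Fin n → Ω₀) → Matrix (Fin n) (Fin K) ℝ) (hE : IsSubGaussianNoise L P₀ E)
    (hpsd : (covMat E P₀).PosSemidef) (hop : 0 < opNorm (covMat E P₀))
    (hrank : 2 * (rankConst (proxy L) * n * opNorm (covMat E P₀)) ≤ (covMat E P₀).trace)
    (hK : 2 * (K * opNorm (covMat E P₀)) ≤ (covMat E P₀).trace) :
    (Measure.pi fun _ : Fin n => P₀) {ω | ¬ ∀ v, (covMat E P₀).trace / 16 * (v ⬝ᵥ v) ≤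
        (design A (F ω) (Matrix.of fun i => E (ω i)))ᵀ *ᵥ v ⬝ᵥ
          (design A (F ω) (Matrix.of fun i => E (ω i)))ᵀ *ᵥ v} ≤
      ENNReal.ofReal (2 * Real.exp (-n)) := by
  have hunit := isUnit_det_transpose_mul_self_of_rank_eq hA
  have hsymm := isSymm_complProj A
  have hidem := isIdempotentElem_complProj hunit
  have hsq : psdSqrt (covMat E P₀) * (psdSqrt (covMat E P₀))ᵀ = covMat E P₀ := by
    rw [isSymm_psdSqrt, psdSqrt_mul_self hpsd]
  set B := complProj A * psdSqrt (covMat E P₀) with hB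
  have htrace : (covMat E P₀).trace / 2 ≤ (Bᵀ * B).trace := by
    have hsub := trace_sub_le_trace_proj_mul hsymm hidem (psdSqrt (covMat E P₀))
      (by rw [hsq]; exact quadForm_le_opNorm _)
    rw [hsq, trace_one_sub_complProj hunit, Fintype.card_fin] at hsub
    linarith
  have hB_le : ∀ x, x ⬝ᵥ (Bᵀ * B) *ᵥ x ≤ opNorm (covMat E P₀) * (x ⬝ᵥ x) := fun x => by
    rw [dotProduct_transpose_mul_self_mulVec, hB, ← Matrix.mulVec_mulVec]
    refine (mulVec_sq_le_of_isSymm_of_isIdempotentElem hsymm hidem _).trans ?_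
    rw [← dotProduct_mulVec_eq_psdSqrt_mulVec hpsd]
    exact quadForm_le_opNorm _ x
  refine (measure_mono fun ω => mt fun hgood v => ?_).trans
    (measure_not_mul_noise_bounds_le hE hB.symm hop hB_le (by linarith))
  have hproj : complProj A * (Matrix.of fun i => E (ω i))ᵀ =
      complProj A * (design A (F ω) (Matrix.of fun i => E (ω i)))ᵀ := by
    rw [design, Matrix.transpose_add, Matrix.transpose_mul, Matrix.transpose_transpose,
      Matrix.mul_add, ← Matrix.mul_assoc, complProj_mul_self hunit, Matrix.zero_mul, zero_add]
  calc _ ≤ (Bᵀ * B).trace / 8 * (v ⬝ᵥ v) :=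
        mul_le_mul_of_nonneg_right (by linarith) (dotProduct_self_nonneg v)
    _ ≤ _ := (hgood v).1
    _ ≤ _ := by
        rw [hproj, ← Matrix.mulVec_mulVec]
        exact mulVec_sq_le_of_isSymm_of_isIdempotentElem hsymm hidem _

end NoiseEvents

section FactorEvent

variable {Ω₀ : Type*} [MeasurableSpace Ω₀] {P₀ : Measure Ω₀} [IsProbabilityMeasure P₀]
  {n K : ℕ} {L : ℝ≥0}

theorem isUnit_det_psdSqrt {Q : Matrix (Fin K) (Fin K) ℝ} (hQ : Q.PosSemidef) (h : Q.rank = K) :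
    IsUnit (psdSqrt Q).det := by
  have hunit := isUnit_det_of_rank_eq (h.trans (Fintype.card_fin K).symm)
  rw [← psdSqrt_mul_self hQ, Matrix.det_mul] at hunit
  exact isUnit_of_mul_isUnit_left hunit

theorem integral_dotProduct_sq_of_psdSqrt_mulVec {Z Z' : Ω₀ → Fin K → ℝ}
    (hZ : ∀ k, MemLp (fun ω => Z ω k) 2 P₀) (hmean : ∀ k, ∫ ω, Z ω k ∂P₀ = 0)
    (hrank : (covMat Z P₀).rank = K) (hZ' : ∀ᵐ ω ∂P₀, Z ω = psdSqrt (covMat Z P₀) *ᵥ Z' ω)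
    (u : Fin K → ℝ) : ∫ ω, (u ⬝ᵥ Z' ω) ^ 2 ∂P₀ = u ⬝ᵥ u := by
  have hpsd := posSemidef_covMat hZ
  have hunit := isUnit_det_psdSqrt hpsd hrank
  have hdot : ∀ᵐ ω ∂P₀, (u ⬝ᵥ Z' ω) ^ 2 = (Z ω ⬝ᵥ (psdSqrt (covMat Z P₀))⁻¹ *ᵥ u) ^ 2 := by
    filter_upwards [hZ'] with ω hω
    rw [hω, dotProduct_comm (_ *ᵥ Z' ω), Matrix.dotProduct_mulVec, ← Matrix.mulVec_transpose,
      isSymm_psdSqrt, Matrix.mulVec_mulVec, Matrix.mul_nonsing_inv _ hunit, Matrix.one_mulVec]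
  rw [integral_congr_ae hdot, integral_dotProduct_sq hZ hmean,
    dotProduct_mulVec_eq_psdSqrt_mulVec hpsd,
    Matrix.mulVec_mulVec, Matrix.mul_nonsing_inv _ hunit, Matrix.one_mulVec]

theorem measure_not_le_factor {Z : Ω₀ → Fin K → ℝ} (hZ_memLp : ∀ k, MemLp (fun ω => Z ω k) 2 P₀)
    (hZ_mean : ∀ k, ∫ ω, Z ω k ∂P₀ = 0) (hrank : (covMat Z P₀).rank = K)
    (hZ : IsSubGaussianFactor L P₀ Z) (hn : 2 * rankConst (proxy L) * K ≤ n) :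
    (Measure.pi fun _ : Fin n => P₀) {ω | ¬ ∀ γ, (n : ℝ) / 8 * (γ ⬝ᵥ covMat Z P₀ *ᵥ γ) ≤
        (Matrix.of fun i => Z (ω i)) *ᵥ γ ⬝ᵥ (Matrix.of fun i => Z (ω i)) *ᵥ γ} ≤
      ENNReal.ofReal (2 * Real.exp (-(n / (32 * lowerTailConst (proxy L))))) := by
  obtain ⟨Z', hZ'_meas, hZ', hmean, hpsi⟩ := hZ
  have hpsd := posSemidef_covMat hZ_memLp
  have hbound := measure_not_factor_bound_le (κ := Fin n) hZ'_meas
    (isSubgaussianVec_of_vecPsi2Norm_le hZ'_meas hmean hpsi) (one_le_proxy L)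
    (fun u hu => (integral_dotProduct_sq_of_psdSqrt_mulVec hZ_memLp hZ_mean hrank hZ' u).trans hu)
    (by rwa [Fintype.card_fin, Fintype.card_fin])
  rw [Fintype.card_fin] at hbound
  refine (measure_mono_ae ?_).trans hbound
  filter_upwards [ae_pi_forall hZ'] with ω hω
  refine mt fun hgood γ => ?_
  have hfactor : (Matrix.of fun i => Z (ω i)) =
      (Matrix.of fun i => Z' (ω i)) * psdSqrt (covMat Z P₀) := by
    ext i k
    rw [Matrix.of_apply, hω i, Matrix.mul_apply_eq_vecMul, ← Matrix.mulVec_transpose,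
      isSymm_psdSqrt]
    rfl
  rw [hfactor, ← Matrix.mulVec_mulVec]
  exact dotProduct_mulVec_eq_psdSqrt_mulVec hpsd γ ▸ hgood _

end FactorEvent

section VarianceEvent

variable {Ω₀ : Type*} [MeasurableSpace Ω₀] {P₀ : Measure Ω₀} [IsProbabilityMeasure P₀]
  {n K p : ℕ} {Z : Ω₀ → Fin K → ℝ} {E : Ω₀ → Fin p → ℝ} {ε : Ω₀ → ℝ} {L : ℝ≥0}

theorem hasSubgaussianMGF_normalized_and_ae_eq (hε : IsSubGaussianResponseNoise L P₀ ε) :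
    HasSubgaussianMGF (fun ω => (√Var[ε; P₀])⁻¹ * ε ω) (proxy L) P₀ ∧
      ∀ᵐ ω ∂P₀, ε ω = √Var[ε; P₀] * ((√Var[ε; P₀])⁻¹ * ε ω) := by
  obtain ⟨ε', hε'_meas, hε', hmean, hpsi⟩ := hε
  rcases eq_or_ne (√Var[ε; P₀]) 0 with h0 | h0
  · simp only [h0, zero_mul, inv_zero] at hε' ⊢
    exact ⟨hasSubgaussianMGF_mono HasSubgaussianMGF.fun_zero zero_le, hε'⟩
  · refine ⟨(hasSubgaussianMGF_of_psi2Norm_le hε'_meas hmean hpsi).congr ?_,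
      .of_forall fun ω => (mul_inv_cancel_left₀ h0 _).symm⟩
    filter_upwards [hε'] with ω hω
    rw [hω, inv_mul_cancel_left₀ h0]

theorem measure_not_variance_le (hm : IsLatentModel P₀ Z E ε)
    (hε : IsSubGaussianResponseNoise L P₀ ε) {ρ : Type*} [Fintype ρ] {S : Matrix ρ ρ ℝ}
    (hS : S.PosSemidef) {R : (Fin n → (Fin K → ℝ) × (Fin p → ℝ)) → Matrix ρ (Fin n) ℝ}
    (hR : ∀ i j, Measurable fun q => R q i j) (s : ℝ) :
    (Measure.pi fun _ : Fin n => P₀) {ω | ¬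
        (fun i => ε (ω i)) ⬝ᵥ ((R fun i => (Z (ω i), E (ω i)))ᵀ * S *
          R fun i => (Z (ω i), E (ω i))) *ᵥ (fun i => ε (ω i)) ≤
        4 * (proxy L * Var[ε; P₀]) * s * ((R fun i => (Z (ω i), E (ω i)))ᵀ * S *
          R fun i => (Z (ω i), E (ω i))).trace} ≤ ENNReal.ofReal (Real.exp (1 / 2 - s)) := by
  obtain ⟨hsub, hscale⟩ := hasSubgaussianMGF_normalized_and_ae_eq hε
  have hindep : IndepFun (fun ω => (Z ω, E ω)) (fun ω => (√Var[ε; P₀])⁻¹ * ε ω) P₀ :=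
    (indepFun_prodMk_left hm.measurable_Z hm.measurable_E hm.measurable_ε hm.indep_Z
      hm.indep_E_ε).comp measurable_id (measurable_const_mul _)
  have hZ := hm.measurable_Z
  have hE := hm.measurable_E
  have hε_meas := hm.measurable_ε
  have htail := measure_trace_mul_lt_quadForm_le_of_indepFun (zero_lt_one.trans_le (one_le_proxy L))
    (X := fun (ω : Fin n → Ω₀) i => (Z (ω i), E (ω i))) (by fun_prop) (by fun_prop)
    (indepFun_pi (by fun_prop) (by fun_prop) hindep) (isSubgaussianVec_pi hsub)
    (measurable_transpose_mul_mul_apply hR S)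
    (fun q => by simpa using hS.conjTranspose_mul_mul_same (R q)) s
  refine (measure_mono_ae ?_).trans htail
  filter_upwards [ae_pi_forall hscale] with ω hω
  refine fun hbad => lt_of_not_ge fun hle => hbad ?_
  rw [show (fun i => ε (ω i)) = √Var[ε; P₀] • fun i => (√Var[ε; P₀])⁻¹ * ε (ω i) from funext hω,
    Matrix.mulVec_smul, dotProduct_smul, smul_dotProduct, smul_smul,
    Real.mul_self_sqrt (variance_nonneg ε P₀), smul_eq_mul]
  refine (mul_le_mul_of_nonneg_left hle (variance_nonneg ε P₀)).trans_eq ?_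
  ring

end VarianceEvent

section GoodSampleProbability

theorem exp_neg_le_inv {x : ℝ} (hx : 0 < x) : Real.exp (-x) ≤ x⁻¹ := by
  rw [Real.exp_neg]
  exact inv_anti₀ hx ((le_add_of_nonneg_right zero_le_one).trans (Real.add_one_le_exp x))

theorem exp_half_sub_log_le {x : ℝ} (hx : 0 < x) : Real.exp (1 / 2 - Real.log x) ≤ 2 / x := by
  rw [Real.exp_sub, Real.exp_log hx]
  have hsq : Real.exp (1 / 2) ^ 2 ≤ 2 ^ 2 := by
    rw [← Real.exp_nat_mul]
    norm_num
    linarith [Real.exp_one_lt_d9]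
  gcongr
  exact le_of_sq_le_sq hsq zero_le_two

theorem measure_union_le_of_le {Ω : Type*} [MeasurableSpace Ω] {P : Measure Ω} {s t : Set Ω}
    {a b : ℝ≥0∞} (hs : P s ≤ a) (ht : P t ≤ b) : P (s ∪ t) ≤ a + b :=
  (measure_union_le s t).trans (add_le_add hs ht)

variable {Ω₀ : Type*} [MeasurableSpace Ω₀] {P₀ : Measure Ω₀} [IsProbabilityMeasure P₀]
  {n K p : ℕ} {A : Matrix (Fin p) (Fin K) ℝ}
  {Z : Ω₀ → Fin K → ℝ} {E : Ω₀ → Fin p → ℝ} {ε : Ω₀ → ℝ} {L : ℝ≥0}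

theorem measurable_rightInv_design_apply (j : Fin p) (i : Fin n) :
    Measurable fun q : Fin n → (Fin K → ℝ) × (Fin p → ℝ) =>
      rightInv (design A (Matrix.of fun i => (q i).1) (Matrix.of fun i => (q i).2)) j i := by
  refine measurable_rightInv_apply (fun i j => ?_) j i
  simp only [design, Matrix.add_apply, Matrix.mul_apply, Matrix.of_apply]
  fun_prop

theorem measure_not_isGoodSample_le (hm : IsLatentModel P₀ Z E ε) (hA : A.rank = K)
    (hrank : (covMat Z P₀).rank = K) (hE : IsSubGaussianNoise L P₀ E)
    (hZ : IsSubGaussianFactor L P₀ Z) (hε : IsSubGaussianResponseNoise L P₀ ε) (hn_pos : 0 < n)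
    (hn : 2 * rankConst (proxy L) * K ≤ n) (hop : 0 < opNorm (covMat E P₀))
    (htrace : 2 * (rankConst (proxy L) * n * opNorm (covMat E P₀)) ≤ (covMat E P₀).trace)
    (hK : 2 * (K * opNorm (covMat E P₀)) ≤ (covMat E P₀).trace) :
    (Measure.pi fun _ : Fin n => P₀) {ω | ¬ IsGoodSample A (covMat Z P₀) (covMat E P₀)
        (16 * proxy L * (covMat E P₀).trace) ((covMat E P₀).trace / 16) (n / 8)
        (4 * (proxy L * Var[ε; P₀]) * Real.log n) (Matrix.of fun i => Z (ω i))
        (Matrix.of fun i => E (ω i)) fun i => ε (ω i)} ≤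
      ENNReal.ofReal ((8 + 64 * lowerTailConst (proxy L)) / n) := by
  have hSE := posSemidef_covMat hm.memLp_E
  have hSZ := posSemidef_covMat hm.memLp_Z
  have hR := measurable_rightInv_design_apply (n := n) (A := A)
  have hAR := measurable_mul_apply (fun i j => measurable_const (a := Aᵀ i j)) hR
  have hnoise := measure_not_noise_le (n := n) hE hSE hop (by linarith [hSE.trace_nonneg])
  have hdesign := measure_not_le_design hA (fun ω => Matrix.of fun i => Z (ω i)) hE hSE hop
    htrace hK
  have hfactor := measure_not_le_factor hm.memLp_Z hm.mean_Z hrank hZ hn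
  have hvar_noise := measure_not_variance_le hm hε hSE hR (Real.log n)
  have hvar_factor := measure_not_variance_le hm hε hSZ hAR (Real.log n)
  refine (measure_mono fun ω hbad => ?_).trans <|
    (measure_union_le_of_le hnoise <| measure_union_le_of_le hdesign <|
      measure_union_le_of_le hfactor <| measure_union_le_of_le hvar_noise hvar_factor).trans ?_
  · by_contra hgood
    simp only [Set.mem_union, Set.mem_ofPred_eq, not_or, not_not] at hgood
    obtain ⟨hnoise, hdesign, hfactor, hvar_noise, hvar_factor⟩ := hgood
    exact hbad ⟨hnoise, hdesign, hfactor, hvar_noise, hvar_factor⟩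
  · rw [← ENNReal.ofReal_add (by positivity) (by positivity),
      ← ENNReal.ofReal_add (by positivity) (by positivity),
      ← ENNReal.ofReal_add (by positivity) (by positivity),
      ← ENNReal.ofReal_add (by positivity) (by positivity)]
    refine ENNReal.ofReal_le_ofReal ?_
    have hθ : 0 < lowerTailConst (proxy L) := lowerTailConst_pos _
    have hn_pos' : (0 : ℝ) < n := Nat.cast_pos.2 hn_pos
    have hexp := exp_neg_le_inv hn_pos'
    have hexp_factor := exp_neg_le_inv (x := n / (32 * lowerTailConst (proxy L))) (by positivity)
    have hexp_var := exp_half_sub_log_le hn_pos'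
    calc _ ≤ 2 * (n : ℝ)⁻¹ + (2 * (n : ℝ)⁻¹ + (2 * (n / (32 * lowerTailConst (proxy L)))⁻¹ +
          (2 / n + 2 / n))) := by gcongr
      _ = _ := by field_simp; ring

end GoodSampleProbability

section RiskBound

theorem effRank_of_ne_zero {p : ℕ} {Q : Matrix (Fin p) (Fin p) ℝ} (hQ : Q ≠ 0) :
    effRank Q = Q.trace / opNorm Q :=
  if_neg hQ

theorem minNormEstimator_eq_rightInv_mulVec {Ω : Type*} {n K p : ℕ} {A : Matrix (Fin p) (Fin K) ℝ}
    {Zs : Fin n → Ω → Fin K → ℝ} {Es : Fin n → Ω → Fin p → ℝ} {ω : Ω}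
    (hX : IsUnit (design A (Matrix.of fun i => Zs i ω) (Matrix.of fun i => Es i ω) *
      (design A (Matrix.of fun i => Zs i ω) (Matrix.of fun i => Es i ω))ᵀ).det)
    (β : Fin K → ℝ) (εs : Fin n → Ω → ℝ) :
    minNormEstimator A β Zs Es εs ω =
      rightInv (design A (Matrix.of fun i => Zs i ω) (Matrix.of fun i => Es i ω)) *ᵥ
        ((Matrix.of fun i => Zs i ω) *ᵥ β + fun i => εs i ω) := by
  rw [← pinv_eq_rightInv hX, minNormEstimator]
  congr 2
  ext i j
  simp only [design, feature, Matrix.of_apply, Matrix.add_apply, Pi.add_apply, Matrix.mul_apply,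
    Matrix.mulVec, dotProduct, Matrix.transpose_apply, mul_comm]

theorem bias_add_variance_le_sq_mul {τ q r v w x m : ℝ} (hτ : 0 ≤ τ) (hx : 0 ≤ x) (hxq : x ≤ q)
    (hm : 0 ≤ m) (hmr : m ≤ r) (hv : 0 ≤ v) (hw : 0 ≤ w) :
    4 * (1 + 256 * τ) * (128 * τ * r + m) * x + 128 * τ * v + 128 * τ * (1 + 256 * τ) * w ≤
      4 * (1 + 256 * τ) ^ 2 * (q * r + v + w) := by
  have hr : 0 ≤ r := hm.trans hmr
  have hbias : 128 * τ * r + m ≤ (1 + 256 * τ) * r := by nlinarith [mul_nonneg hτ hr]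
  have hnoise : 128 * τ * v ≤ 4 * (1 + 256 * τ) ^ 2 * v :=
    mul_le_mul_of_nonneg_right (by nlinarith) hv
  have hfactor : 128 * τ * (1 + 256 * τ) * w ≤ 4 * (1 + 256 * τ) ^ 2 * w :=
    mul_le_mul_of_nonneg_right (by nlinarith) hw
  calc _ ≤ 4 * (1 + 256 * τ) * ((1 + 256 * τ) * r) * q + 4 * (1 + 256 * τ) ^ 2 * v +
        4 * (1 + 256 * τ) ^ 2 * w := by gcongr
    _ = _ := by ring

variable {Ω₀ Ω : Type*} [MeasurableSpace Ω₀] {P₀ : Measure Ω₀} [IsProbabilityMeasure P₀]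
  {n K p : ℕ} {A : Matrix (Fin p) (Fin K) ℝ} {β : Fin K → ℝ}
  {Z : Ω₀ → Fin K → ℝ} {E : Ω₀ → Fin p → ℝ} {ε : Ω₀ → ℝ}
  {Zs : Fin n → Ω → Fin K → ℝ} {Es : Fin n → Ω → Fin p → ℝ} {εs : Fin n → Ω → ℝ}

theorem IsGoodSample.risk_sub_variance_le {τ : ℝ≥0} {ω : Ω}
    (hs : IsGoodSample A (covMat Z P₀) (covMat E P₀) (16 * τ * (covMat E P₀).trace)
      ((covMat E P₀).trace / 16) (n / 8) (4 * (τ * Var[ε; P₀]) * Real.log n)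
      (Matrix.of fun i => Zs i ω) (Matrix.of fun i => Es i ω) fun i => εs i ω)
    (hm : IsLatentModel P₀ Z E ε) (hK : 1 ≤ K) (hA : A.rank = K) (hrank : (covMat Z P₀).rank = K)
    (hn : 0 < n) (hE : covMat E P₀ ≠ 0)
    (htrace : n * opNorm (covMat E P₀) ≤ (covMat E P₀).trace) :
    risk P₀ A β Z E ε (minNormEstimator A β Zs Es εs ω) - Var[ε; P₀] ≤
      4 * (1 + 256 * τ) ^ 2 *
        ((β ⬝ᵥ (covMat Z P₀ *ᵥ β)) / snr A (covMat Z P₀) (covMat E P₀) *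
            (effRank (covMat E P₀) / n) +
          Var[ε; P₀] * (n * Real.log n / effRank (covMat E P₀)) +
          Var[ε; P₀] * (K * Real.log n / n)) := by
  have hSZ := posSemidef_covMat hm.memLp_Z
  have hSE := posSemidef_covMat hm.memLp_E
  obtain ⟨x, hx, hx_le⟩ := exists_transpose_mulVec_eq hSZ hK hA hrank β
  have hop := opNorm_pos hE
  have hn_pos : (0 : ℝ) < n := Nat.cast_pos.2 hn
  have htr : 0 < (covMat E P₀).trace := (mul_pos hn_pos hop).trans_le htrace
  have : 0 ≤ Real.log n := Real.log_natCast_nonneg n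
  have hvar := variance_nonneg ε P₀
  have hexcess := hs.excess_risk_le hSZ hSE (by positivity) (by positivity) (by positivity)
    (by positivity) (quadForm_le_opNorm _) hop.le hx
    (minNormEstimator_eq_rightInv_mulVec (hs.isUnit_det (by positivity)) β εs)
  rw [risk_eq hm, add_sub_cancel_right, effRank_of_ne_zero hE, snr]
  refine hexcess.trans <| le_of_eq_of_le ?_ <| (bias_add_variance_le_sq_mul τ.coe_nonneg
    (dotProduct_self_nonneg x) hx_le hop.le ((le_div_iff₀' hn_pos).2 htrace)
    (v := Var[ε; P₀] * (n * Real.log n / ((covMat E P₀).trace / opNorm (covMat E P₀))))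
    (w := Var[ε; P₀] * (K * Real.log n / n)) (by positivity) (by positivity)).trans_eq ?_
  · simp only [Fintype.card_fin]
    field_simp
    ring
  · rw [div_div_eq_mul_div]
    field_simp

end RiskBound

section Conclusion

theorem ne_zero_of_one_lt_effRank {p : ℕ} {Q : Matrix (Fin p) (Fin p) ℝ} (h : 1 < effRank Q) :
    Q ≠ 0 := by
  rintro rfl
  exact h.ne' (if_pos rfl)

theorem mul_opNorm_lt_trace {p : ℕ} {Q : Matrix (Fin p) (Fin p) ℝ} (hQ : Q ≠ 0) {c : ℝ}
    (h : c < effRank Q) : c * opNorm Q < Q.trace := by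
  rwa [effRank_of_ne_zero hQ, lt_div_iff₀ (opNorm_pos hQ)] at h

variable {Ω₀ Ω : Type*} [MeasurableSpace Ω₀] [MeasurableSpace Ω] {P₀ : Measure Ω₀}
  [IsProbabilityMeasure P₀] {P : Measure Ω} {n K p : ℕ} {A : Matrix (Fin p) (Fin K) ℝ}
  {Z : Ω₀ → Fin K → ℝ} {E : Ω₀ → Fin p → ℝ} {ε : Ω₀ → ℝ}
  {Zs : Fin n → Ω → Fin K → ℝ} {Es : Fin n → Ω → Fin p → ℝ} {εs : Fin n → Ω → ℝ}

theorem one_sub_le_measureReal_of_compl_le [IsProbabilityMeasure P] {s : Set Ω} {a : ℝ}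
    (ha : 0 ≤ a) (h : P sᶜ ≤ ENNReal.ofReal a) : 1 - a ≤ P.real s := by
  have hunion := measureReal_union_le (μ := P) s sᶜ
  rw [Set.union_compl_self, probReal_univ] at hunion
  have hcompl : P.real sᶜ ≤ a := ENNReal.toReal_le_of_le_ofReal ha h
  linarith

theorem IsSample.measure_not_isGoodSample_eq (hs : IsSample P Zs Es εs P₀ Z E ε)
    (SZ : Matrix (Fin K) (Fin K) ℝ) (SE : Matrix (Fin p) (Fin p) ℝ) (a g h t : ℝ) :
    P {ω | ¬ IsGoodSample A SZ SE a g h t (Matrix.of fun i => Zs i ω) (Matrix.of fun i => Es i ω)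
        fun i => εs i ω} =
      (Measure.pi fun _ : Fin n => P₀) {ω | ¬ IsGoodSample A SZ SE a g h t
        (Matrix.of fun i => Z (ω i)) (Matrix.of fun i => E (ω i)) fun i => ε (ω i)} :=
  hs.identDistrib_pi.measure_mem_eq measurableSet_isGoodSample.compl

end Conclusion

end FactorRegression

theorem mainTheorem1 (L : ℝ≥0) :
    ∃ C : ℝ, 0 < C ∧ ∃ c : ℝ, 0 < c ∧ ∃ C' : ℝ, 0 < C' ∧
    ∀ (n K p : ℕ), 1 ≤ K →
    ∀ (Ω₀ : Type*) [MeasurableSpace Ω₀] (P₀ : Measure Ω₀) [IsProbabilityMeasure P₀]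
      (Ω : Type*) [MeasurableSpace Ω] (P : Measure Ω) [IsProbabilityMeasure P]
      (A : Matrix (Fin p) (Fin K) ℝ) (β : Fin K → ℝ)
      (Z : Ω₀ → Fin K → ℝ) (E : Ω₀ → Fin p → ℝ) (ε : Ω₀ → ℝ)
      (Zs : Fin n → Ω → Fin K → ℝ) (Es : Fin n → Ω → Fin p → ℝ) (εs : Fin n → Ω → ℝ),
    IsLatentModel P₀ Z E ε →
    IsSample P Zs Es εs P₀ Z E ε →
    A.rank = K →
    (covMat Z P₀).rank = K →
    IsSubGaussianNoise L P₀ E →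
    IsSubGaussianFactor L P₀ Z →
    IsSubGaussianResponseNoise L P₀ ε →
    C * (K : ℝ) < (n : ℝ) →
    C * (n : ℝ) < effRank (covMat E P₀) →
    (∃ αstar : Fin p → ℝ, IsMinOn (risk P₀ A β Z E ε) Set.univ αstar) ∧
    ∀ αstar : Fin p → ℝ, IsMinOn (risk P₀ A β Z E ε) Set.univ αstar →
      1 - c / (n : ℝ) < P.real {ω |
        risk P₀ A β Z E ε (minNormEstimator A β Zs Es εs ω) - risk P₀ A β Z E ε αstar
            ≤ risk P₀ A β Z E ε (minNormEstimator A β Zs Es εs ω) - Var[ε; P₀] ∧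
        risk P₀ A β Z E ε (minNormEstimator A β Zs Es εs ω) - Var[ε; P₀]
            ≤ C' * ((β ⬝ᵥ (covMat Z P₀ *ᵥ β)) / snr A (covMat Z P₀) (covMat E P₀)
                      * (effRank (covMat E P₀) / (n : ℝ))
                    + Var[ε; P₀] * ((n : ℝ) * Real.log n / effRank (covMat E P₀))
                    + Var[ε; P₀] * ((K : ℝ) * Real.log n / (n : ℝ)))} := by
  have hr : 0 < rankConst (proxy L) := rankConst_pos (one_le_proxy L)
  have hθ : 0 < lowerTailConst (proxy L) := lowerTailConst_pos _
  refine ⟨2 * rankConst (proxy L) + 2, by positivity, 9 + 64 * lowerTailConst (proxy L),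
    by positivity, 4 * (1 + 256 * proxy L) ^ 2, by positivity, ?_⟩
  intro n K p hK Ω₀ _ P₀ _ Ω _ P _ A β Z E ε Zs Es εs hm hs hA hrank hE hZ hε hn hre
  refine ⟨exists_isMinOn_risk hm, fun αstar _ => ?_⟩
  have hK_le : (K : ℝ) ≤ n := by nlinarith
  have hn_one : (1 : ℝ) ≤ n := (Nat.one_le_cast.2 hK).trans hK_le
  have hn_pos : 0 < n := Nat.one_le_cast.1 hn_one
  have hE_ne : covMat E P₀ ≠ 0 := ne_zero_of_one_lt_effRank (by nlinarith)
  have hop : 0 < opNorm (covMat E P₀) := opNorm_pos hE_ne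
  have htrace := mul_opNorm_lt_trace hE_ne hre
  have hK_op : K * opNorm (covMat E P₀) ≤ n * opNorm (covMat E P₀) := by gcongr
  have hn_op : 0 < n * opNorm (covMat E P₀) := by positivity
  have hr_op : 0 < rankConst (proxy L) * n * opNorm (covMat E P₀) := by positivity
  have hbad := hs.measure_not_isGoodSample_eq .. ▸ measure_not_isGoodSample_le (A := A) hm hA hrank
    hE hZ hε hn_pos (by nlinarith) hop (by linarith) (by linarith)
  refine lt_of_lt_of_le ?_ (one_sub_le_measureReal_of_compl_le (by positivity)
    ((measure_mono fun ω => mt fun hgood => ⟨?_, ?_⟩).trans hbad))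
  · gcongr
    linarith
  · linarith [variance_le_risk (A := A) (β := β) hm αstar]
  · exact hgood.risk_sub_variance_le hm hK hA hrank hn_pos hE_ne (by linarith)
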